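/- Conventions. A total NP search problem is a relation $S\subseteq\{0,1\}^*\times\{0,1\}^*$ such that $(x,y)\in S$ is decidable in time polynomial in $|x|+|y|$, and for some polynomial $q$ every $x$ has some $y$ with $(x,y)\in S$ and $|y|\le q(|x|)$. A search problem $S$ is reducible to $T$ if there are polynomial-time computable functions $F$ and $H$ such that for all $x,y\in\{0,1\}^*$: if $(F(x),y)\in T$ then $(x,H(x,y))\in S$. Problems are given by their instances and, for each instance, its solutions, under a standard encoding by bit strings (circuits are encoded as lists of gates, with length polynomially related to their size; the numbers $s,id,g,t,x,y$ below are written in binary); every string is a solution of a string that does not encode an instance. We write $[m]=\{0,\dots,m-1\}$, $\mathrm{bc}$ for the map from $\{0,1\}^k$ to $[2^k]$ that reads a string as a binary number (most significant bit first), and $\mathrm{bd}$ for its inverse. Collision. Instance: a Boolean circuit $C$ with $n$ inputs and $m$ outputs, $m<n$. Solution: distinct $u,v\in\{0,1\}^n$ with $C(u)=C(v)$. $\mathsf{PWPP}$ is the class of all total NP search problems reducible to Collision. A search problem is $\mathsf{PWPP}$-complete if it belongs to $\mathsf{PWPP}$ and every problem in $\mathsf{PWPP}$ is reducible to it. DLog.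 Instance: a tuple $(s,f,id,g,t)$, where $s\ge 2$ is an integer, $f$ is a Boolean circuit with $2\ell$ inputs and $\ell$ outputs, $\ell=\lceil\log_2 s\rceil$, and $id,g,t\in[s]$. Put $f_{\mathbb G}(x,y)=\mathrm{bc}(f(\mathrm{bd}(x),\mathrm{bd}(y)))$ for $x,y\in[2^\ell]$. For $x\in[s]$, let $\mathcal I_{\mathbb G}(x)\in[2^\ell]$ be computed by square-and-multiply: start with $r=\mathrm{bd}(id)$; for each bit of the binary representation of $x$ without leading zeroes (the single digit $0$ for $x=0$), from the most significant to the least significant, replace $r$ by $f(r,r)$ and then, if the bit is $1$, replace $r$ by $f(\mathrm{bd}(g),r)$; finally return $\mathrm{bc}(r)$. Solution: one of the following: 1. $x\in[s]$ such that $\mathcal I_{\mathbb G}(x)=t$; 2. $x,y\in[s]$ such that $f_{\mathbb G}(x,y)\ge s$; 3. distinct $x,y\in[s]$ such that $\mathcal I_{\mathbb G}(x)=\mathcal I_{\mathbb G}(y)$; 4. distinct $x,y\in[s]$ such that $f_{\mathbb G}(t,\mathcal I_{\mathbb G}(x))=f_{\mathbb G}(t,\mathcal I_{\mathbb G}(y))$;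 5. $x,y\in[s]$ such that $\mathcal I_{\mathbb G}(x)=f_{\mathbb G}(t,\mathcal I_{\mathbb G}(y))$ and $\mathcal I_{\mathbb G}(x-y \bmod s)\ne t$. Theorem. The search problem DLog is $\mathsf{PWPP}$-complete. -/

import Mathlib

namespace TotalSearch

/-! ### Polynomial time, total NP search problems, reductions -/

/-- `f : {0,1}* → {0,1}*` is computed by a Turing machine in time polynomial in the input length. -/
def PolyTime (f : List Bool → List Bool) : Prop :=
  Nonempty (Turing.TM2ComputableInPolyTime id id f)

/-- The encoding of a pair of strings `(x, y)` as a single string of length `|x| + |y|`. -/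
def encodePair : List Bool × List Bool → List (Bool ⊕ Bool) :=
  (Computability.encodingProd (Computability.encodingList Bool)
    (Computability.encodingList Bool)).encode

/-- `f : {0,1}* × {0,1}* → {0,1}*` is computable in time polynomial in `|x| + |y|`. -/
def PolyTime₂ (f : List Bool → List Bool → List Bool) : Prop :=
  Nonempty (Turing.TM2ComputableInPolyTime encodePair id (fun p => f p.1 p.2))

/-- The relation `S` on strings is decidable in time polynomial in `|x| + |y|`. -/
def PolyTimeDecidable (S : List Bool → List Bool → Prop) : Prop :=
  ∃ d : List Bool × List Bool → Bool, (∀ x y, d (x, y) = true ↔ S x y) ∧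
    Nonempty (Turing.TM2ComputableInPolyTime encodePair Computability.encodeBool d)

/-- `S` is a total NP search problem. -/
structure IsTFNP (S : List Bool → List Bool → Prop) : Prop where
  decidable : PolyTimeDecidable S
  total : ∃ q : Polynomial ℕ, ∀ x, ∃ y, S x y ∧ y.length ≤ q.eval x.length

/-- `S` is (polynomial-time many-one) reducible to `T`: instances are translated by `f`, and
solutions of the instance `f x` of `T` are translated back by `g`, given the instance `x`. -/
def Reducible (S T : List Bool → List Bool → Prop) : Prop :=
  ∃ (f : List Bool → List Bool) (g : List Bool → List Bool → List Bool),
    PolyTime f ∧ PolyTime₂ g ∧ ∀ x y, T (f x) y → S x (g x y)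

/-- The search problem given by a set of valid instances and, for every valid instance, a set of
admissible solutions; instances and solutions are presented as strings. Every string is a solution
of a string that does not encode a valid instance. -/
def searchProblem {I A : Type} (encI : I → List Bool) (encA : A → List Bool)
    (Valid : I → Prop) (Sol : I → A → Prop) : List Bool → List Bool → Prop :=
  fun x y => ∀ i, Valid i → encI i = x → ∃ a, Sol i a ∧ encA a = y

/-! ### Binary representation and self-delimiting codes -/

/-- Bit composition: the number with binary representation `u`, most significant bit first. -/
def bc (u : List Bool) : ℕ := u.foldl (fun a b => 2 * a + b.toNat) 0

/-- Bit decomposition: the binary representation of `a < 2 ^ k` of length `k`, with leading zeroes,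
most significant bit first. -/
def bd (k a : ℕ) : List Bool := ((List.range k).map a.testBit).reverse

/-- The binary representation of `a` without leading zeroes; that of `0` is the digit `0`. -/
def bd₀ (a : ℕ) : List Bool := bd (Nat.log 2 a + 1) a

/-- Self-delimiting code of a string: each bit is preceded by `1`, and a `0` ends the code. -/
def block (u : List Bool) : List Bool := u.flatMap (fun b => [true, b]) ++ [false]

/-- Self-delimiting unary code of a number. -/
def unary (n : ℕ) : List Bool := List.replicate n true ++ [false]

/-- Self-delimiting code of a list, given a self-delimiting code of its members. -/
def encodeList {α : Type} (enc : α → List Bool) (l : List α) : List Bool :=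
  l.flatMap (fun a => true :: enc a) ++ [false]

/-! ### Boolean circuits -/

/-- A gate of a Boolean circuit: an input variable, a constant, or a Boolean connective applied to
the values of gates, which are referred to by their position in the list of all gates. -/
inductive Gate
  | input (i : ℕ)
  | const (b : Bool)
  | neg (i : ℕ)
  | conj (i j : ℕ)
  | disj (i j : ℕ)

/-- The value of a gate on input `u`, where `vals` lists the values of the earlier gates. -/
def Gate.value (u vals : List Bool) : Gate → Bool
  | .input i => u.getD i false
  | .const b => b
  | .neg i => !(vals.getD i false)
  | .conj i j => vals.getD i false && vals.getD j false
  | .disj i j => vals.getD i false || vals.getD j false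

/-- In a circuit with `n` inputs, the gate at position `k` may only refer to the `n` input variables
and to earlier gates. -/
def Gate.WellFormed (n k : ℕ) : Gate → Prop
  | .input i => i < n
  | .const _ => True
  | .neg i => i < k
  | .conj i j => i < k ∧ j < k
  | .disj i j => i < k ∧ j < k

def Gate.encode : Gate → List Bool
  | .input i => unary 0 ++ unary i
  | .const b => unary 1 ++ [b]
  | .neg i => unary 2 ++ unary i
  | .conj i j => unary 3 ++ unary i ++ unary j
  | .disj i j => unary 4 ++ unary i ++ unary j

/-- A Boolean circuit: the number of inputs, the gates in topological order, and the list of the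
positions of the output gates. -/
structure Circuit where
  numInputs : ℕ
  gates : List Gate
  outputs : List ℕ

namespace Circuit

def numOutputs (C : Circuit) : ℕ := C.outputs.length

def WellFormed (C : Circuit) : Prop :=
  (∀ (k : ℕ) (g : Gate), C.gates[k]? = some g → g.WellFormed C.numInputs k) ∧
    ∀ o ∈ C.outputs, o < C.gates.length

/-- The values of all gates on input `u`. -/
def values (C : Circuit) (u : List Bool) : List Bool :=
  C.gates.foldl (fun vals g => vals ++ [g.value u vals]) []

/-- The output of the circuit on input `u`. -/
def eval (C : Circuit) (u : List Bool) : List Bool :=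
  C.outputs.map (fun o => (C.values u).getD o false)

/-- The number of inputs and the positions of gates are written in unary, so that the length of the
code is polynomially related to the size of the circuit. -/
def encode (C : Circuit) : List Bool :=
  unary C.numInputs ++ encodeList Gate.encode C.gates ++ encodeList unary C.outputs

end Circuit

/-! ### The problem Collision and the class PWPP -/

/-- An instance is a Boolean circuit with `n` inputs and `m < n` outputs; a solution is a pair of
distinct strings of length `n` with the same image. -/
def Collision : List Bool → List Bool → Prop :=
  searchProblem Circuit.encode
    (fun p : List Bool × List Bool => block p.1 ++ block p.2)
    (fun C => C.WellFormed ∧ C.numOutputs < C.numInputs)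
    (fun C p => p.1.length = C.numInputs ∧ p.2.length = C.numInputs ∧ p.1 ≠ p.2 ∧
      C.eval p.1 = C.eval p.2)

/-- The class PWPP of all total NP search problems reducible to Collision. -/
def PWPP : Set (List Bool → List Bool → Prop) :=
  {S | IsTFNP S ∧ Reducible S Collision}

def IsPWPPHard (T : List Bool → List Bool → Prop) : Prop :=
  ∀ S ∈ PWPP, Reducible S T

def IsPWPPComplete (T : List Bool → List Bool → Prop) : Prop :=
  T ∈ PWPP ∧ IsPWPPHard T

/-! ### The problem DLog -/

/-- A tuple `(s, f, id, g, t)`. -/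
structure DLogInstance where
  s : ℕ
  f : Circuit
  id : ℕ
  g : ℕ
  t : ℕ

namespace DLogInstance

/-- The number `⌈log₂ s⌉` of bits that represent an element of `[s]`. -/
def len (G : DLogInstance) : ℕ := Nat.clog 2 G.s

def Valid (G : DLogInstance) : Prop :=
  2 ≤ G.s ∧ G.f.WellFormed ∧ G.f.numInputs = 2 * G.len ∧ G.f.numOutputs = G.len ∧
    G.id < G.s ∧ G.g < G.s ∧ G.t < G.s

/-- The operation computed by the circuit, on strings of length `⌈log₂ s⌉`. -/
def opBits (G : DLogInstance) (u v : List Bool) : List Bool := G.f.eval (u ++ v)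

/-- The operation computed by the circuit, on numbers. -/
def op (G : DLogInstance) (x y : ℕ) : ℕ := bc (G.opBits (bd G.len x) (bd G.len y))

/-- The indexing function: the `x`-th power of `g`, computed by square-and-multiply from the most
significant bit of `x`, starting with `id`. -/
def index (G : DLogInstance) (x : ℕ) : ℕ :=
  bc ((bd₀ x).foldl
    (fun r b => if b then G.opBits (bd G.len G.g) (G.opBits r r) else G.opBits r r)
    (bd G.len G.id))

def encode (G : DLogInstance) : List Bool :=
  block (bd₀ G.s) ++ G.f.encode ++ block (bd₀ G.id) ++ block (bd₀ G.g) ++ block (bd₀ G.t)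

end DLogInstance

/-- A candidate solution of an instance of DLog: a number or a pair of numbers. -/
inductive DLogAnswer
  | single (x : ℕ)
  | pair (x y : ℕ)

def DLogAnswer.encode : DLogAnswer → List Bool
  | .single x => block (bd₀ x)
  | .pair x y => block (bd₀ x) ++ block (bd₀ y)

/-- The five types of solutions. For `y < s`, the number `(x + (s - y)) % s` is the remainder of the
integer `x - y` modulo `s`. -/
inductive DLogInstance.IsSolution (G : DLogInstance) : DLogAnswer → Prop
  | log (x : ℕ) (hx : x < G.s) (h : G.index x = G.t) : G.IsSolution (.single x)
  | outOfRange (x y : ℕ) (hx : x < G.s) (hy : y < G.s) (h : G.s ≤ G.op x y) :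
      G.IsSolution (.pair x y)
  | indexCollision (x y : ℕ) (hx : x < G.s) (hy : y < G.s) (hne : x ≠ y)
      (h : G.index x = G.index y) : G.IsSolution (.pair x y)
  | cosetCollision (x y : ℕ) (hx : x < G.s) (hy : y < G.s) (hne : x ≠ y)
      (h : G.op G.t (G.index x) = G.op G.t (G.index y)) : G.IsSolution (.pair x y)
  | notHomomorphic (x y : ℕ) (hx : x < G.s) (hy : y < G.s)
      (h : G.index x = G.op G.t (G.index y)) (hne : G.index ((x + (G.s - y)) % G.s) ≠ G.t) :
      G.IsSolution (.pair x y)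

/-- The search problem DLog. -/
def DLog : List Bool → List Bool → Prop :=
  searchProblem DLogInstance.encode DLogAnswer.encode DLogInstance.Valid DLogInstance.IsSolution

end TotalSearch

/-! Write I for the indexing function and ℓ = ⌈log₂ s⌉.

DLog is total: unless f leads out of [s] (type 2), I maps [s] to itself. Then either I is onto and t
has a logarithm (type 1), or I is not injective (type 3). This is
`DLogInstance.Valid.exists_isSolution`.

DLog reduces to Collision. Put h₀(r) = I(r) and h₁(r) = f(t, I(r)). For a string u of ℓ + 1 bits,
start with id and apply the functions selected by the bits of u. This maps ℓ + 1 bits to ℓ bits, and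
`DLogInstance.chainCircuit` computes it. Tracing a collision back to the common start yields (x, b)
≠ (y, b') with equal images under h_b and h_b'. If b = b' = 0 this is a solution of type 3, if b =
b' = 1 of type 4. If b ≠ b', say I(x) = f(t, I(y)), then either I(x - y mod s) ≠ t, which is type 5,
or x - y mod s is a logarithm of t. The argument needs all values to lie in [s]; otherwise some
application of f to values of the computation leaves [s], which is type 2. See
`DLogInstance.Valid.exists_isSolution_of_chain`.

Collision reduces to DLog. From C with n inputs form two maps on n-bit strings, w ↦ 0 C(b C(w)) for
b = 0, 1, with outputs of C padded. Iterating them from 10…0, which is in the image of neither,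
gives a hash of strings of arbitrary length; any collision of the hash gives one of C
(`Circuit.Compresses.exists_collision`). Let s = 2^(n+2), so that every string p q w of n + 2 bits
is an element and type 2 is impossible. The operation is built so that square-and-multiply hashes
the digits of the exponent. Powers of g have p = 0. Squaring turns 0 q w into a string with q = 1,
which announces a digit 0 that is hashed only at the next squaring; multiplication by g hashes a
digit 1 in its place and sets q = 0. Multiplication by t only sets p = 1, and t itself has p = 1. So
types 1 and 5 are impossible, and types 3 and 4 give two distinct exponents of equal index, hence a
collision of the hash (`Circuit.Compresses.exists_hash_eq_of_isSolution`).

Both reductions recover a solution by testing polynomially many candidates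
(`reducible_of_candidates`), so it is enough to prove that one of them works.

Most of the length goes into polynomial time. `PTF` is a class of functions on types encoded by
binary trees; it is closed under composition, pairing, case distinction and folds with bounded
accumulators. It agrees with polynomial-time Turing machines in both directions (`polyTime_iff`,
`polyTime₂_iff`): stack programs compile to machines, and machines are simulated by iterating a
`PTF` step. The second direction is needed because hardness quantifies over reductions that are
given as arbitrary machines. -/

namespace TotalSearch

open Turing

/-! ### Structured stack programs and their compilation to `TM2` machines -/

section Programs

variable {K : Type} [DecidableEq K] {Γ : K → Type} {σ : Type}

/-- Structured programs over finitely many stacks and a register. -/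
inductive Prog (Γ : K → Type) (σ : Type)
  | skip
  | push (k : K) (f : σ → Γ k)
  | pop (k : K) (f : σ → Option (Γ k) → σ)
  | seq (P Q : Prog Γ σ)
  | ite (p : σ → Bool) (P Q : Prog Γ σ)
  | loop (p : σ → Bool) (P : Prog Γ σ)

/-- `Exec P v S v' S' n`: the program `P`, started with register `v` and stacks `S`, ends with
register `v'` and stacks `S'` after at most `n` steps. -/
inductive Exec : Prog Γ σ → σ → (∀ k, List (Γ k)) → σ → (∀ k, List (Γ k)) → ℕ → Prop
  | skip (v S) : Exec .skip v S v S 1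
  | push (k f v S) : Exec (.push k f) v S v (Function.update S k (f v :: S k)) 1
  | pop (k f v S) :
      Exec (.pop k f) v S (f v (S k).head?) (Function.update S k (S k).tail) 1
  | seq {P Q v S v₁ S₁ v₂ S₂ m n} (h₁ : Exec P v S v₁ S₁ m) (h₂ : Exec Q v₁ S₁ v₂ S₂ n) :
      Exec (.seq P Q) v S v₂ S₂ (m + n)
  | ite_true {p P Q v S v₁ S₁ n} (hp : p v = true) (h : Exec P v S v₁ S₁ n) :
      Exec (.ite p P Q) v S v₁ S₁ (n + 1)
  | ite_false {p P Q v S v₁ S₁ n} (hp : p v = false) (h : Exec Q v S v₁ S₁ n) :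
      Exec (.ite p P Q) v S v₁ S₁ (n + 1)
  | loop_true {p P v S v₁ S₁ v₂ S₂ m n} (hp : p v = true) (h₁ : Exec P v S v₁ S₁ m)
      (h₂ : Exec (.loop p P) v₁ S₁ v₂ S₂ n) : Exec (.loop p P) v S v₂ S₂ (m + n + 1)
  | loop_false {p P v S} (hp : p v = false) : Exec (.loop p P) v S v S 1
  | mono {P v S v₁ S₁ m n} (h : Exec P v S v₁ S₁ m) (hn : m ≤ n) : Exec P v S v₁ S₁ n

/-- The labels of the compiled program. -/
def Prog.Label : Prog Γ σ → Type
  | skip => Unit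
  | push _ _ => Unit
  | pop _ _ => Unit
  | seq P Q => P.Label ⊕ Q.Label
  | ite _ P Q => Option (P.Label ⊕ Q.Label)
  | loop _ P => Option P.Label

/-- The set of labels of a program is finite. -/
@[reducible] def Prog.fintypeLabel : (P : Prog Γ σ) → Fintype P.Label
  | skip => inferInstanceAs (Fintype Unit)
  | push _ _ => inferInstanceAs (Fintype Unit)
  | pop _ _ => inferInstanceAs (Fintype Unit)
  | seq P Q =>
    letI := P.fintypeLabel
    letI := Q.fintypeLabel
    inferInstanceAs (Fintype (P.Label ⊕ Q.Label))
  | ite _ P Q =>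
    letI := P.fintypeLabel
    letI := Q.fintypeLabel
    inferInstanceAs (Fintype (Option (P.Label ⊕ Q.Label)))
  | loop _ P =>
    letI := P.fintypeLabel
    inferInstanceAs (Fintype (Option P.Label))

/-- The label at which the compiled program starts. -/
def Prog.entry : (P : Prog Γ σ) → P.Label
  | skip => ()
  | push _ _ => ()
  | pop _ _ => ()
  | seq P _ => Sum.inl P.entry
  | ite _ _ _ => none
  | loop _ _ => none

/-- The statements of the compiled program, inside a machine with labels `Λ`. -/
def Prog.stmt {Λ : Type} : (P : Prog Γ σ) → (P.Label → Λ) → Λ → P.Label → TM2.Stmt Γ Λ σ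
  | skip, _, exit, _ => .goto fun _ => exit
  | push k f, _, exit, _ => .push k f (.goto fun _ => exit)
  | pop k f, _, exit, _ => .pop k f (.goto fun _ => exit)
  | seq P Q, emb, exit, l =>
    match l with
    | .inl l => P.stmt (fun l => emb (.inl l)) (emb (.inr Q.entry)) l
    | .inr l => Q.stmt (fun l => emb (.inr l)) exit l
  | ite p P Q, emb, exit, l =>
    match l with
    | none => .branch p (.goto fun _ => emb (some (.inl P.entry)))
        (.goto fun _ => emb (some (.inr Q.entry)))
    | some (.inl l) => P.stmt (fun l => emb (some (.inl l))) exit l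
    | some (.inr l) => Q.stmt (fun l => emb (some (.inr l))) exit l
  | loop p P, emb, exit, l =>
    match l with
    | none => .branch p (.goto fun _ => emb (some P.entry)) (.goto fun _ => exit)
    | some l => P.stmt (fun l => emb (some l)) (emb none) l

/-- `c` leads to `c'` in exactly `t` steps. -/
def StepsTo {Λ : Type} (M : Λ → TM2.Stmt Γ Λ σ) (t : ℕ) (c c' : TM2.Cfg Γ Λ σ) : Prop :=
  (flip bind (TM2.step M))^[t] (some c) = some c'

theorem StepsTo.trans {Λ : Type} {M : Λ → TM2.Stmt Γ Λ σ} {s t : ℕ} {c c' c'' : TM2.Cfg Γ Λ σ}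
    (h₁ : StepsTo M s c c') (h₂ : StepsTo M t c' c'') : StepsTo M (s + t) c c'' := by
  unfold StepsTo at *
  rw [Nat.add_comm, Function.iterate_add_apply, h₁, h₂]

theorem StepsTo.one {Λ : Type} {M : Λ → TM2.Stmt Γ Λ σ} {l : Λ} {v : σ} {S : ∀ k, List (Γ k)}
    {c : TM2.Cfg Γ Λ σ} (h : TM2.stepAux (M l) v S = c) : StepsTo M 1 ⟨some l, v, S⟩ c := by
  simp [StepsTo, flip, TM2.step, h]

/-- Induction on the execution rather than on the program, because a loop calls itself again. The
machine stays the same; a subprogram is seen through a restricted embedding of labels, with the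
entry of whatever follows as its exit. The body of a loop exits to the test of that loop. -/
theorem Exec.stepsTo {P : Prog Γ σ} {v S v' S' n} (h : Exec P v S v' S' n) :
    ∀ {Λ : Type} (M : Λ → TM2.Stmt Γ Λ σ) (emb : P.Label → Λ) (exit : Λ),
      (∀ l, M (emb l) = P.stmt emb exit l) →
      ∃ t ≤ n, StepsTo M t ⟨some (emb P.entry), v, S⟩ ⟨some exit, v', S'⟩ := by
  induction h with
  | skip v S =>
    intro Λ M emb exit hM
    exact ⟨1, le_rfl, .one (by rw [hM]; rfl)⟩
  | push k f v S =>
    intro Λ M emb exit hM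
    exact ⟨1, le_rfl, .one (by rw [hM]; rfl)⟩
  | pop k f v S =>
    intro Λ M emb exit hM
    exact ⟨1, le_rfl, .one (by rw [hM]; rfl)⟩
  | @seq P Q v S v₁ S₁ v₂ S₂ m n _ _ ih₁ ih₂ =>
    intro Λ M emb exit hM
    obtain ⟨t₁, ht₁, hs₁⟩ := ih₁ M (fun l => emb (.inl l)) (emb (.inr Q.entry))
      (fun l => hM (.inl l))
    obtain ⟨t₂, ht₂, hs₂⟩ := ih₂ M (fun l => emb (.inr l)) exit (fun l => hM (.inr l))
    exact ⟨t₁ + t₂, by omega, hs₁.trans hs₂⟩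
  | @ite_true p P Q v S v₁ S₁ n hp _ ih =>
    intro Λ M emb exit hM
    obtain ⟨t, ht, hs⟩ := ih M (fun l => emb (some (.inl l))) exit (fun l => hM (some (.inl l)))
    refine ⟨1 + t, by omega, StepsTo.trans (.one ?_) hs⟩
    have : M (emb (Prog.ite p P Q).entry) = _ := hM none
    rw [this]
    simp [Prog.stmt, hp]
  | @ite_false p P Q v S v₁ S₁ n hp _ ih =>
    intro Λ M emb exit hM
    obtain ⟨t, ht, hs⟩ := ih M (fun l => emb (some (.inr l))) exit (fun l => hM (some (.inr l)))
    refine ⟨1 + t, by omega, StepsTo.trans (.one ?_) hs⟩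
    have : M (emb (Prog.ite p P Q).entry) = _ := hM none
    rw [this]
    simp [Prog.stmt, hp]
  | @loop_true p P v S v₁ S₁ v₂ S₂ m n hp _ _ ih₁ ih₂ =>
    intro Λ M emb exit hM
    obtain ⟨t₁, ht₁, hs₁⟩ := ih₁ M (fun l => emb (some l)) (emb none) (fun l => hM (some l))
    obtain ⟨t₂, ht₂, hs₂⟩ := ih₂ M emb exit hM
    refine ⟨1 + (t₁ + t₂), by omega, StepsTo.trans (.one ?_) (hs₁.trans hs₂)⟩
    have : M (emb (Prog.loop p P).entry) = _ := hM none
    rw [this]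
    simp [Prog.stmt, hp]
  | @loop_false p P v S hp =>
    intro Λ M emb exit hM
    refine ⟨1, le_rfl, .one ?_⟩
    have : M (emb (Prog.loop p P).entry) = _ := hM none
    rw [this]
    simp [Prog.stmt, hp]
  | mono _ hn ih =>
    intro Λ M emb exit hM
    obtain ⟨t, ht, hs⟩ := ih M emb exit hM
    exact ⟨t, ht.trans hn, hs⟩

theorem Exec.seq' {P Q : Prog Γ σ} {v S v₁ S₁ v₂ S₂} {m n N : ℕ} (h₁ : Exec P v S v₁ S₁ m)
    (h₂ : Exec Q v₁ S₁ v₂ S₂ n) (hN : m + n ≤ N) : Exec (.seq P Q) v S v₂ S₂ N :=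
  (h₁.seq h₂).mono hN

end Programs

/-! ### Binary trees on the work stack -/

/-- Binary trees, the data on which polynomial-time functions operate. -/
inductive BTree
  | nil
  | cons (a b : BTree)

/-- The prefix code of a tree. -/
def BTree.code : BTree → List Bool
  | nil => [false]
  | cons a b => true :: (a.code ++ b.code)

/-- The stacks of the machines that are constructed here. -/
inductive Stk
  | inp | out | work | left | right | count
  deriving DecidableEq

instance : Fintype Stk :=
  ⟨{.inp, .out, .work, .left, .right, .count}, by intro k; cases k <;> simp⟩

/-- All stacks but the input stack hold bits. -/
abbrev Alph (A : Type) : Stk → Type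
  | .inp => A
  | .out => Bool
  | .work => Bool
  | .left => Bool
  | .right => Bool
  | .count => Bool

/-- The register holds the item that was popped last. -/
abbrev Reg := Option (Bool × Bool)

section Store

variable {A : Type}

abbrev BProg (A : Type) := Prog (Alph A) Reg

abbrev Store (A : Type) := ∀ k, List (Alph A k)

def store (i : List A) (o w l r c : List Bool) : Store A
  | .inp => i
  | .out => o
  | .work => w
  | .left => l
  | .right => r
  | .count => c

variable (i : List A) (o w l r c : List Bool)

@[simp] theorem store_inp : store i o w l r c .inp = i := rfl
@[simp] theorem store_out : store i o w l r c .out = o := rfl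
@[simp] theorem store_work : store i o w l r c .work = w := rfl
@[simp] theorem store_left : store i o w l r c .left = l := rfl
@[simp] theorem store_right : store i o w l r c .right = r := rfl
@[simp] theorem store_count : store i o w l r c .count = c := rfl

@[simp] theorem update_inp (x : List A) :
    Function.update (store i o w l r c) .inp x = store x o w l r c := by
  funext k; cases k <;> rfl
@[simp] theorem update_out (x : List Bool) :
    Function.update (store i o w l r c) .out x = store i x w l r c := by
  funext k; cases k <;> rfl
@[simp] theorem update_work (x : List Bool) :
    Function.update (store i o w l r c) .work x = store i o x l r c := by
  funext k; cases k <;> rfl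
@[simp] theorem update_left (x : List Bool) :
    Function.update (store i o w l r c) .left x = store i o w x r c := by
  funext k; cases k <;> rfl
@[simp] theorem update_right (x : List Bool) :
    Function.update (store i o w l r c) .right x = store i o w l x c := by
  funext k; cases k <;> rfl
@[simp] theorem update_count (x : List Bool) :
    Function.update (store i o w l r c) .count x = store i o w l r x := by
  funext k; cases k <;> rfl

end Store

/-! ### Routines on trees -/

section Routines

variable {A : Type}

/-- The bit that was popped last. -/
def Reg.bit : Reg → Bool
  | some (_, b) => b
  | none => false

def Reg.isSome (v : Reg) : Bool := Option.isSome v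

def popBit (_ : Reg) (o : Option Bool) : Reg := o.map fun b => (false, b)

namespace BProg

abbrev popWork : BProg A := .pop .work popBit
abbrev popLeft : BProg A := .pop .left popBit
abbrev popRight : BProg A := .pop .right popBit
abbrev popCount : BProg A := .pop .count popBit
abbrev pushWork (f : Reg → Bool) : BProg A := .push .work f
abbrev pushLeft (f : Reg → Bool) : BProg A := .push .left f
abbrev pushRight (f : Reg → Bool) : BProg A := .push .right f
abbrev pushCount (f : Reg → Bool) : BProg A := .push .count f

end BProg

open BProg

variable (i : List A) (o w l r c : List Bool) (v : Reg)

theorem exec_popWork (b : Bool) :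
    Exec popWork v (store i o (b :: w) l r c) (some (false, b)) (store i o w l r c) 1 := by
  simpa [popBit] using Exec.pop (Γ := Alph A) .work popBit v (store i o (b :: w) l r c)

theorem exec_popLeft (b : Bool) :
    Exec popLeft v (store i o w (b :: l) r c) (some (false, b)) (store i o w l r c) 1 := by
  simpa [popBit] using Exec.pop (Γ := Alph A) .left popBit v (store i o w (b :: l) r c)

theorem exec_popLeft_nil :
    Exec popLeft v (store i o w [] r c) none (store i o w [] r c) 1 := by
  simpa [popBit] using Exec.pop (Γ := Alph A) .left popBit v (store i o w [] r c)

theorem exec_popRight (b : Bool) :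
    Exec popRight v (store i o w l (b :: r) c) (some (false, b)) (store i o w l r c) 1 := by
  simpa [popBit] using Exec.pop (Γ := Alph A) .right popBit v (store i o w l (b :: r) c)

theorem exec_popRight_nil :
    Exec popRight v (store i o w l [] c) none (store i o w l [] c) 1 := by
  simpa [popBit] using Exec.pop (Γ := Alph A) .right popBit v (store i o w l [] c)

theorem exec_popCount (b : Bool) :
    Exec popCount v (store i o w l r (b :: c)) (some (false, b)) (store i o w l r c) 1 := by
  simpa [popBit] using Exec.pop (Γ := Alph A) .count popBit v (store i o w l r (b :: c))

theorem exec_popCount_nil :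
    Exec popCount v (store i o w l r []) none (store i o w l r []) 1 := by
  simpa [popBit] using Exec.pop (Γ := Alph A) .count popBit v (store i o w l r [])

theorem exec_pushWork (f : Reg → Bool) :
    Exec (pushWork f) v (store i o w l r c) v (store i o (f v :: w) l r c) 1 := by
  simpa using Exec.push (Γ := Alph A) .work f v (store i o w l r c)

theorem exec_pushLeft (f : Reg → Bool) :
    Exec (pushLeft f) v (store i o w l r c) v (store i o w (f v :: l) r c) 1 := by
  simpa using Exec.push (Γ := Alph A) .left f v (store i o w l r c)

theorem exec_pushRight (f : Reg → Bool) :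
    Exec (pushRight f) v (store i o w l r c) v (store i o w l (f v :: r) c) 1 := by
  simpa using Exec.push (Γ := Alph A) .right f v (store i o w l r c)

theorem exec_pushCount (f : Reg → Bool) :
    Exec (pushCount f) v (store i o w l r c) v (store i o w l r (f v :: c)) 1 := by
  simpa using Exec.push (Γ := Alph A) .count f v (store i o w l r c)

theorem exec_popCount' :
    Exec popCount v (store i o w l r c) (popBit v c.head?) (store i o w l r c.tail) 1 := by
  simpa using Exec.pop (Γ := Alph A) .count popBit v (store i o w l r c)

namespace BProg

/-- Pop items with `Q` as long as there are any, and treat each of them with `P`. -/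
def drain (Q P : BProg A) : BProg A := .seq Q (.loop Reg.isSome (.seq P Q))

def clearLeft : BProg A := drain popLeft .skip
def leftToRight : BProg A := drain popLeft (pushRight Reg.bit)
def leftToWork : BProg A := drain popLeft (pushWork Reg.bit)
def leftToBoth : BProg A := drain popLeft (.seq (pushWork Reg.bit) (pushRight Reg.bit))
def rightToLeft : BProg A := drain popRight (pushLeft Reg.bit)

end BProg

/-- Loop invariant: in `S l d` the items `l` are still to be popped and `d` lists those already
treated, latest first; the item at hand is in the register. -/
theorem exec_drain_loop {B : Type} {code : B → Bool × Bool} {Q P : BProg A} {j k : ℕ}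
    (S : List B → List B → Store A)
    (hpop : ∀ v b l d, Exec Q v (S (b :: l) d) (some (code b)) (S l d) j)
    (hnil : ∀ v d, Exec Q v (S [] d) none (S [] d) j)
    (hP : ∀ b l d, Exec P (some (code b)) (S l d) (some (code b)) (S l (b :: d)) k)
    (b : B) (l d : List B) :
    Exec (.loop Reg.isSome (.seq P Q)) (some (code b)) (S l d) none
      (S [] (l.reverse ++ b :: d)) ((k + j + 1) * (l.length + 1) + 1) := by
  induction l generalizing b d with
  | nil => exact (Exec.loop_true rfl ((hP b [] d).seq (hnil _ _)) (.loop_false rfl)).mono (by simp)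
  | cons b' l ih =>
    have h := ih b' (b :: d)
    refine (Exec.loop_true rfl ((hP b _ d).seq (hpop _ b' l _)) (by simpa using h)).mono ?_
    simp only [List.length_cons]
    ring_nf
    omega

theorem exec_drain {B : Type} {code : B → Bool × Bool} {Q P : BProg A} {j k : ℕ}
    (S : List B → List B → Store A)
    (hpop : ∀ v b l d, Exec Q v (S (b :: l) d) (some (code b)) (S l d) j)
    (hnil : ∀ v d, Exec Q v (S [] d) none (S [] d) j)
    (hP : ∀ b l d, Exec P (some (code b)) (S l d) (some (code b)) (S l (b :: d)) k)
    (l : List B) (v : Reg) (d : List B) :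
    Exec (drain Q P) v (S l d) none (S [] (l.reverse ++ d)) ((k + j + 1) * l.length + j + 1) := by
  cases l with
  | nil => exact (hnil v d).seq' (.loop_false rfl) (by simp)
  | cons b l =>
    have h := (hpop v b l d).seq (exec_drain_loop S hpop hnil hP b l d)
    simp only [List.reverse_cons, List.append_assoc, List.singleton_append] at h ⊢
    exact h.mono (by simp; omega)

theorem exec_clearLeft :
    Exec clearLeft v (store i o w l r c) none (store i o w [] r c) (3 * l.length + 2) :=
  exec_drain (code := fun b => (false, b)) (fun l _ => store i o w l r c)
    (fun v b l _ => exec_popLeft i o w l r c v b) (fun v _ => exec_popLeft_nil i o w r c v)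
    (fun _ _ _ => .skip _ _) l v []

theorem exec_leftToRight :
    Exec leftToRight v (store i o w l r c) none (store i o w [] (l.reverse ++ r) c)
      (3 * l.length + 2) := by
  have h := exec_drain (code := fun b => (false, b)) (fun l d => store i o w l (d ++ r) c)
    (fun v b l _ => exec_popLeft i o w l _ c v b) (fun v _ => exec_popLeft_nil i o w _ c v)
    (fun _ l d => exec_pushRight i o w l _ c _ Reg.bit) l v []
  simp only [List.nil_append, List.append_nil] at h
  exact h

theorem exec_leftToWork :
    Exec leftToWork v (store i o w l r c) none (store i o (l.reverse ++ w) [] r c)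
      (3 * l.length + 2) := by
  have h := exec_drain (code := fun b => (false, b)) (fun l d => store i o (d ++ w) l r c)
    (fun v b l _ => exec_popLeft i o _ l _ c v b) (fun v _ => exec_popLeft_nil i o _ _ c v)
    (fun _ l d => exec_pushWork i o _ l _ c _ Reg.bit) l v []
  simp only [List.nil_append, List.append_nil] at h
  exact h

theorem exec_leftToBoth :
    Exec leftToBoth v (store i o w l r c) none
      (store i o (l.reverse ++ w) [] (l.reverse ++ r) c) (4 * l.length + 2) := by
  have h := exec_drain (code := fun b => (false, b))
    (fun l d => store i o (d ++ w) l (d ++ r) c)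
    (fun v b l _ => exec_popLeft i o _ l _ c v b) (fun v _ => exec_popLeft_nil i o _ _ c v)
    (fun _ l d => (exec_pushWork i o _ l _ c _ Reg.bit).seq
      (exec_pushRight i o _ l _ c _ Reg.bit)) l v []
  simp only [List.nil_append, List.append_nil] at h
  exact h

theorem exec_rightToLeft :
    Exec rightToLeft v (store i o w l r c) none (store i o w (r.reverse ++ l) [] c)
      (3 * r.length + 2) := by
  have h := exec_drain (code := fun b => (false, b)) (fun r d => store i o w (d ++ l) r c)
    (fun v b r _ => exec_popRight i o w _ r c v b) (fun v _ => exec_popRight_nil i o w _ c v)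
    (fun _ r d => exec_pushLeft i o w _ r c _ Reg.bit) r v []
  simp only [List.nil_append, List.append_nil] at h
  exact h

namespace BProg

/-- The count stack holds one mark for each subtree still to be read after the current one. An inner
node adds two marks, and every node then takes one mark away; when none is left to take, the tree is
complete and the register becomes `none`, which ends the loop. -/
def moveBody : BProg A :=
  .seq popWork (.seq (pushLeft Reg.bit) (.seq
    (.ite Reg.bit (.seq (pushCount fun _ => true) (pushCount fun _ => true)) .skip) popCount))

/-- Move the topmost tree from the work stack to the left stack, where its code is reversed. -/
def moveTree : BProg A :=
  .seq (pushCount fun _ => true) (.seq popCount (.loop Reg.isSome moveBody))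

end BProg

/-- Stated in continuation form: `h` describes the loop after the whole of `x` has been moved. In
the case of an inner node, the run for the right subtree can thus serve as the continuation of the
run for the left one. -/
theorem exec_moveTree_loop (x : BTree) {v₂ : Reg} {S₂ : Store A} {n : ℕ} (hv : v.isSome = true)
    (h : Exec (.loop Reg.isSome moveBody) (popBit none c.head?)
      (store i o w (x.code.reverse ++ l) r c.tail) v₂ S₂ n) :
    Exec (.loop Reg.isSome moveBody) v (store i o (x.code ++ w) l r c) v₂ S₂
      (7 * x.code.length + n) := by
  induction x generalizing v w l c n with
  | nil =>
    refine (Exec.loop_true hv ((exec_popWork i o w l r c v false).seq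
      ((exec_pushLeft i o w l r c _ Reg.bit).seq ((Exec.ite_false rfl (.skip _ _)).seq
        (exec_popCount' i o w _ r c _)))) h).mono ?_
    simp [BTree.code]
  | cons a b iha ihb =>
    have h₁ := ihb (v := some (false, true)) (w := w)
      (l := a.code.reverse ++ true :: l) (c := c) rfl
      (by simpa [BTree.code, List.append_assoc] using h)
    have h₂ := iha (v := some (false, true)) (w := b.code ++ w) (l := true :: l)
      (c := true :: c) rfl h₁
    rw [show (BTree.cons a b).code ++ w = true :: (a.code ++ (b.code ++ w)) by simp [BTree.code]]
    refine (Exec.loop_true hv ((exec_popWork i o _ l r c v true).seq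
      ((exec_pushLeft i o _ l r c _ Reg.bit).seq ((Exec.ite_true rfl
        ((exec_pushCount i o _ _ r _ _ _).seq (exec_pushCount i o _ _ r _ _ _))).seq
        (exec_popCount' i o _ _ r _ _)))) h₂).mono ?_
    simp [BTree.code]; omega

theorem exec_moveTree (x : BTree) :
    Exec moveTree v (store i o (x.code ++ w) l r []) none
      (store i o w (x.code.reverse ++ l) r []) (7 * x.code.length + 3) :=
  (exec_pushCount i o _ l r [] v _).seq' ((exec_popCount i o _ l r [] v true).seq
    (exec_moveTree_loop i o w l r [] _ x rfl (.loop_false rfl))) (by omega)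

namespace BProg

/-- Remove the topmost tree. -/
def dropTree : BProg A := .seq moveTree clearLeft

/-- Duplicate the topmost tree. -/
def dupTree : BProg A := .seq moveTree (.seq leftToBoth (.seq rightToLeft leftToWork))

/-- Move the trees on the left stack below the topmost tree of the work stack. -/
def insertBelow : BProg A :=
  .seq leftToRight (.seq moveTree (.seq rightToLeft leftToWork))

/-- Exchange the two topmost trees. -/
def swapTrees : BProg A := .seq moveTree insertBelow

/-- Move the third tree to the top. -/
def rotTrees : BProg A := .seq moveTree (.seq moveTree insertBelow)

/-- Remove the second tree. -/
def dropSecond : BProg A := .seq swapTrees dropTree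

end BProg

theorem exec_dropTree (x : BTree) :
    Exec dropTree v (store i o (x.code ++ w) [] [] []) none (store i o w [] [] [])
      (10 * x.code.length + 5) :=
  (exec_moveTree i o w [] [] v x).seq' (exec_clearLeft i o w _ [] [] none) (by simp; omega)

theorem exec_dupTree (x : BTree) :
    Exec dupTree v (store i o (x.code ++ w) [] [] []) none
      (store i o (x.code ++ (x.code ++ w)) [] [] []) (17 * x.code.length + 9) := by
  have h := (exec_moveTree i o w [] [] v x).seq ((exec_leftToBoth i o w _ [] [] none).seq
    ((exec_rightToLeft i o _ [] _ [] none).seq (exec_leftToWork i o _ _ [] [] none)))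
  simp only [List.append_nil, List.reverse_reverse, List.length_reverse] at h
  exact h.mono (by omega)

theorem exec_insertBelow (x : BTree) :
    Exec insertBelow v (store i o (x.code ++ w) l [] []) none
      (store i o (x.code ++ (l.reverse ++ w)) [] [] []) (10 * x.code.length + 9 * l.length + 9) := by
  have h := (exec_leftToRight i o (x.code ++ w) l [] [] v).seq
    ((exec_moveTree i o w [] _ none x).seq
    ((exec_rightToLeft i o w _ _ [] none).seq (exec_leftToWork i o w _ [] [] none)))
  simp only [List.append_nil, List.reverse_reverse, List.length_reverse, List.reverse_append,
    List.length_append, List.append_assoc] at h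
  exact h.mono (by omega)

theorem exec_swapTrees (x y : BTree) :
    Exec swapTrees v (store i o (x.code ++ (y.code ++ w)) [] [] []) none
      (store i o (y.code ++ (x.code ++ w)) [] [] []) (16 * x.code.length + 10 * y.code.length + 12) :=
  (exec_moveTree i o _ [] [] v x).seq' (by simpa using exec_insertBelow i o w (x.code.reverse) none y)
    (by omega)

theorem exec_rotTrees (x y z : BTree) :
    Exec rotTrees v (store i o (x.code ++ (y.code ++ (z.code ++ w))) [] [] []) none
      (store i o (z.code ++ (x.code ++ (y.code ++ w))) [] [] [])
      (16 * x.code.length + 16 * y.code.length + 10 * z.code.length + 15) :=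
  (exec_moveTree i o _ [] [] v x).seq' ((exec_moveTree i o _ _ [] none y).seq (by
    simpa using exec_insertBelow i o w (y.code.reverse ++ x.code.reverse) none z)) (by omega)

theorem exec_dropSecond (x y : BTree) :
    Exec dropSecond v (store i o (x.code ++ (y.code ++ w)) [] [] []) none
      (store i o (x.code ++ w) [] [] []) (16 * x.code.length + 20 * y.code.length + 17) :=
  (exec_swapTrees i o w v x y).seq' (exec_dropTree i o _ none y) (by omega)

end Routines

/-! ### Polynomial-time functions on types that are encoded by trees -/

theorem eval_mono_nat (p : Polynomial ℕ) {m n : ℕ} (h : m ≤ n) : p.eval m ≤ p.eval n := by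
  rw [Polynomial.eval_eq_sum_range, Polynomial.eval_eq_sum_range]
  gcongr

/-- An encoding of the elements of a type by binary trees. -/
class TreeEnc (α : Type) where
  enc : α → BTree

/-- The size of the code of an element. -/
def tsize {α : Type} [TreeEnc α] (a : α) : ℕ := (TreeEnc.enc a).code.length

instance : TreeEnc BTree := ⟨id⟩

instance : TreeEnc Unit := ⟨fun _ => .nil⟩

instance : TreeEnc Bool := ⟨fun b => bif b then .cons .nil .nil else .nil⟩

instance {α β : Type} [TreeEnc α] [TreeEnc β] : TreeEnc (α × β) :=
  ⟨fun p => .cons (TreeEnc.enc p.1) (TreeEnc.enc p.2)⟩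

instance {α : Type} [TreeEnc α] : TreeEnc (List α) :=
  ⟨fun l => l.foldr (fun a t => .cons (TreeEnc.enc a) t) .nil⟩

/-- A proof adds nothing to the code, so a subtype as domain expresses a promise on the argument. -/
instance {α : Type} [TreeEnc α] {p : α → Prop} : TreeEnc {a // p a} := ⟨fun a => TreeEnc.enc a.1⟩

/-- Unary, which suits lengths, counters and positions of gates. Numbers that have to be handled in
binary are represented by their `bd₀` instead. -/
instance : TreeEnc ℕ := ⟨fun n => TreeEnc.enc (List.replicate n ())⟩

section

variable {α β γ δ : Type} [TreeEnc α] [TreeEnc β] [TreeEnc γ] [TreeEnc δ]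

open TreeEnc

@[simp] theorem enc_tree (t : BTree) : enc t = t := rfl
@[simp] theorem enc_true : enc true = .cons .nil .nil := rfl
@[simp] theorem enc_false : enc false = .nil := rfl
@[simp] theorem enc_pair (p : α × β) : enc p = .cons (enc p.1) (enc p.2) := rfl
@[simp] theorem enc_nil : enc ([] : List α) = .nil := rfl
@[simp] theorem enc_cons (a : α) (l : List α) : enc (a :: l) = .cons (enc a) (enc l) := rfl
@[simp] theorem enc_subtype {p : α → Prop} (a : {a // p a}) : enc a = enc a.1 := rfl
@[simp] theorem enc_zero : enc 0 = .nil := rfl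
@[simp] theorem enc_succ (n : ℕ) : enc (n + 1) = .cons .nil (enc n) := rfl

theorem tsize_pair (p : α × β) : tsize p = tsize p.1 + tsize p.2 + 1 := by
  simp [tsize, BTree.code]
@[simp] theorem tsize_mk (a : α) (b : β) : tsize (a, b) = tsize a + tsize b + 1 := tsize_pair _
@[simp] theorem tsize_nil : tsize ([] : List α) = 1 := rfl
@[simp] theorem tsize_cons (a : α) (l : List α) : tsize (a :: l) = tsize a + tsize l + 1 := by
  simp [tsize, BTree.code]
@[simp] theorem tsize_subtype {p : α → Prop} (a : {a // p a}) : tsize a = tsize a.1 := rfl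
theorem one_le_tsize (a : α) : 1 ≤ tsize a := by
  unfold tsize; cases enc a <;> simp [BTree.code]
theorem tsize_bool (b : Bool) : tsize b ≤ 3 := by cases b <;> simp [tsize, BTree.code]
@[simp] theorem tsize_nat (n : ℕ) : tsize n = 2 * n + 1 := by
  induction n with
  | zero => rfl
  | succ n ih =>
    have : tsize (n + 1) = tsize n + 2 := by simp [tsize, BTree.code]
    omega

theorem tsize_append (l l' : List α) : tsize (l ++ l') + 1 = tsize l + tsize l' := by
  induction l with
  | nil => simp [Nat.add_comm]
  | cons a l ih => simp; omega

theorem length_lt_tsize (l : List α) : l.length < tsize l := by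
  induction l with
  | nil => simp
  | cons a l ih => simp; omega

theorem tsize_list_le {l : List α} {m : ℕ} (h : ∀ a ∈ l, tsize a ≤ m) :
    tsize l ≤ l.length * (m + 1) + 1 := by
  induction l with
  | nil => simp
  | cons b l ih =>
    have h₁ := ih fun a ha => h a (by simp [ha])
    have h₂ := h b (by simp)
    simp only [tsize_cons, List.length_cons]
    ring_nf at h₁ ⊢
    omega

/-- The program `P` computes `f` on the topmost tree of the work stack. -/
def Computes {A : Type} (P : BProg A) (f : α → β) (t : α → ℕ) : Prop :=
  ∀ a w, Exec P none (store [] [] ((enc a).code ++ w) [] [] []) none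
    (store [] [] ((enc (f a)).code ++ w) [] [] []) (t a)

/-- Polynomial-time functions. -/
@[fun_prop]
structure PTF (f : α → β) : Prop where
  computes : ∀ A : Type, ∃ (P : BProg A) (p : Polynomial ℕ), Computes P f fun a => p.eval (tsize a)
  size : ∃ q : Polynomial ℕ, ∀ a, tsize (f a) ≤ q.eval (tsize a)

/-- A common bound of time and size. -/
theorem PTF.bound {f : α → β} (hf : PTF f) (A : Type) : ∃ (P : BProg A) (p : Polynomial ℕ),
    Computes P f (fun a => p.eval (tsize a)) ∧ ∀ a, tsize (f a) ≤ p.eval (tsize a) := by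
  obtain ⟨P, p, hP⟩ := hf.computes A
  obtain ⟨q, hq⟩ := hf.size
  refine ⟨P, p + q, fun a w => (hP a w).mono (by simp), fun a => (hq a).trans (by simp)⟩

/-- Programs see codes only. Hence a function may be exchanged for any other whose values have the
same codes, even one with a different codomain. -/
theorem PTF.of_enc_eq {f : α → β} {f' : α → γ} (hf : PTF f) (h : ∀ a, enc (f' a) = enc (f a)) :
    PTF f' := by
  refine ⟨fun A => ?_, ?_⟩
  · obtain ⟨P, p, hP⟩ := hf.computes A
    exact ⟨P, p, fun a w => by rw [h]; exact hP a w⟩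
  · obtain ⟨q, hq⟩ := hf.size
    exact ⟨q, fun a => by have := hq a; unfold tsize at this ⊢; rwa [h]⟩

@[fun_prop]
theorem PTF.id' : PTF fun a : α => a :=
  ⟨fun _ => ⟨.skip, 1, fun _ _ => by simpa using Exec.skip _ _⟩, Polynomial.X, fun _ => by simp⟩

theorem PTF.of_enc {f : α → β} (hf : PTF fun a => enc (f a)) : PTF f :=
  hf.of_enc_eq fun _ => rfl

theorem PTF.toTree : PTF (enc : α → BTree) := PTF.id'.of_enc_eq fun _ => rfl

@[fun_prop]
theorem PTF.comp {g : β → γ} {f : α → β} (hg : PTF g) (hf : PTF f) : PTF fun a => g (f a) := by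
  refine ⟨fun A => ?_, ?_⟩
  · obtain ⟨P, p, hP, hp⟩ := hf.bound A
    obtain ⟨Q, q, hQ⟩ := hg.computes A
    refine ⟨.seq P Q, p + q.comp p, fun a w => (hP a w).seq' (hQ (f a) w) ?_⟩
    simpa using eval_mono_nat q (hp a)
  · obtain ⟨p, hp⟩ := hf.size
    obtain ⟨q, hq⟩ := hg.size
    exact ⟨q.comp p, fun a => (hq _).trans (by simpa using eval_mono_nat q (hp a))⟩

open BProg

@[fun_prop]
theorem PTF.prodMk {f : α → β} {g : α → γ} (hf : PTF f) (hg : PTF g) :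
    PTF fun a => (f a, g a) := by
  refine ⟨fun A => ?_, ?_⟩
  · obtain ⟨P, p, hP, hp⟩ := hf.bound A
    obtain ⟨Q, q, hQ, hq⟩ := hg.bound A
    -- One copy of the argument is kept below while `f` runs on the other. The last swap puts the
    -- value of `f` on top, and a leading `true` joins the two trees into a pair.
    refine ⟨.seq dupTree (.seq P (.seq swapTrees (.seq Q (.seq swapTrees
      (pushWork fun _ => true))))), 27 * Polynomial.X + 27 * p + 17 * q + 40, fun a w => ?_⟩
    have h := exec_pushWork (A := A) [] [] ((enc (f a)).code ++ ((enc (g a)).code ++ w)) [] [] []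
      none fun _ => true
    refine (exec_dupTree [] [] w none (enc a)).seq' ((hP a _).seq
      ((exec_swapTrees [] [] w none (enc (f a)) (enc a)).seq ((hQ a _).seq
      ((exec_swapTrees [] [] w none (enc (g a)) (enc (f a))).seq
      (by simpa [BTree.code] using h))))) ?_
    have h₁ := hp a
    have h₂ := hq a
    simp only [tsize] at h₁ h₂ ⊢
    simp
    omega
  · obtain ⟨p, hp⟩ := hf.size
    obtain ⟨q, hq⟩ := hg.size
    refine ⟨p + q + 1, fun a => ?_⟩
    have h₁ := hp a
    have h₂ := hq a
    simp; omega

/-- The constant program. -/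
def BProg.pushBits {A : Type} : List Bool → BProg A
  | [] => .skip
  | b :: l => .seq (pushBits l) (pushWork fun _ => b)

theorem exec_pushBits {A : Type} (i : List A) (o w l r c u : List Bool) (v : Reg) :
    Exec (pushBits u) v (store i o w l r c) v (store i o (u ++ w) l r c) (u.length + 1) := by
  induction u with
  | nil => exact .skip _ _
  | cons b u ih => exact ih.seq (exec_pushWork i o _ l r c v _)

@[fun_prop]
theorem PTF.const (b : β) : PTF fun _ : α => b := by
  refine ⟨fun A => ⟨.seq dropTree (pushBits (enc b).code),
    10 * Polynomial.X + Polynomial.C ((enc b).code.length + 6), fun a w =>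
    (exec_dropTree [] [] w none (enc a)).seq' (exec_pushBits _ _ _ _ _ _ _ _) ?_⟩,
    Polynomial.C (tsize b), fun _ => by simp⟩
  simp [tsize]; omega

/-- The left subtree. -/
def BTree.left : BTree → BTree
  | nil => nil
  | cons a _ => a

/-- The right subtree. -/
def BTree.right : BTree → BTree
  | nil => nil
  | cons _ b => b

def BTree.isCons : BTree → Bool
  | nil => false
  | cons _ _ => true

/-- Branch according to the root of the topmost tree. -/
def BProg.onCons {A : Type} (P : BProg A) : BProg A :=
  .seq popWork (.ite Reg.bit P (.seq (pushWork fun _ => false) popCount))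

theorem exec_onCons {A : Type} {P : BProg A} {f : BTree → BTree} {t : ℕ}
    (hf : f .nil = .nil) (x : BTree) (w : List Bool)
    (hP : ∀ a b v, x = .cons a b → Exec P v (store [] [] (a.code ++ (b.code ++ w)) [] [] []) none
      (store [] [] ((f x).code ++ w) [] [] []) t) :
    Exec (onCons P) none (store [] [] (x.code ++ w) [] [] []) none
      (store [] [] ((f x).code ++ w) [] [] []) (t + 4) := by
  cases x with
  | nil =>
    rw [hf]
    -- The bit is put back. Popping the empty count stack only serves to reset the register to
    -- `none`.
    exact (exec_popWork [] [] w [] [] [] none false).seq' (.ite_false rfl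
      ((exec_pushWork [] [] w [] [] [] _ fun _ => false).seq (exec_popCount_nil _ _ _ _ _ _)))
      (by omega)
  | cons a b =>
    have h := (exec_popWork [] [] (a.code ++ (b.code ++ w)) [] [] [] none true).seq
      (.ite_true (P := P) (p := Reg.bit) (Q := (.seq (pushWork fun _ => false) popCount)) rfl
        (hP a b _ rfl))
    simp only [BTree.code, List.cons_append, List.append_assoc]
    exact h.mono (by omega)

theorem BTree.length_code_cons (a b : BTree) :
    (cons a b).code.length = a.code.length + b.code.length + 1 := by
  simp [code]

theorem PTF.treeLeft : PTF BTree.left := by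
  refine ⟨fun A => ⟨onCons dropSecond, 20 * Polynomial.X + 40, fun x w => ?_⟩, Polynomial.X,
    fun x => ?_⟩
  · refine (exec_onCons (t := 20 * tsize x + 17) (f := BTree.left) rfl x w ?_).mono (by simp)
    rintro a b v rfl
    refine (exec_dropSecond [] [] w v a b).mono ?_
    simp only [tsize, enc_tree, BTree.length_code_cons]; omega
  · cases x <;> simp [BTree.left, tsize, BTree.code]; omega

theorem PTF.treeRight : PTF BTree.right := by
  refine ⟨fun A => ⟨onCons dropTree, 20 * Polynomial.X + 40, fun x w => ?_⟩, Polynomial.X,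
    fun x => ?_⟩
  · refine (exec_onCons (t := 20 * tsize x + 17) (f := BTree.right) rfl x w ?_).mono (by simp)
    rintro a b v rfl
    refine (exec_dropTree [] [] _ v a).mono ?_
    simp only [tsize, enc_tree, BTree.length_code_cons]; omega
  · cases x <;> simp [BTree.right, tsize, BTree.code]; omega

theorem PTF.isCons : PTF BTree.isCons := by
  refine ⟨fun A => ⟨onCons (.seq dropTree (.seq dropTree (pushBits [true, false, false]))),
    20 * Polynomial.X + 40, fun x w => ?_⟩, 3, fun x => ?_⟩
  · refine (exec_onCons (t := 20 * tsize x + 17) (f := fun x => enc x.isCons) rfl x w ?_).mono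
      (by simp)
    rintro a b v rfl
    refine (exec_dropTree [] [] _ v a).seq' ((exec_dropTree [] [] _ none b).seq
      (exec_pushBits [] [] w [] [] [] [true, false, false] none)) ?_
    simp only [tsize, enc_tree, BTree.length_code_cons, List.length_cons, List.length_nil]; omega
  · cases x <;> simp [BTree.isCons, tsize, BTree.code]

/-- The branches live on subtypes, so time and size of each need to be bounded only on the arguments
that reach it. -/
theorem PTF.dite {c : α → Bool} {f : {a // c a = true} → β} {g : {a // ¬ c a = true} → β}
    (hc : PTF c) (hf : PTF f) (hg : PTF g) :
    PTF fun a => if h : c a = true then f ⟨a, h⟩ else g ⟨a, h⟩ := by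
  refine ⟨fun A => ?_, ?_⟩
  · obtain ⟨P, p, hP⟩ := hc.computes A
    obtain ⟨Q, q, hQ⟩ := hf.computes A
    obtain ⟨R, r, hR⟩ := hg.computes A
    -- The code of `true` has three bits, that of `false` one; so two more bits are removed in the
    -- first branch. `popCount` resets the register.
    refine ⟨.seq dupTree (.seq P (.seq popWork (.ite Reg.bit
      (.seq popWork (.seq popWork (.seq popCount Q))) (.seq popCount R)))),
      17 * Polynomial.X + p + q + r + 20, fun a w => ?_⟩
    by_cases h : c a = true
    · have hP' := hP a ((enc a).code ++ w)
      simp only [h, enc_true, BTree.code] at hP'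
      refine (exec_dupTree [] [] w none (enc a)).seq' (hP'.seq
        ((exec_popWork [] [] _ [] [] [] none true).seq (.ite_true rfl
        ((exec_popWork [] [] _ [] [] [] _ false).seq ((exec_popWork [] [] _ [] [] [] _ false).seq
        ((exec_popCount_nil [] [] _ [] [] _).seq (by simpa [h] using hQ ⟨a, h⟩ w))))))) ?_
      simp [tsize]; omega
    · have hP' := hP a ((enc a).code ++ w)
      simp only [h, enc_false, BTree.code] at hP'
      refine (exec_dupTree [] [] w none (enc a)).seq' (hP'.seq
        ((exec_popWork [] [] _ [] [] [] none false).seq (.ite_false rfl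
        ((exec_popCount_nil [] [] _ [] [] _).seq (by simpa [h] using hR ⟨a, h⟩ w))))) ?_
      simp [tsize]; omega
  · obtain ⟨q, hq⟩ := hf.size
    obtain ⟨r, hr⟩ := hg.size
    refine ⟨q + r, fun a => ?_⟩
    by_cases h : c a = true
    · simpa [h] using (hq ⟨a, h⟩).trans (Nat.le_add_right _ _)
    · simpa [h] using (hr ⟨a, h⟩).trans (Nat.le_add_left _ _)

/-- On entry the root bit of a nonempty list has been popped, so the stack shows head, tail,
accumulator. Rotation brings the accumulator next to the head, the pushed `true` makes them a pair
for `P`, and the final pop reads the root of the tail, which decides whether the loop goes on. -/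
def BProg.foldBody {A : Type} (P : BProg A) : BProg A :=
  .seq rotTrees (.seq (pushWork fun _ => true) (.seq P (.seq swapTrees popWork)))

/-- The pop that inspects the next list cell ends a turn of the loop but is needed before its test.
The statement therefore treats this pop and the loop as two executions with an unspecified state
between them. The number `m` bounds the list and every intermediate accumulator, so all turns have
the same time bound. -/
theorem exec_fold_loop {A : Type} {step : β × α → β} {P : BProg A} {p : Polynomial ℕ}
    (hP : Computes P step fun x => p.eval (tsize x)) (m : ℕ) (w : List Bool) (l : List α) (b : β)
    (v : Reg) (hl : tsize l ≤ m)
    (hb : ∀ l₁ l₂, l = l₁ ++ l₂ → tsize (l₁.foldl (fun b a => step (b, a)) b) ≤ m) :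
    ∃ v₁ S₁ m₁ m₂,
      Exec popWork v (store [] [] ((enc l).code ++ ((enc b).code ++ w)) [] [] []) v₁ S₁ m₁ ∧
      Exec (.loop Reg.bit (foldBody P)) v₁ S₁ (some (false, false))
        (store [] [] ((enc (l.foldl (fun b a => step (b, a)) b)).code ++ w) [] [] []) m₂ ∧
      m₁ + m₂ ≤ l.length * (70 * m + p.eval (2 * m + 1) + 60) + 2 := by
  induction l generalizing b v with
  | nil => exact ⟨_, _, _, _, exec_popWork [] [] _ [] [] [] v false, .loop_false rfl, by simp⟩
  | cons a l ih =>
    have hb₀ := hb [] (a :: l) rfl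
    have hb₁ := hb [a] l rfl
    simp only [List.foldl_cons, List.foldl_nil, tsize_cons] at hb₀ hb₁ hl
    obtain ⟨v₁, S₁, m₁, m₂, h₁, h₂, hm⟩ := ih (step (b, a)) none (by omega)
      fun l₁ l₂ h => hb (a :: l₁) l₂ (by simp [h])
    simp only [enc_cons, BTree.code, List.cons_append, List.append_assoc]
    have hs : p.eval (tsize (b, a)) ≤ p.eval (2 * m + 1) := eval_mono_nat p (by simp; omega)
    have hP' := hP (b, a) ((enc l).code ++ w)
    simp only [enc_pair, BTree.code, List.cons_append, List.append_assoc] at hP'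
    refine ⟨_, _, _, _, exec_popWork [] [] _ [] [] [] v true, .loop_true rfl
      ((exec_rotTrees [] [] w _ (enc a) (enc l) (enc b)).seq
      ((exec_pushWork [] [] _ [] [] [] none fun _ => true).seq
      (hP'.seq ((exec_swapTrees [] [] w none (enc (step (b, a))) (enc l)).seq h₁)))) h₂, ?_⟩
    simp only [tsize] at *
    simp only [List.length_cons, add_mul]
    omega

end

/-! ### Folds with bounded accumulators, and the basic operations derived from them -/

section

variable {α β γ δ : Type} [TreeEnc α] [TreeEnc β] [TreeEnc γ] [TreeEnc δ]

open TreeEnc BProg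

/-- A polynomial-time step may square the size each time, so a fold is polynomial only under a bound
on all intermediate accumulators. The bound is a promise on the argument. -/
theorem PTF.foldl_core {step : β × α → β} (h : PTF step) (q : Polynomial ℕ) :
    PTF fun x : {x : β × List α // ∀ l₁ l₂, x.2 = l₁ ++ l₂ →
      tsize (l₁.foldl (fun b a => step (b, a)) x.1) ≤ q.eval (tsize x)} =>
      x.1.2.foldl (fun b a => step (b, a)) x.1.1 := by
  refine ⟨fun A => ?_, q, fun x => x.2 _ [] (by simp)⟩
  obtain ⟨P, p, hP⟩ := h.computes A
  refine ⟨.seq popWork (.seq swapTrees (.seq (.seq popWork (.loop Reg.bit (foldBody P)))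
    popCount)), 26 * Polynomial.X + Polynomial.X * (70 * (q + Polynomial.X) +
      p.comp (2 * (q + Polynomial.X) + 1) + 60) + 20, ?_⟩
  rintro ⟨⟨b, l⟩, hx⟩ w
  obtain ⟨v₁, S₁, m₁, m₂, h₁, h₂, hm⟩ := exec_fold_loop hP (q.eval (tsize (b, l)) + tsize (b, l)) w
    l b none (by simp; omega) fun l₁ l₂ hl => (hx l₁ l₂ hl).trans (by simp)
  simp only [enc_subtype, enc_pair, BTree.code, List.cons_append, List.append_assoc]
  refine (exec_popWork [] [] _ [] [] [] none true).seq' ((exec_swapTrees [] [] w _ (enc b)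
    (enc l)).seq ((h₁.seq h₂).seq (exec_popCount_nil [] [] _ [] [] _))) ?_
  have hl := length_lt_tsize l
  have hN : tsize (b, l) = (enc b).code.length + (enc l).code.length + 1 := tsize_mk b l
  simp only [tsize_subtype, Polynomial.eval_add, Polynomial.eval_mul, Polynomial.eval_X,
    Polynomial.eval_comp, Polynomial.eval_ofNat, Polynomial.eval_one]
  generalize tsize (b, l) = N at *
  generalize 70 * (q.eval N + N) + p.eval (2 * (q.eval N + N) + 1) + 60 = M at *
  have hl' : l.length ≤ N := by unfold tsize at hl; omega
  have := Nat.mul_le_mul_right M hl'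
  omega

theorem PTF.foldl {init : γ → β} {l : γ → List α} {step : γ → β → α → β} (hinit : PTF init)
    (hl : PTF l) (hstep : PTF fun x : (γ × β) × α => step x.1.1 x.1.2 x.2)
    (hb : ∃ q : Polynomial ℕ, ∀ c, ∀ l₁ l₂, l c = l₁ ++ l₂ →
      tsize (l₁.foldl (step c) (init c)) ≤ q.eval (tsize c)) :
    PTF fun c => (l c).foldl (step c) (init c) := by
  obtain ⟨q, hq⟩ := hb
  -- The parameter `c` travels along in the accumulator, because the step of `PTF.foldl_core` sees
  -- only accumulator and item.
  have hfold : ∀ c (l : List α) (b : β),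
      l.foldl (fun (b : γ × β) a => (b.1, step b.1 b.2 a)) (c, b) = (c, l.foldl (step c) b) := by
    intro c l
    induction l with
    | nil => simp
    | cons a l ih => intro b; simp [ih]
  have h₁ : PTF fun x : (γ × β) × α => (x.1.1, step x.1.1 x.1.2 x.2) :=
    PTF.prodMk (((PTF.treeLeft.comp PTF.treeLeft).comp PTF.toTree).of_enc_eq fun _ => rfl) hstep
  have h₂ := PTF.foldl_core h₁ (q + Polynomial.X + 1)
  have h₃ : PTF fun c => ((c, init c), l c) := (PTF.id'.prodMk hinit).prodMk hl
  have h₄ := h₂.comp (h₃.of_enc_eq (f' := fun c => ⟨((c, init c), l c), fun l₁ l₂ hc => by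
    have h₅ := hq c l₁ l₂ hc
    have h₆ : tsize c ≤ tsize ((c, init c), l c) := by simp; omega
    have h₇ := eval_mono_nat q h₆
    simp only [hfold, tsize_mk, Polynomial.eval_add, Polynomial.eval_X,
      Polynomial.eval_one] at *
    omega⟩) fun _ => rfl)
  have h₈ := (PTF.treeRight.comp PTF.toTree).comp h₄
  refine h₈.of_enc_eq fun c => ?_
  simp [hfold, BTree.right]

theorem tsize_foldl_le {step : γ → β → α → β} {q : Polynomial ℕ}
    (h : ∀ c b a, tsize (step c b a) ≤ tsize b + q.eval (tsize c + tsize a)) (c : γ)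
    (l : List α) (b : β) :
    tsize (l.foldl (step c) b) ≤ tsize b + l.length * q.eval (tsize c + tsize l) := by
  induction l generalizing b with
  | nil => simp
  | cons a l ih =>
    have h₁ := ih (step c b a)
    have h₂ := h c b a
    have h₃ := eval_mono_nat q (m := tsize c + tsize l) (n := tsize c + tsize (a :: l))
      (by simp; omega)
    have h₄ := eval_mono_nat q (m := tsize c + tsize a) (n := tsize c + tsize (a :: l))
      (by simp; omega)
    have h₅ := Nat.mul_le_mul_left l.length h₃
    simp only [List.foldl_cons, List.length_cons, add_mul]
    omega

/-- Folding is polynomial-time if the size of the accumulator grows by a bounded amount in each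
step. -/
theorem PTF.foldl_add {init : γ → β} {l : γ → List α} {step : γ → β → α → β} (hinit : PTF init)
    (hl : PTF l) (hstep : PTF fun x : (γ × β) × α => step x.1.1 x.1.2 x.2)
    (hb : ∃ q : Polynomial ℕ, ∀ c b a, tsize (step c b a) ≤ tsize b + q.eval (tsize c + tsize a)) :
    PTF fun c => (l c).foldl (step c) (init c) := by
  obtain ⟨q, hq⟩ := hb
  obtain ⟨r, hr⟩ := hinit.size
  obtain ⟨s, hs⟩ := hl.size
  refine hinit.foldl hl hstep ⟨r + s * q.comp (Polynomial.X + s), fun c l₁ l₂ hc => ?_⟩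
  refine (tsize_foldl_le hq c l₁ (init c)).trans ?_
  have h₁ := hs c
  have h₂ := hr c
  rw [hc] at h₁
  have h₃ := tsize_append l₁ l₂
  have h₄ := length_lt_tsize l₁
  have h₅ := one_le_tsize l₂
  simp only [Polynomial.eval_add, Polynomial.eval_mul, Polynomial.eval_comp, Polynomial.eval_X]
  gcongr
  · omega
  · exact eval_mono_nat q (by omega)

/-- Folding is polynomial-time if the size of the accumulator is bounded independently of the
previous one. -/
theorem PTF.foldl_bdd {init : γ → β} {l : γ → List α} {step : γ → β → α → β} (hinit : PTF init)
    (hl : PTF l) (hstep : PTF fun x : (γ × β) × α => step x.1.1 x.1.2 x.2)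
    (hb : ∃ q : Polynomial ℕ, ∀ c b a, tsize (step c b a) ≤ q.eval (tsize c + tsize a)) :
    PTF fun c => (l c).foldl (step c) (init c) :=
  hinit.foldl_add hl hstep (hb.imp fun _ h c b a => (h c b a).trans (Nat.le_add_left _ _))

/-! ### Pairs and Booleans -/

@[fun_prop]
theorem PTF.fst {f : γ → α × β} (hf : PTF f) : PTF fun c => (f c).1 :=
  ((PTF.treeLeft.comp PTF.toTree).comp hf).of_enc_eq fun _ => rfl

@[fun_prop]
theorem PTF.snd {f : γ → α × β} (hf : PTF f) : PTF fun c => (f c).2 :=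
  ((PTF.treeRight.comp PTF.toTree).comp hf).of_enc_eq fun _ => rfl

theorem PTF.val {p : α → Prop} : PTF fun a : {a // p a} => a.1 := PTF.id'.of_enc_eq fun _ => rfl

@[fun_prop]
theorem PTF.cond {b : γ → Bool} {f g : γ → α} (hb : PTF b) (hf : PTF f) (hg : PTF g) :
    PTF fun c => bif b c then f c else g c :=
  (PTF.dite hb (hf.comp PTF.val) (hg.comp PTF.val)).of_enc_eq fun c => by
    by_cases h : b c = true <;> simp [h]

@[fun_prop]
theorem PTF.not {b : γ → Bool} (hb : PTF b) : PTF fun c => !b c :=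
  (hb.cond (PTF.const false) (PTF.const true)).of_enc_eq fun c => by cases b c <;> rfl

@[fun_prop]
theorem PTF.and {a b : γ → Bool} (ha : PTF a) (hb : PTF b) : PTF fun c => a c && b c :=
  (ha.cond hb (PTF.const false)).of_enc_eq fun c => by cases a c <;> simp

@[fun_prop]
theorem PTF.or {a b : γ → Bool} (ha : PTF a) (hb : PTF b) : PTF fun c => a c || b c :=
  (ha.cond (PTF.const true) hb).of_enc_eq fun c => by cases a c <;> simp

@[fun_prop]
theorem PTF.beqBool {a b : γ → Bool} (ha : PTF a) (hb : PTF b) : PTF fun c => a c == b c :=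
  (ha.cond hb hb.not).of_enc_eq fun c => by cases a c <;> simp

/-! ### Lists -/

@[fun_prop]
theorem PTF.cons {f : γ → α} {l : γ → List α} (hf : PTF f) (hl : PTF l) :
    PTF fun c => f c :: l c :=
  (hf.prodMk hl).of_enc_eq fun _ => rfl

@[fun_prop]
theorem PTF.isEmpty {l : γ → List α} (hl : PTF l) : PTF fun c => (l c).isEmpty :=
  (((PTF.isCons.comp PTF.toTree).comp hl).not).of_enc_eq fun c => by
    cases l c <;> rfl

@[fun_prop]
theorem PTF.tail {l : γ → List α} (hl : PTF l) : PTF fun c => (l c).tail :=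
  ((PTF.treeRight.comp PTF.toTree).comp hl).of_enc_eq fun c => by
    cases l c <;> rfl

@[fun_prop]
theorem PTF.headD {l : γ → List α} {d : γ → α} (hl : PTF l) (hd : PTF d) :
    PTF fun c => (l c).headD (d c) :=
  (hl.isEmpty.cond (PTF.toTree.comp hd) ((PTF.treeLeft.comp PTF.toTree).comp hl)).of_enc_eq
    fun c => by cases l c <;> rfl

omit [TreeEnc α] in
theorem foldl_cons_eq (l l' : List α) : l.foldl (fun acc a => a :: acc) l' = l.reverse ++ l' := by
  induction l generalizing l' with
  | nil => rfl
  | cons a l ih => simp [ih]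

@[fun_prop]
theorem PTF.reverse {l : γ → List α} (hl : PTF l) : PTF fun c => (l c).reverse := by
  refine (PTF.foldl_add (init := fun _ => []) (step := fun _ acc a => a :: acc) (PTF.const []) hl
    (by fun_prop) ⟨Polynomial.X + 1, fun c b a => by simp; omega⟩).of_enc_eq fun c => ?_
  simp

@[fun_prop]
theorem PTF.append {l l' : γ → List α} (hl : PTF l) (hl' : PTF l') : PTF fun c => l c ++ l' c := by
  refine (PTF.foldl_add (step := fun _ acc a => a :: acc) hl' hl.reverse
    (by fun_prop) ⟨Polynomial.X + 1, fun c b a => by simp; omega⟩).of_enc_eq fun c => ?_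
  rw [foldl_cons_eq, List.reverse_reverse]

omit [TreeEnc α] [TreeEnc β] in
theorem foldl_append_eq (f : α → List β) (l : List α) (l' : List β) :
    l.foldl (fun acc a => acc ++ f a) l' = l' ++ l.flatMap f := by
  induction l generalizing l' with
  | nil => simp
  | cons a l ih => simp [ih]

@[fun_prop]
theorem PTF.flatMap {l : γ → List α} {f : γ → α → List β} (hl : PTF l)
    (hf : PTF fun x : γ × α => f x.1 x.2) : PTF fun c => (l c).flatMap (f c) := by
  obtain ⟨q, hq⟩ := hf.size
  refine (PTF.foldl_add (init := fun _ => []) (step := fun c acc a => acc ++ f c a) (PTF.const [])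
    hl ?_ ⟨q.comp (Polynomial.X + 1), fun c b a => ?_⟩).of_enc_eq fun c => ?_
  · exact PTF.append (by fun_prop) (hf.comp (f := fun x : (γ × List β) × α => (x.1.1, x.2))
      (by fun_prop))
  · have h₁ := tsize_append b (f c a)
    have h₂ := hq (c, a)
    simp at h₂ ⊢
    omega
  · rw [foldl_append_eq, List.nil_append]

@[fun_prop]
theorem PTF.map {l : γ → List α} {f : γ → α → β} (hl : PTF l)
    (hf : PTF fun x : γ × α => f x.1 x.2) : PTF fun c => (l c).map (f c) :=
  (hl.flatMap (f := fun c a => [f c a]) (hf.cons (PTF.const []))).of_enc_eq fun c => by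
    induction l c <;> simp_all

@[fun_prop]
theorem PTF.filter {l : γ → List α} {p : γ → α → Bool} (hl : PTF l)
    (hp : PTF fun x : γ × α => p x.1 x.2) : PTF fun c => (l c).filter (p c) :=
  (hl.flatMap (f := fun c a => bif p c a then [a] else [])
    (hp.cond (by fun_prop) (by fun_prop))).of_enc_eq fun c => by
      induction l c with
      | nil => simp
      | cons a l ih => cases h : p c a <;> simp_all

@[fun_prop]
theorem PTF.all {l : γ → List α} {p : γ → α → Bool} (hl : PTF l)
    (hp : PTF fun x : γ × α => p x.1 x.2) : PTF fun c => (l c).all (p c) :=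
  ((hl.filter (p := fun c a => !p c a) hp.not).isEmpty).of_enc_eq fun c => by
    induction l c with
    | nil => simp
    | cons a l ih => cases h : p c a <;> simp_all

/-! ### Numbers in unary -/

@[fun_prop]
theorem PTF.replicateUnit {n : γ → ℕ} (hn : PTF n) : PTF fun c => List.replicate (n c) () :=
  hn.of_enc_eq fun _ => rfl

@[fun_prop]
theorem PTF.length {l : γ → List α} (hl : PTF l) : PTF fun c => (l c).length :=
  (hl.map (f := fun _ _ => ()) (PTF.const ())).of_enc_eq fun c => by
    rw [List.map_const']; rfl

@[fun_prop]
theorem PTF.add {m n : γ → ℕ} (hm : PTF m) (hn : PTF n) : PTF fun c => m c + n c :=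
  (hm.replicateUnit.append hn.replicateUnit).of_enc_eq fun c => by
    rw [← List.replicate_add]; rfl

@[fun_prop]
theorem PTF.mul {m n : γ → ℕ} (hm : PTF m) (hn : PTF n) : PTF fun c => m c * n c :=
  (hm.replicateUnit.flatMap (f := fun c _ => List.replicate (n c) ())
    (by fun_prop)).length.of_enc_eq fun c => by simp

/-- Iteration is polynomial-time if the sizes of the iterates are bounded. -/
theorem PTF.iterate {n : γ → ℕ} {x : γ → β} {f : γ → β → β} (hn : PTF n) (hx : PTF x)
    (hf : PTF fun y : γ × β => f y.1 y.2)
    (hb : ∃ q : Polynomial ℕ, ∀ c, ∀ m ≤ n c, tsize ((f c)^[m] (x c)) ≤ q.eval (tsize c)) :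
    PTF fun c => (f c)^[n c] (x c) := by
  have h : ∀ c (l : List Unit) (b : β), l.foldl (fun b _ => f c b) b = (f c)^[l.length] b := by
    intro c l
    induction l with
    | nil => simp
    | cons a l ih => intro b; simp [ih]
  obtain ⟨q, hq⟩ := hb
  refine (PTF.foldl (step := fun c b _ => f c b) hx hn.replicateUnit
    (hf.comp (f := fun x : (γ × β) × Unit => x.1) (by fun_prop)) ⟨q, fun c l₁ l₂ hc => ?_⟩).of_enc_eq
      fun c => by simp [h]
  rw [h]
  refine hq c _ ?_
  have := congrArg List.length hc
  simp at this
  omega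

/-- Iteration of a function that does not increase the size is polynomial-time. -/
theorem PTF.iterate_of_le {n : γ → ℕ} {x : γ → β} {f : β → β} (hn : PTF n) (hx : PTF x)
    (hf : PTF f) (hb : ∀ b, tsize (f b) ≤ tsize b) : PTF fun c => f^[n c] (x c) := by
  obtain ⟨q, hq⟩ := hx.size
  refine PTF.iterate (f := fun _ => f) hn hx (by fun_prop) ⟨q, fun c m hm => ?_⟩
  clear hm
  refine le_trans ?_ (hq c)
  induction m with
  | zero => simp
  | succ m ih => rw [Function.iterate_succ_apply']; exact (hb _).trans ih

theorem tsize_tail_le (l : List α) : tsize l.tail ≤ tsize l := by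
  cases l <;> simp; omega

@[fun_prop]
theorem PTF.drop {n : γ → ℕ} {l : γ → List α} (hn : PTF n) (hl : PTF l) :
    PTF fun c => (l c).drop (n c) := by
  refine (PTF.iterate_of_le (f := List.tail) hn hl (by fun_prop) tsize_tail_le).of_enc_eq
    fun c => ?_
  congr 1
  generalize l c = l
  induction n c generalizing l with
  | zero => rfl
  | succ n ih => rw [Function.iterate_succ_apply, ← ih]; simp

@[fun_prop]
theorem PTF.getD {n : γ → ℕ} {l : γ → List α} {d : γ → α} (hl : PTF l) (hn : PTF n) (hd : PTF d) :
    PTF fun c => (l c).getD (n c) (d c) :=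
  ((hn.drop hl).headD hd).of_enc_eq fun c => by
    rw [List.headD_eq_head?_getD, List.head?_drop, List.getD_eq_getElem?_getD]

@[fun_prop]
theorem PTF.sub {m n : γ → ℕ} (hm : PTF m) (hn : PTF n) : PTF fun c => m c - n c :=
  ((hn.drop hm.replicateUnit).length).of_enc_eq fun c => by simp

@[fun_prop]
theorem PTF.decide_le {m n : γ → ℕ} (hm : PTF m) (hn : PTF n) : PTF fun c => decide (m c ≤ n c) :=
  ((hm.sub hn).replicateUnit.isEmpty).of_enc_eq fun c => by
    congr 1
    rw [Bool.eq_iff_iff]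
    simp [Nat.sub_eq_zero_iff_le]

@[fun_prop]
theorem PTF.decide_lt {m n : γ → ℕ} (hm : PTF m) (hn : PTF n) : PTF fun c => decide (m c < n c) :=
  (PTF.decide_le (hm.add (PTF.const 1)) hn).of_enc_eq fun _ => rfl

@[fun_prop]
theorem PTF.beqNat {m n : γ → ℕ} (hm : PTF m) (hn : PTF n) : PTF fun c => m c == n c :=
  ((PTF.decide_le hm hn).and (PTF.decide_le hn hm)).of_enc_eq fun c => by
    congr 1
    rw [Bool.eq_iff_iff]
    simp
    omega

@[fun_prop]
theorem PTF.replicate {n : γ → ℕ} {a : γ → α} (hn : PTF n) (ha : PTF a) :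
    PTF fun c => List.replicate (n c) (a c) :=
  (hn.replicateUnit.map (f := fun c _ => a c) (by fun_prop)).of_enc_eq fun c => by simp

@[fun_prop]
theorem PTF.range {n : γ → ℕ} (hn : PTF n) : PTF fun c => List.range (n c) := by
  have h : ∀ m : ℕ, (fun l : List ℕ => l ++ [l.length])^[m] [] = List.range m := by
    intro m
    induction m with
    | zero => rfl
    | succ m ih => rw [Function.iterate_succ_apply', ih, List.range_succ]; simp
  obtain ⟨q, hq⟩ := hn.size
  refine (PTF.iterate (x := fun _ => []) (f := fun _ (l : List ℕ) => l ++ [l.length]) hn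
    (PTF.const []) (by fun_prop) ⟨q * (2 * q + 1 + 1) + 1, fun c m hm => ?_⟩).of_enc_eq
      fun c => by rw [h]
  rw [h]
  have h₁ := hq c
  rw [tsize_nat] at h₁
  refine (tsize_list_le (m := 2 * q.eval (tsize c) + 1) fun a ha => ?_).trans ?_
  · rw [List.mem_range] at ha
    rw [tsize_nat]; omega
  · simp only [List.length_range, Polynomial.eval_add, Polynomial.eval_mul, Polynomial.eval_ofNat,
      Polynomial.eval_one]
    gcongr
    omega

@[fun_prop]
theorem PTF.take {n : γ → ℕ} {l : γ → List α} (hn : PTF n) (hl : PTF l) :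
    PTF fun c => (l c).take (n c) :=
  ((PTF.drop (hl.length.sub hn) hl.reverse).reverse).of_enc_eq fun c => by
    rw [List.drop_reverse, List.reverse_reverse]
    congr 1
    rcases le_total (n c) (l c).length with h | h
    · rw [Nat.sub_sub_self h]
    · rw [Nat.sub_eq_zero_of_le h, Nat.sub_zero, List.take_length, List.take_of_length_le h]

/-- Equality of strings. -/
@[fun_prop]
theorem PTF.beqList {l l' : γ → List Bool} (hl : PTF l) (hl' : PTF l') :
    PTF fun c => l c == l' c := by
  refine ((hl.length.beqNat hl'.length).and (PTF.all (l := fun c => List.range (l c).length)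
    (p := fun c i => (l c).getD i false == (l' c).getD i false) (by fun_prop)
    (PTF.beqBool (PTF.getD (hl.comp (by fun_prop)) (by fun_prop) (by fun_prop))
      (PTF.getD (hl'.comp (by fun_prop)) (by fun_prop) (by fun_prop))))).of_enc_eq fun c => ?_
  congr 1
  rw [Bool.eq_iff_iff]
  simp only [beq_iff_eq, Bool.and_eq_true, List.all_eq_true, List.mem_range]
  constructor
  · intro h; simp [h]
  · rintro ⟨h, h'⟩
    refine List.ext_getElem h fun i hi hi' => ?_
    simpa [hi, hi'] using h' i hi

/-! ### Finite types -/

/-- Equality with a fixed tree. -/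
def BTree.eqConst : BTree → BTree → Bool
  | nil, y => !y.isCons
  | cons a b, y => y.isCons && (a.eqConst y.left && b.eqConst y.right)

theorem BTree.eqConst_iff (x y : BTree) : x.eqConst y = true ↔ x = y := by
  induction x generalizing y with
  | nil => cases y <;> simp [eqConst, isCons]
  | cons a b iha ihb => cases y <;> simp [eqConst, isCons, left, right, iha, ihb]

theorem PTF.eqConst (x : BTree) : PTF x.eqConst := by
  induction x with
  | nil => exact PTF.isCons.not
  | cons a b iha ihb =>
    exact PTF.isCons.and ((iha.comp PTF.treeLeft).and (ihb.comp PTF.treeRight))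

/-- Case distinction over a finite type. -/
theorem PTF.finite_cases [Finite α] (henc : Function.Injective (enc : α → BTree)) {f : α → γ → β}
    (hf : ∀ a, PTF (f a)) : PTF fun x : α × γ => f x.1 x.2 := by
  classical
  -- A nest of comparisons with the elements of a list. The values are taken as trees, so that the
  -- impossible last branch can be `.nil` even if `β` is not known to be inhabited.
  have key : ∀ l : List α, (∃ g : α × γ → BTree, PTF g ∧ ∀ x : α × γ, x.1 ∈ l →
      g x = enc (f x.1 x.2)) := by
    intro l
    induction l with
    | nil => exact ⟨_, PTF.const .nil, by simp⟩
    | cons a l ih =>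
      obtain ⟨g, hg, hl⟩ := ih
      refine ⟨_, ((PTF.eqConst (enc a)).comp (PTF.toTree.comp PTF.id'.fst)).cond
        (PTF.toTree.comp ((hf a).comp PTF.id'.snd)) hg, ?_⟩
      rintro ⟨a', c⟩ ha'
      by_cases h : a = a'
      · subst h
        simp [(BTree.eqConst_iff _ _).2 rfl]
      · have : (enc a).eqConst (enc a') = false := by
          rw [← Bool.not_eq_true, BTree.eqConst_iff]
          exact fun h' => h (henc h')
        rw [this]
        rcases List.mem_cons.1 ha' with rfl | ha'
        · exact absurd rfl h
        · exact hl _ ha'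
  have := Fintype.ofFinite α
  obtain ⟨g, hg, hl⟩ := key Finset.univ.toList
  exact PTF.of_enc (hg.of_enc_eq fun x => (hl x (by simp)).symm)

/-- All functions on a finite type are polynomial-time. -/
theorem PTF.of_finite [Finite α] (henc : Function.Injective (enc : α → BTree)) (f : α → β) :
    PTF f :=
  (PTF.finite_cases henc fun a => PTF.const (α := Unit) (f a)).comp (PTF.id'.prodMk (PTF.const ()))

end

open Turing TreeEnc BProg

/-! ### From polynomial-time functions to Turing machines -/

section Machine

variable {A : Type} (code : A → Bool × Bool)

/-- The bits of a list of pairs of bits on the left stack. -/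
def pairBits (l : List (Bool × Bool)) : List Bool := l.flatMap fun b => [b.2, b.1]

namespace BProg

def popPair : BProg A :=
  .seq popLeft (.pop .left fun v o => o.map fun b => (b, Reg.bit v))

def pushBool (p : Reg → Bool) : BProg A :=
  .ite p (pushBits [true, false, false]) (pushBits [false])

/-- Move the input to the work stack, as the code of a list of pairs of bits. -/
def readInput : BProg A :=
  .seq (drain (.pop .inp fun _ o => o.map code)
      (.seq (pushLeft fun v => (v.getD (false, false)).1)
        (pushLeft fun v => (v.getD (false, false)).2)))
    (.seq (pushWork fun _ => false)
      (drain popPair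
        (.seq (pushBool fun v => (v.getD (false, false)).2)
          (.seq (pushBool fun v => (v.getD (false, false)).1) (pushBits [true, true])))))

/-- Move the bits of the list on the work stack to the output stack. -/
def writeOutput : BProg A :=
  .seq (.seq popWork (.loop Reg.bit (.seq (.seq popWork
      (.ite Reg.bit (.seq popWork (.seq popWork (pushLeft fun _ => true)))
        (pushLeft fun _ => false))) popWork)))
    (drain popLeft (.push .out Reg.bit))

end BProg

theorem exec_pushBool (i : List A) (o w l r c : List Bool) (v : Reg) (p : Reg → Bool) :
    Exec (pushBool p) v (store i o w l r c) v (store i o ((enc (p v)).code ++ w) l r c) 5 := by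
  cases h : p v
  · exact (Exec.ite_false h (exec_pushBits i o w l r c [false] v)).mono (by simp)
  · exact (Exec.ite_true h (exec_pushBits i o w l r c [true, false, false] v)).mono (by simp)

theorem exec_popPair (w l : List Bool) (b : Bool × Bool) (v : Reg) :
    Exec popPair v (store ([] : List A) [] w (b.2 :: b.1 :: l) [] []) (some b)
      (store [] [] w l [] []) 2 := by
  have h := Exec.pop (Γ := Alph A) .left (fun v o => o.map fun b => (b, Reg.bit v))
    (some (false, b.2)) (store [] [] w (b.1 :: l) [] [])
  simp only [update_left] at h
  exact (exec_popLeft [] [] w (b.1 :: l) [] [] v b.2).seq h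

theorem exec_popPair_nil (w : List Bool) (v : Reg) :
    Exec popPair v (store ([] : List A) [] w [] [] []) none (store [] [] w [] [] []) 2 := by
  have h := Exec.pop (Γ := Alph A) .left (fun v o => o.map fun b => (b, Reg.bit v))
    none (store [] [] w [] [] [])
  simp only [update_left] at h
  exact (exec_popLeft_nil [] [] w [] [] v).seq h

/-- The first pass reverses the input onto the left stack; the second reverses it again and builds
the code of the list from its end, starting with the bit of the empty list. -/
theorem exec_readInput (l : List A) :
    Exec (readInput code) none (store l [] [] [] [] []) none
      (store [] [] (enc (l.map code)).code [] [] []) (21 * l.length + 20) := by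
  have h₁ := exec_drain (code := code) (j := 1) (k := 2) (Q := .pop .inp fun _ o => o.map code)
    (P := .seq (pushLeft fun v => (v.getD (false, false)).1)
        (pushLeft fun v => (v.getD (false, false)).2))
    (fun l d => store l [] [] (pairBits (d.map code)) [] [])
    (fun v b l d => by
      simpa using Exec.pop (Γ := Alph A) .inp (fun _ o => o.map code) v
        (store (b :: l) [] [] (pairBits (d.map code)) [] []))
    (fun v d => by
      simpa using Exec.pop (Γ := Alph A) .inp (fun _ o => o.map code) v
        (store [] [] [] (pairBits (d.map code)) [] []))
    (fun b l d => (exec_pushLeft l [] [] _ [] [] _ _).seq (exec_pushLeft l [] [] _ [] [] _ _))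
    l none []
  have h₂ := exec_drain (A := A) (code := id) (j := 2) (k := 13) (Q := popPair)
    (P := .seq (pushBool fun v => (v.getD (false, false)).2)
          (.seq (pushBool fun v => (v.getD (false, false)).1) (pushBits [true, true])))
    (fun l d => store [] [] (enc d).code (pairBits l) [] [])
    (fun v b l d => exec_popPair (enc d).code (pairBits l) b v)
    (fun v d => exec_popPair_nil (enc d).code v)
    (fun b l d => by
      have h := (exec_pushBool (A := A) [] [] (enc d).code (pairBits l) [] [] (some b) fun v =>
        (v.getD (false, false)).2).seq
        ((exec_pushBool [] [] _ (pairBits l) [] [] (some b) fun v => (v.getD (false, false)).1).seq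
        (exec_pushBits [] [] _ (pairBits l) [] [] [true, true] (some b)))
      simpa [BTree.code] using h)
    (l.map code).reverse none []
  simp only [List.append_nil, List.reverse_reverse, List.length_reverse, List.length_map,
    List.map_reverse] at h₁ h₂
  exact h₁.seq' ((exec_pushWork [] [] [] _ [] [] none _).seq h₂) (by omega)

theorem exec_writeOutput_loop (l : List Bool) (w u : List Bool) (v : Reg) :
    ∃ v₁ S₁ m₁ m₂, Exec popWork v (store ([] : List A) [] ((enc l).code ++ w) u [] []) v₁ S₁ m₁ ∧
      Exec (.loop Reg.bit (.seq (.seq popWork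
      (.ite Reg.bit (.seq popWork (.seq popWork (pushLeft fun _ => true)))
        (pushLeft fun _ => false))) popWork)) v₁ S₁ (some (false, false))
        (store [] [] w (l.reverse ++ u) [] []) m₂ ∧ m₁ + m₂ ≤ 10 * l.length + 2 := by
  induction l generalizing u v with
  | nil => exact ⟨_, _, _, _, exec_popWork [] [] _ u [] [] v false, .loop_false rfl, by simp⟩
  | cons b l ih =>
    cases b with
    | false =>
      obtain ⟨v₁, S₁, m₁, m₂, h₁, h₂, hm⟩ := ih (false :: u) (some (false, false))
      simp only [enc_cons, BTree.code, List.cons_append, List.append_assoc]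
      refine ⟨_, _, _, _, exec_popWork [] [] _ u [] [] v true, .loop_true rfl
        (((exec_popWork [] [] _ u [] [] _ false).seq (.ite_false rfl
          (exec_pushLeft [] [] _ u [] [] _ _))).seq h₁) (by simpa using h₂), ?_⟩
      simp; omega
    | true =>
      obtain ⟨v₁, S₁, m₁, m₂, h₁, h₂, hm⟩ := ih (true :: u) (some (false, false))
      simp only [enc_cons, BTree.code, List.cons_append, List.append_assoc]
      refine ⟨_, _, _, _, exec_popWork [] [] _ u [] [] v true, .loop_true rfl
        (((exec_popWork [] [] _ u [] [] _ true).seq (.ite_true rfl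
          ((exec_popWork [] [] _ u [] [] _ false).seq ((exec_popWork [] [] _ u [] [] _ false).seq
          (exec_pushLeft [] [] _ u [] [] _ _))))).seq h₁) (by simpa using h₂), ?_⟩
      simp; omega

theorem exec_writeOutput (l : List Bool) :
    Exec writeOutput none (store ([] : List A) [] (enc l).code [] [] []) none
      (store [] l [] [] [] []) (13 * l.length + 10) := by
  obtain ⟨v₁, S₁, m₁, m₂, h₁, h₂, hm⟩ := exec_writeOutput_loop (A := A) l [] [] none
  simp only [List.append_nil] at h₁ h₂
  have h₃ := exec_drain (A := A) (code := fun b => (false, b)) (j := 1) (k := 1) (Q := popLeft)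
    (P := .push .out Reg.bit) (fun l d => store [] d [] l [] [])
    (fun v b l d => exec_popLeft [] d [] l [] [] v b) (fun v d => exec_popLeft_nil [] d [] [] [] v)
    (fun b l d => by
      have h := Exec.push (Γ := Alph A) .out Reg.bit (some (false, b)) (store [] d [] l [] [])
      simp only [update_out] at h
      exact h)
    l.reverse (some (false, false)) []
  simp only [List.append_nil, List.reverse_reverse, List.length_reverse] at h₃
  exact (h₁.seq h₂).seq' h₃ (by omega)

/-- The machine that executes a program. -/
def machine [Fintype A] (P : BProg A) : FinTM2 where
  K := Stk
  k₀ := .inp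
  k₁ := .out
  Γ := Alph A
  Λ := Option P.Label
  main := some P.entry
  ΛFin := letI := P.fintypeLabel; inferInstanceAs (Fintype (Option P.Label))
  σ := Reg
  initialState := none
  Γk₀Fin := inferInstanceAs (Fintype A)
  m := fun l =>
    match l with
    | none => .halt
    | some l => P.stmt some none l

/-- From `PTF` to machines. Every input alphabet enters as pairs of bits, so one reading routine
serves strings as well as encoded pairs of strings; undoing `code` is left to `F`. -/
theorem nonempty_computable [Fintype A] {α β : Type} {ea : α → List A} {eb : β → List Bool}
    {f : α → β} (F : List (Bool × Bool) → List Bool) (hF : PTF F)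
    (h : ∀ a, F ((ea a).map code) = eb (f a)) :
    Nonempty (TM2ComputableInPolyTime ea eb f) := by
  obtain ⟨P, p, hP, hp⟩ := hF.bound A
  let R : BProg A := .seq (readInput code) (.seq P writeOutput)
  have hrun : ∀ a, Exec R none (store (ea a) [] [] [] [] []) none
      (store [] (eb (f a)) [] [] [] [])
      ((21 * Polynomial.X + 14 * p.comp (8 * Polynomial.X + 1) + 31).eval (ea a).length) := by
    intro a
    have h₁ := hP ((ea a).map code) []
    simp only [List.append_nil, h] at h₁
    refine (exec_readInput code (ea a)).seq' (h₁.seq (exec_writeOutput (eb (f a)))) ?_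
    -- A pair of bits has size at most 3 + 3 + 1 = 7, and a list cell adds one.
    have h₂ : tsize ((ea a).map code) ≤ 8 * (ea a).length + 1 := by
      have := tsize_list_le (l := (ea a).map code) (m := 7) fun b _ => by
        have := tsize_bool b.1
        have := tsize_bool b.2
        rw [tsize_pair]; omega
      rw [List.length_map] at this
      omega
    have h₃ := eval_mono_nat p h₂
    have h₄ := hp ((ea a).map code)
    rw [h] at h₄
    have h₅ := length_lt_tsize (eb (f a))
    simp
    omega
  refine ⟨⟨⟨machine R, Equiv.refl A, Equiv.refl Bool⟩,
    21 * Polynomial.X + 14 * p.comp (8 * Polynomial.X + 1) + 32, fun a => ?_⟩⟩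
  have hex := (hrun a).stepsTo (Λ := Option R.Label) (machine R).m some none fun l => rfl
  have hinit : initList (machine R) (List.map (Equiv.refl A).invFun (ea a)) =
      ⟨some (some R.entry), none, store (ea a) [] [] [] [] []⟩ := by
    unfold initList
    congr 1
    funext k
    cases k <;> first | rfl | (simp [machine]; rfl)
  have hhalt : haltList (machine R) (List.map (Equiv.refl Bool).invFun (eb (f a))) =
      ⟨none, none, store [] (eb (f a)) [] [] [] []⟩ := by
    unfold haltList
    congr 1
    funext k
    cases k <;> first | rfl | (simp [machine]; rfl)
  -- The additional step executes `halt` at the exit label.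
  refine ⟨⟨hex.choose + 1, ?_⟩, ?_⟩
  · rw [hinit]
    obtain ⟨-, hs⟩ := hex.choose_spec
    have hs' := hs.trans (StepsTo.one (c := ⟨none, none, store [] (eb (f a)) [] [] [] []⟩) rfl)
    rw [Option.map_some, hhalt]
    exact hs'
  · have := hex.choose_spec.1
    simp at this ⊢
    omega

end Machine

open Turing TreeEnc

/-! ### Encodings of finite types and of functions on finite types -/

section Finite

variable {α β γ κ : Type} [TreeEnc β] [TreeEnc γ]

theorem enc_nat_injective : Function.Injective (enc : ℕ → BTree) := by
  intro m n h
  have : tsize m = tsize n := by unfold tsize; rw [h]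
  simp at this
  exact this

theorem enc_bool_injective : Function.Injective (enc : Bool → BTree) := by
  intro a b h
  cases a <;> cases b <;> simp_all

theorem enc_pair_injective [TreeEnc α] (h₁ : Function.Injective (enc : α → BTree))
    (h₂ : Function.Injective (enc : β → BTree)) : Function.Injective (enc : α × β → BTree) := by
  rintro ⟨a, b⟩ ⟨a', b'⟩ h
  simp only [enc_pair, BTree.cons.injEq] at h
  rw [h₁ h.1, h₂ h.2]

/-- The encoding of a finite type by the numbers of its elements. -/
@[reducible] noncomputable def TreeEnc.ofFinite (α : Type) [Finite α] : TreeEnc α :=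
  ⟨fun a => enc (Finite.equivFin α a : ℕ)⟩

theorem enc_ofFinite_injective (α : Type) [Finite α] :
    Function.Injective (TreeEnc.ofFinite α).enc := fun _ _ h =>
  (Finite.equivFin α).injective (Fin.val_injective (enc_nat_injective h))

theorem exists_tsize_le [Finite β] : ∃ m, ∀ b : β, tsize b ≤ m := by
  have := Fintype.ofFinite β
  exact ⟨∑ b : β, tsize b, fun b => Finset.single_le_sum (f := fun b : β => tsize b)
    (fun _ _ => Nat.zero_le _) (Finset.mem_univ b)⟩

/-- Used for the family of stacks of a machine; the order of the list is arbitrary but fixed. -/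
noncomputable instance [Fintype κ] : TreeEnc (κ → β) :=
  ⟨fun f => enc (Finset.univ.toList.map f)⟩

variable [Fintype κ]

theorem tsize_pi (f : κ → β) : tsize f = ∑ k, (tsize (f k) + 1) + 1 := by
  rw [← Finset.sum_map_toList]
  show tsize (Finset.univ.toList.map f) = _
  induction (Finset.univ : Finset κ).toList with
  | nil => rfl
  | cons k l ih => simp [ih]; omega

theorem PTF.pi {f : γ → κ → β} (hf : ∀ k, PTF fun c => f c k) : PTF f := by
  have key : ∀ l : List κ, PTF fun c => l.map (f c) := by
    intro l
    induction l with
    | nil => exact PTF.const []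
    | cons k l ih => exact (hf k).cons ih
  exact (key Finset.univ.toList).of_enc_eq fun _ => rfl

theorem PTF.apply {f : γ → κ → β} (hf : PTF f) (k : κ) : PTF fun c => f c k := by
  classical
  have h₁ : PTF fun c => Finset.univ.toList.map (f c) := hf.of_enc_eq fun _ => rfl
  have h₂ := (PTF.treeLeft.comp PTF.toTree).comp
    (PTF.drop (PTF.const (Finset.univ.toList.idxOf k)) h₁)
  refine h₂.of_enc_eq fun c => ?_
  have hk : k ∈ (Finset.univ : Finset κ).toList := by simp
  have hlt := List.idxOf_lt_length_of_mem hk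
  rw [← List.map_drop, List.drop_eq_getElem_cons hlt]
  simp [BTree.left]

theorem PTF.update [DecidableEq κ] {f : γ → κ → β} {g : γ → β} (hf : PTF f) (k : κ) (hg : PTF g) :
    PTF fun c => Function.update (f c) k (g c) := by
  refine PTF.pi fun k' => ?_
  by_cases h : k' = k
  · subst h; simpa using hg
  · simpa [h] using hf.apply k'

theorem tsize_update_le [DecidableEq κ] (f : κ → β) (k : κ) (b : β) :
    tsize (Function.update f k b) + tsize (f k) = tsize f + tsize b := by
  rw [tsize_pi, tsize_pi, ← Finset.add_sum_erase _ _ (Finset.mem_univ k),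
    ← Finset.add_sum_erase _ _ (Finset.mem_univ k)]
  rw [Finset.sum_congr rfl fun x hx => by rw [Function.update_of_ne (Finset.ne_of_mem_erase hx)]]
  simp
  omega

/-- Evaluation of polynomials, in unary. -/
theorem PTF.polynomial_eval (p : Polynomial ℕ) {n : γ → ℕ} (hn : PTF n) :
    PTF fun c => p.eval (n c) := by
  induction p using Polynomial.induction_on' with
  | add p q hp hq => simpa using hp.add hq
  | monomial k a =>
    simp only [Polynomial.eval_monomial]
    refine (PTF.const a).mul ?_
    induction k with
    | zero => simpa using PTF.const 1
    | succ k ih => simpa [pow_succ] using ih.mul hn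

end Finite

/-! ### Turing machines compute polynomial-time functions -/

section Interpreter

variable {K : Type} [DecidableEq K] [Fintype K] {Γ : K → Type} {Λ σ Sym : Type}
  (e : ∀ k, Γ k → Sym) (d : ∀ k, Sym → Option (Γ k)) (dflt : Sym)

/-- The first symbol of a stack, which is represented by a list of codes of symbols. -/
def topSymbol (k : K) (l : List Sym) : Option (Γ k) :=
  bif l.isEmpty then none else d k (l.headD dflt)

/-- Execution of a statement on stacks that are represented by codes of symbols. -/
def stepRep : TM2.Stmt Γ Λ σ → σ → (K → List Sym) → Option Λ × σ × (K → List Sym)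
  | .push k f q, v, S => stepRep q v (Function.update S k (e k (f v) :: S k))
  | .peek k f q, v, S => stepRep q (f v (topSymbol d dflt k (S k))) S
  | .pop k f q, v, S =>
    stepRep q (f v (topSymbol d dflt k (S k))) (Function.update S k (S k).tail)
  | .load f q, v, S => stepRep q (f v) S
  | .branch f q₁ q₂, v, S => bif f v then stepRep q₁ v S else stepRep q₂ v S
  | .goto f, v, S => (some (f v), v, S)
  | .halt, v, S => (none, v, S)

/-- Execution of a statement, where halted configurations are unchanged. -/
def runRep (M : Λ → TM2.Stmt Γ Λ σ) (x : Option Λ × σ × (K → List Sym)) :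
    Option Λ × σ × (K → List Sym) :=
  match x.1 with
  | none => x
  | some l => stepRep e d dflt (M l) x.2.1 x.2.2

variable {e d}

/-- All symbols that the statement may push are decoded correctly. -/
def GoodStmt (e : ∀ k, Γ k → Sym) (d : ∀ k, Sym → Option (Γ k)) : TM2.Stmt Γ Λ σ → Prop
  | .push k f q => (∀ v, d k (e k (f v)) = some (f v)) ∧ GoodStmt e d q
  | .peek _ _ q => GoodStmt e d q
  | .pop _ _ q => GoodStmt e d q
  | .load _ q => GoodStmt e d q
  | .branch _ q₁ q₂ => GoodStmt e d q₁ ∧ GoodStmt e d q₂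
  | .goto _ => True
  | .halt => True

def GoodStacks (e : ∀ k, Γ k → Sym) (d : ∀ k, Sym → Option (Γ k)) (S : ∀ k, List (Γ k)) : Prop :=
  ∀ k, ∀ a ∈ S k, d k (e k a) = some a

/-- The representation of stacks. -/
def repStacks (e : ∀ k, Γ k → Sym) (S : ∀ k, List (Γ k)) : K → List Sym := fun k => (S k).map (e k)

omit [Fintype K] [DecidableEq K] in
theorem topSymbol_repStacks {S : ∀ k, List (Γ k)} (hS : GoodStacks e d S) (k : K) :
    topSymbol d dflt k (repStacks e S k) = (S k).head? := by
  have h := hS k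
  unfold topSymbol repStacks
  cases hk : S k with
  | nil => simp
  | cons a l => simp [hk] at h; simp [h]

omit [Fintype K] in
theorem repStacks_update (S : ∀ k, List (Γ k)) (k : K) (l : List (Γ k)) :
    repStacks e (Function.update S k l) = Function.update (repStacks e S) k (l.map (e k)) := by
  funext k'
  by_cases h : k' = k
  · subst h; simp [repStacks]
  · simp [repStacks, h]

omit [Fintype K] in
theorem GoodStacks.update {S : ∀ k, List (Γ k)} (hS : GoodStacks e d S) (k : K) (l : List (Γ k))
    (hl : ∀ a ∈ l, d k (e k a) = some a) : GoodStacks e d (Function.update S k l) := by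
  intro k'
  by_cases h : k' = k
  · subst h; simpa using hl
  · simpa [h] using hS k'

omit [Fintype K] in
-- Symbols are manipulated only through their codes. This is faithful as long as every symbol on a
-- stack can be decoded, which is why that invariant is proved along with the simulation.
theorem stepRep_repStacks (q : TM2.Stmt Γ Λ σ) (hq : GoodStmt e d q) (v : σ)
    (S : ∀ k, List (Γ k)) (hS : GoodStacks e d S) :
    stepRep e d dflt q v (repStacks e S) = ((TM2.stepAux q v S).l, (TM2.stepAux q v S).var,
      repStacks e (TM2.stepAux q v S).stk) ∧ GoodStacks e d (TM2.stepAux q v S).stk := by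
  induction q generalizing v S with
  | push k f q ih =>
    have h := ih hq.2 v _ (hS.update k (f v :: S k) (by
      simpa [hq.1 v] using hS k))
    rw [repStacks_update] at h
    exact h
  | peek k f q ih =>
    have h := ih hq (f v (S k).head?) S hS
    rw [← topSymbol_repStacks dflt hS] at h
    simpa [stepRep, topSymbol_repStacks dflt hS] using h
  | pop k f q ih =>
    have h := ih hq (f v (S k).head?) _ (hS.update k (S k).tail fun a ha =>
      hS k a (List.mem_of_mem_tail ha))
    rw [repStacks_update, List.map_tail] at h
    simp only [stepRep, topSymbol_repStacks dflt hS]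
    exact h
  | load f q ih => exact ih hq (f v) S hS
  | branch f q₁ q₂ ih₁ ih₂ =>
    cases h : f v
    · simpa [stepRep, h] using ih₂ hq.2 v S hS
    · simpa [stepRep, h] using ih₁ hq.1 v S hS
  | goto f => exact ⟨rfl, hS⟩
  | halt => exact ⟨rfl, hS⟩

omit [Fintype K] in
theorem runRep_iterate {M : Λ → TM2.Stmt Γ Λ σ} (hM : ∀ l, GoodStmt e d (M l)) (n : ℕ)
    (c c' : TM2.Cfg Γ Λ σ) (hS : GoodStacks e d c.stk) (h : StepsTo M n c c') :
    (runRep e d dflt M)^[n] (c.l, c.var, repStacks e c.stk) =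
      (c'.l, c'.var, repStacks e c'.stk) ∧ GoodStacks e d c'.stk := by
  induction n generalizing c with
  | zero =>
    simp only [StepsTo, Function.iterate_zero, id, Option.some.injEq] at h
    subst h
    exact ⟨rfl, hS⟩
  | succ n ih =>
    rw [StepsTo, Function.iterate_succ_apply] at h
    obtain ⟨l, v, S⟩ := c
    cases l with
    | none =>
      -- A halted configuration has no successor, so it cannot lead to `c'` in a positive number of
      -- steps.
      have h' : some c' = none := h.symm.trans (Function.iterate_fixed rfl n)
      cases h'
    | some l =>
      obtain ⟨h₁, h₂⟩ := stepRep_repStacks dflt (M l) (hM l) v S hS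
      rw [Function.iterate_succ_apply]
      have := ih (TM2.stepAux (M l) v S) h₂ h
      rwa [← h₁] at this

/-! ### Time and size of one simulated machine step -/

section Sizes

variable [TreeEnc σ] [TreeEnc Sym] [TreeEnc (Option Λ)] [Finite σ] [Finite Sym]

/-- The functions inside a statement are arbitrary, but they depend only on the state and possibly
one top symbol. These range over finite types, on which every function is polynomial-time. -/
theorem PTF.stepRep (hσ : Function.Injective (enc : σ → BTree))
    (hSym : Function.Injective (enc : Sym → BTree)) (q : TM2.Stmt Γ Λ σ) :
    PTF fun x : σ × (K → List Sym) => stepRep e d dflt q x.1 x.2 := by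
  have htop : ∀ k (f : σ → Option (Γ k) → σ),
      PTF fun x : σ × (K → List Sym) => f x.1 (topSymbol d dflt k (x.2 k)) := by
    intro k f
    have hinj := enc_pair_injective hσ (enc_pair_injective enc_bool_injective hSym)
    have hS : PTF fun x : σ × (K → List Sym) => x.2 k := (PTF.id'.snd).apply k
    exact (PTF.of_finite hinj fun y : σ × Bool × Sym => f y.1 (bif y.2.1 then none else d k y.2.2)).comp
      (PTF.id'.fst.prodMk (hS.isEmpty.prodMk (hS.headD (PTF.const dflt))))
  induction q with
  | push k f q ih =>
    exact ih.comp (PTF.id'.fst.prodMk (PTF.update PTF.id'.snd k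
      (((PTF.of_finite hσ fun v => e k (f v)).comp PTF.id'.fst).cons (PTF.apply PTF.id'.snd k))))
  | peek k f q ih => exact ih.comp ((htop k f).prodMk PTF.id'.snd)
  | pop k f q ih =>
    exact ih.comp ((htop k f).prodMk (PTF.update PTF.id'.snd k (PTF.apply PTF.id'.snd k).tail))
  | load f q ih => exact ih.comp (((PTF.of_finite hσ f).comp PTF.id'.fst).prodMk PTF.id'.snd)
  | branch f q₁ q₂ ih₁ ih₂ => exact ((PTF.of_finite hσ f).comp PTF.id'.fst).cond ih₁ ih₂
  | goto f => exact ((PTF.of_finite hσ fun v => some (f v)).comp PTF.id'.fst).prodMk PTF.id'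
  | halt => exact (PTF.const none).prodMk PTF.id'

/-- A statement pushes a bounded number of symbols, and labels and states have bounded size. So
growth is additive, and iteration over polynomially many steps stays polynomial. -/
theorem tsize_stepRep_le [Finite Λ] (q : TM2.Stmt Γ Λ σ) : ∃ m, ∀ v (S : K → List Sym),
    tsize (stepRep e d dflt q v S) ≤ tsize S + m := by
  obtain ⟨m₁, h₁⟩ := exists_tsize_le (β := Option Λ)
  obtain ⟨m₂, h₂⟩ := exists_tsize_le (β := σ)
  obtain ⟨m₃, h₃⟩ := exists_tsize_le (β := Sym)
  induction q with
  | push k f q ih =>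
    obtain ⟨m, h⟩ := ih
    refine ⟨m + m₃ + 1, fun v S => (h v _).trans ?_⟩
    have h₄ := tsize_update_le S k (e k (f v) :: S k)
    have h₅ := h₃ (e k (f v))
    simp at h₄
    omega
  | peek k f q ih => exact ih.imp fun m h v S => h _ S
  | pop k f q ih =>
    obtain ⟨m, h⟩ := ih
    refine ⟨m, fun v S => (h _ _).trans ?_⟩
    have h₄ := tsize_update_le S k (S k).tail
    have h₅ := tsize_tail_le (S k)
    omega
  | load f q ih => exact ih.imp fun m h v S => h _ S
  | branch f q₁ q₂ ih₁ ih₂ =>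
    obtain ⟨m, h⟩ := ih₁
    obtain ⟨m', h'⟩ := ih₂
    refine ⟨m + m', fun v S => ?_⟩
    have h₄ := h v S
    have h₅ := h' v S
    simp only [TotalSearch.stepRep]
    cases f v <;> simp only [cond_true, cond_false] <;> omega
  | goto f =>
    refine ⟨m₁ + m₂ + 2, fun v S => ?_⟩
    have h₄ := h₁ (some (f v))
    have h₅ := h₂ v
    simp only [TotalSearch.stepRep, tsize_mk]
    omega
  | halt =>
    refine ⟨m₁ + m₂ + 2, fun v S => ?_⟩
    have h₄ := h₁ none
    have h₅ := h₂ v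
    simp only [TotalSearch.stepRep, tsize_mk]
    omega

theorem PTF.runRep [Finite Λ] (hΛ : Function.Injective (enc : Option Λ → BTree))
    (hσ : Function.Injective (enc : σ → BTree))
    (hSym : Function.Injective (enc : Sym → BTree)) (M : Λ → TM2.Stmt Γ Λ σ) :
    PTF (runRep e d dflt M) := by
  have h := PTF.finite_cases hΛ (f := fun l (x : σ × (K → List Sym)) =>
    TotalSearch.runRep e d dflt M (l, x)) fun l => by
      cases l with
      | none => exact (PTF.const none).prodMk PTF.id'
      | some l => exact PTF.stepRep dflt hσ hSym (M l)
  exact h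

theorem tsize_runRep_le [Finite Λ] (M : Λ → TM2.Stmt Γ Λ σ) :
    ∃ m, ∀ x, tsize (runRep e d dflt M x) ≤ tsize x + m := by
  have := Fintype.ofFinite Λ
  choose m hm using fun l => tsize_stepRep_le (e := e) (d := d) dflt (M l)
  refine ⟨∑ l, m l, fun ⟨l, v, S⟩ => ?_⟩
  cases l with
  | none => exact Nat.le_add_right _ _
  | some l =>
    have h₁ := hm l v S
    have h₂ := Finset.single_le_sum (f := m) (fun _ _ => Nat.zero_le _) (Finset.mem_univ l)
    simp only [TotalSearch.runRep, tsize_mk]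
    omega

end Sizes

omit [Fintype K] [DecidableEq K] in
-- Only the input stack is required to have a finite alphabet. Still, a push depends on the state
-- alone, and labels and states are finitely many, so finitely many symbols can ever be pushed.
-- Together with the input symbols they form one finite alphabet for all stacks.
theorem exists_goodStmt [Finite Λ] [Finite σ] (M : Λ → TM2.Stmt Γ Λ σ) (k₀ : K)
    [Finite (Γ k₀)] : ∃ (Sym : Type) (_ : Finite Sym) (_ : Inhabited Sym) (e : ∀ k, Γ k → Sym)
      (d : ∀ k, Sym → Option (Γ k)), (∀ l, GoodStmt e d (M l)) ∧ ∀ a, d k₀ (e k₀ a) = some a := by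
  classical
  have hstmt : ∀ q : TM2.Stmt Γ Λ σ, ∃ s : Set (Σ k, Γ k), s.Finite ∧
      ∀ (Sym : Type) (e : ∀ k, Γ k → Sym) (d : ∀ k, Sym → Option (Γ k)),
      (∀ a ∈ s, d a.1 (e a.1 a.2) = some a.2) → GoodStmt e d q := by
    intro q
    induction q with
    | push k f q ih =>
      obtain ⟨s, hs, h⟩ := ih
      refine ⟨s ∪ Set.range fun v => ⟨k, f v⟩, hs.union (Set.finite_range _), fun Sym e d hd =>
        ⟨fun v => hd ⟨k, f v⟩ (Or.inr ⟨v, rfl⟩), h Sym e d fun a ha => hd a (Or.inl ha)⟩⟩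
    | peek k f q ih => exact ih
    | pop k f q ih => exact ih
    | load f q ih => exact ih
    | branch f q₁ q₂ ih₁ ih₂ =>
      obtain ⟨s, hs, h⟩ := ih₁
      obtain ⟨s', hs', h'⟩ := ih₂
      exact ⟨s ∪ s', hs.union hs', fun Sym e d hd => ⟨h Sym e d fun a ha => hd a (Or.inl ha),
        h' Sym e d fun a ha => hd a (Or.inr ha)⟩⟩
    | goto f => exact ⟨∅, Set.finite_empty, fun _ _ _ _ => trivial⟩
    | halt => exact ⟨∅, Set.finite_empty, fun _ _ _ _ => trivial⟩
  choose s hs h using hstmt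
  let s' : Set (Σ k, Γ k) := (⋃ l, s (M l)) ∪ Set.range fun a : Γ k₀ => ⟨k₀, a⟩
  have hs' : s'.Finite := (Set.finite_iUnion fun l => hs (M l)).union (Set.finite_range _)
  have : Finite s' := hs'
  -- All symbols that never occur share the code `none`.
  let e : ∀ k, Γ k → Option s' := fun k a => if ha : ⟨k, a⟩ ∈ s' then some ⟨⟨k, a⟩, ha⟩ else none
  let d : ∀ k, Option s' → Option (Γ k) := fun k x =>
    x.bind fun x => if hk : x.1.1 = k then some (hk ▸ x.1.2) else none
  have hd : ∀ a ∈ s', d a.1 (e a.1 a.2) = some a.2 := by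
    rintro ⟨k, a⟩ ha
    simp [d, e, ha]
  exact ⟨Option s', inferInstance, inferInstance, e, d,
    fun l => h _ _ e d fun a ha => hd a (Or.inl (Set.mem_iUnion.2 ⟨l, ha⟩)),
    fun a => hd ⟨k₀, a⟩ (Or.inr ⟨a, rfl⟩)⟩

end Interpreter

/-- From machines to `PTF`: lay out the initial configuration, iterate the simulated step as often
as the time bound says, and read off the output stack. -/
theorem exists_ptf_of_computable {A α β : Type} [Finite A] [TreeEnc A]
    (hA : Function.Injective (enc : A → BTree)) {ea : α → List A} {eb : β → List Bool} {f : α → β}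
    (h : TM2ComputableInPolyTime ea eb f) :
    ∃ G : List A → List Bool, PTF G ∧ ∀ a, G (ea a) = eb (f a) := by
  obtain ⟨⟨M, φ, ψ⟩, p, hout⟩ := h
  have := M.kFin
  have := M.ΛFin
  have := M.σFin
  have := M.Γk₀Fin
  obtain ⟨Sym, _, _, e, d, hM, hd⟩ := exists_goodStmt M.m M.k₀
  let _ : TreeEnc Sym := TreeEnc.ofFinite Sym
  let _ : TreeEnc M.σ := TreeEnc.ofFinite M.σ
  let _ : TreeEnc (Option M.Λ) := TreeEnc.ofFinite (Option M.Λ)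
  have hSym := enc_ofFinite_injective Sym
  let run := runRep e d default M.m
  let start : List A → Option M.Λ × M.σ × (M.K → List Sym) := fun l =>
    (some M.main, M.initialState, fun k =>
      if k = M.k₀ then l.map fun a => e M.k₀ (φ.symm a) else [])
  have hstart : PTF start := by
    refine (PTF.const _).prodMk ((PTF.const _).prodMk (PTF.pi fun k => ?_))
    by_cases hk : k = M.k₀
    · simp only [hk, if_true]
      exact PTF.id'.map ((PTF.of_finite hA fun a => e M.k₀ (φ.symm a)).comp PTF.id'.snd)
    · simpa only [hk, if_false] using PTF.const _
  have hrun : PTF run := PTF.runRep default (enc_ofFinite_injective _) (enc_ofFinite_injective _)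
    hSym M.m
  obtain ⟨m, hm⟩ := tsize_runRep_le (e := e) (d := d) default M.m
  have hiter : PTF fun l => run^[p.eval l.length] (start l) := by
    obtain ⟨q, hq⟩ := hstart.size
    refine PTF.iterate (f := fun _ => run) (PTF.polynomial_eval p (PTF.length PTF.id')) hstart
      (hrun.comp PTF.id'.snd) ⟨q + p * Polynomial.C m, fun l n hn => ?_⟩
    -- Each step adds at most the constant `m`.
    have h₁ : tsize (run^[n] (start l)) ≤ tsize (start l) + n * m := by
      clear hn
      induction n with
      | zero => simp
      | succ n ih =>
        rw [Function.iterate_succ_apply', add_mul]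
        exact (hm _).trans (by omega)
    have h₂ := hq l
    have h₃ : n ≤ p.eval (tsize l) :=
      hn.trans (eval_mono_nat p (length_lt_tsize l).le)
    have h₄ := Nat.mul_le_mul_right m h₃
    simp only [Polynomial.eval_add, Polynomial.eval_mul, Polynomial.eval_C]
    omega
  refine ⟨fun l => ((run^[p.eval l.length] (start l)).2.2 M.k₁).map fun s =>
    ((d M.k₁ s).map ψ).getD false, ?_, fun a => ?_⟩
  · exact (hiter.snd.snd.apply M.k₁).map ((PTF.of_finite hSym fun s =>
      ((d M.k₁ s).map ψ).getD false).comp PTF.id'.snd)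
  · obtain ⟨⟨n, hn⟩, hle⟩ := hout a
    have hgood : GoodStacks e d (initList M ((ea a).map φ.invFun)).stk := by
      intro k b hb
      simp only [initList] at hb
      split_ifs at hb with hk
      · subst hk
        exact hd b
      · simp at hb
    obtain ⟨h₁, h₂⟩ := runRep_iterate default hM n _ _ hgood hn
    have h₃ : start (ea a) = (some M.main, M.initialState,
        repStacks e (initList M ((ea a).map φ.invFun)).stk) := by
      simp only [start, Prod.mk.injEq, true_and]
      funext k
      by_cases hk : k = M.k₀
      · subst hk
        simp [repStacks, initList]
      · simp [repStacks, initList, hk]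
    have h₄ : run^[p.eval (ea a).length] (start (ea a)) = (none, M.initialState,
        repStacks e (haltList M ((eb (f a)).map ψ.invFun)).stk) := by
      -- The machine may halt before the time bound; the remaining `j` iterations leave the halted
      -- configuration unchanged.
      obtain ⟨j, hj⟩ := Nat.exists_eq_add_of_le hle
      simp only at hj
      rw [hj, Nat.add_comm, Function.iterate_add_apply, h₃]
      refine (congrArg _ h₁).trans ?_
      exact Function.iterate_fixed rfl j
    refine (congrArg (fun x : Option M.Λ × M.σ × (M.K → List Sym) => (x.2.2 M.k₁).map fun s =>
      ((d M.k₁ s).map ψ).getD false) h₄).trans ?_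
    have h₅ := h₂ M.k₁
    simp only [repStacks, haltList, dite_true, List.map_map] at h₅ ⊢
    refine (List.map_congr_left (g := ψ) fun b hb => ?_).trans ?_
    · simp [h₅ b (by simpa using hb)]
    · simp

/-! ### Polynomial-time computability, decidability and reducibility in terms of `PTF` -/

instance : TreeEnc (Bool ⊕ Bool) :=
  ⟨fun s => enc (Sum.elim (fun b => (false, b)) (fun b => (true, b)) s)⟩

theorem enc_sum_injective : Function.Injective (enc : Bool ⊕ Bool → BTree) := by
  intro a b h
  have := enc_pair_injective enc_bool_injective enc_bool_injective h
  rcases a with a | a <;> rcases b with b | b <;> simp_all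

theorem polyTime_iff {f : List Bool → List Bool} : PolyTime f ↔ PTF f := by
  constructor
  · rintro ⟨h⟩
    obtain ⟨G, hG, h⟩ := exists_ptf_of_computable enc_bool_injective h
    exact (funext h : G = f) ▸ hG
  · intro h
    exact nonempty_computable (fun b => (false, b)) (fun l => f (l.map Prod.snd)) (by fun_prop)
      fun a => by simp

theorem encodePair_eq (p : List Bool × List Bool) :
    encodePair p = p.1.map Sum.inl ++ p.2.map Sum.inr := rfl

/-- The pairs of bits that stand for the symbols of the code of a pair of strings. -/
def pairCode : Bool ⊕ Bool → Bool × Bool := Sum.elim (fun b => (false, b)) fun b => (true, b)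

/-- The pair of strings with the given code. -/
def unpair (l : List (Bool × Bool)) : List Bool × List Bool :=
  ((l.filter fun b => !b.1).map Prod.snd, (l.filter fun b => b.1).map Prod.snd)

theorem unpair_encodePair (p : List Bool × List Bool) :
    unpair ((encodePair p).map pairCode) = p := by
  obtain ⟨x, y⟩ := p
  simp [encodePair_eq, unpair, pairCode, List.filter_map, Function.comp_def]

@[fun_prop]
theorem PTF.unpair : PTF unpair := by
  unfold TotalSearch.unpair
  fun_prop

theorem polyTime₂_iff {f : List Bool → List Bool → List Bool} :
    PolyTime₂ f ↔ PTF fun p : List Bool × List Bool => f p.1 p.2 := by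
  constructor
  · rintro ⟨h⟩
    obtain ⟨G, hG, h⟩ := exists_ptf_of_computable enc_sum_injective h
    have h₁ : PTF encodePair := by
      show PTF fun p : List Bool × List Bool => p.1.map Sum.inl ++ p.2.map Sum.inr
      exact (PTF.map PTF.id'.fst ((PTF.of_finite enc_bool_injective Sum.inl).comp
        PTF.id'.snd)).append (PTF.map PTF.id'.snd ((PTF.of_finite enc_bool_injective Sum.inr).comp
        PTF.id'.snd))
    exact (funext h : (fun p => G (encodePair p)) = _) ▸ hG.comp h₁
  · intro h
    exact nonempty_computable pairCode (fun l => f (unpair l).1 (unpair l).2)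
      (h.comp PTF.unpair) fun a => by rw [unpair_encodePair]; rfl

theorem polyTimeDecidable_of_ptf {S : List Bool → List Bool → Prop}
    {d : List Bool × List Bool → Bool} (hd : PTF d) (h : ∀ x y, d (x, y) = true ↔ S x y) :
    PolyTimeDecidable S :=
  ⟨d, h, nonempty_computable pairCode (fun l => [d (unpair l)])
    ((hd.comp PTF.unpair).cons (PTF.const [])) fun a => by rw [unpair_encodePair]; rfl⟩

/-- Machines are awkward to compose, so both reductions are translated to `PTF` and the composite is
translated back. -/
theorem Reducible.trans {S T U : List Bool → List Bool → Prop} (h₁ : Reducible S T)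
    (h₂ : Reducible T U) : Reducible S U := by
  obtain ⟨f, g, hf, hg, h⟩ := h₁
  obtain ⟨f', g', hf', hg', h'⟩ := h₂
  rw [polyTime_iff] at hf hf'
  rw [polyTime₂_iff] at hg hg'
  refine ⟨fun x => f' (f x), fun x y => g x (g' (f x) y), polyTime_iff.2 (hf'.comp hf),
    polyTime₂_iff.2 ?_, fun x y hy => h _ _ (h' _ _ hy)⟩
  exact hg.comp (f := fun p : List Bool × List Bool => (p.1, g' (f p.1) p.2)) (PTF.prodMk
    (by fun_prop) (hg'.comp (f := fun p : List Bool × List Bool => (f p.1, p.2)) (by fun_prop)))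

/-- To solve `S`, translate the instance and search a list of candidates that is computed from the
solution of the translated instance. -/
theorem reducible_of_candidates {S T : List Bool → List Bool → Prop} {f : List Bool → List Bool}
    {cands : List Bool → List Bool → List (List Bool)} {d : List Bool × List Bool → Bool}
    (hf : PTF f) (hc : PTF fun p : List Bool × List Bool => cands p.1 p.2) (hd : PTF d)
    (hS : ∀ x y, d (x, y) = true → S x y)
    (h : ∀ x y, T (f x) y → ∃ z ∈ cands x y, d (x, z) = true) : Reducible S T := by
  refine ⟨f, fun x y => ((cands x y).filter fun z => d (x, z)).headD [], polyTime_iff.2 hf,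
    polyTime₂_iff.2 ?_, fun x y hy => hS _ _ ?_⟩
  · exact (hc.filter (p := fun c z => d (c.1, z)) (hd.comp (by fun_prop))).headD (PTF.const [])
  · obtain ⟨z, hz, hz'⟩ := h x y hy
    cases hl : (cands x y).filter fun z => d (x, z) with
    | nil => exact absurd hz' (by simpa using List.filter_eq_nil_iff.1 hl z hz)
    | cons a l =>
      have : a ∈ (cands x y).filter fun z => d (x, z) := by rw [hl]; simp
      show d (x, List.headD _ []) = true
      rw [hl]
      exact (List.mem_filter.1 this).2

open TreeEnc

/-! ### Binary representation -/

theorem bc_append (u v : List Bool) : bc (u ++ v) = bc u * 2 ^ v.length + bc v := by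
  induction v using List.reverseRecOn with
  | nil => simp [bc]
  | append_singleton v b ih =>
    have h : ∀ w : List Bool, bc (w ++ [b]) = 2 * bc w + b.toNat := fun w => by
      simp [bc]
    rw [← List.append_assoc, h, h, ih, List.length_append, List.length_singleton, pow_succ]
    ring

theorem bc_singleton (b : Bool) : bc [b] = b.toNat := by simp [bc]

theorem bc_concat (u : List Bool) (b : Bool) : bc (u ++ [b]) = 2 * bc u + b.toNat := by
  rw [bc_append, bc_singleton, List.length_singleton, pow_one, Nat.mul_comm]

theorem bc_cons (b : Bool) (u : List Bool) : bc (b :: u) = b.toNat * 2 ^ u.length + bc u := by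
  rw [← List.singleton_append, bc_append, bc_singleton]

theorem bc_lt (u : List Bool) : bc u < 2 ^ u.length := by
  induction u with
  | nil => simp [bc]
  | cons b u ih =>
    rw [bc_cons, List.length_cons, pow_succ]
    have := b.toNat_le
    nlinarith [Nat.mul_le_mul_right (2 ^ u.length) this]

theorem bc_replicate_false (n : ℕ) : bc (List.replicate n false) = 0 := by
  induction n with
  | zero => rfl
  | succ n ih => rw [List.replicate_succ, bc_cons, ih]; simp

@[simp] theorem length_bd (k a : ℕ) : (bd k a).length = k := by simp [bd]

theorem bd_succ (k a : ℕ) : bd (k + 1) a = bd k (a / 2) ++ [a.testBit 0] := by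
  unfold bd
  rw [List.range_succ_eq_map]
  simp [Function.comp_def, Nat.testBit_succ]

theorem bd_two_mul_add (k a : ℕ) (b : Bool) : bd (k + 1) (2 * a + b.toNat) = bd k a ++ [b] := by
  rw [bd_succ]
  have h : (2 * a + b.toNat) / 2 = a := by cases b <;> simp; omega
  rw [h, Nat.testBit_zero]
  cases b <;> simp

theorem two_mul_add_eq (a : ℕ) : 2 * (a / 2) + (a.testBit 0).toNat = a := by
  rw [Nat.testBit_zero]
  rcases Nat.mod_two_eq_zero_or_one a with h | h <;> simp [h] <;> omega

theorem bc_bd {k a : ℕ} (h : a < 2 ^ k) : bc (bd k a) = a := by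
  induction k generalizing a with
  | zero => simp at h; subst h; rfl
  | succ k ih =>
    rw [bd_succ, bc_concat, ih (by rw [pow_succ] at h; omega), two_mul_add_eq]

theorem bd_bc (u : List Bool) : bd u.length (bc u) = u := by
  induction u using List.reverseRecOn with
  | nil => rfl
  | append_singleton u b ih =>
    rw [bc_concat, List.length_append, List.length_singleton, bd_two_mul_add, ih]

theorem bc_inj {u v : List Bool} (h : u.length = v.length) (h' : bc u = bc v) : u = v := by
  rw [← bd_bc u, ← bd_bc v, h, h']

/-- Binary representation of fixed length from an arbitrary one. -/
def padTo (k : ℕ) (u : List Bool) : List Bool :=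
  List.replicate (k - u.length) false ++ u.drop (u.length - k)

theorem length_padTo (k : ℕ) (u : List Bool) : (padTo k u).length = k := by
  simp [padTo]; omega

/-- Changes the length of a binary representation by manipulating the string, without passing
through a number in unary; superfluous high bits are cut off. -/
theorem bd_bc_eq_padTo (k : ℕ) (u : List Bool) : bd k (bc u) = padTo k u := by
  induction k generalizing u with
  | zero => simp [padTo, bd]
  | succ k ih =>
    induction u using List.reverseRecOn with
    | nil =>
      have h := ih []
      rw [show bc [] = 2 * bc [] + false.toNat from rfl, bd_two_mul_add, h]
      simp [padTo, List.replicate_succ']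
    | append_singleton u b _ =>
      rw [bc_concat, bd_two_mul_add, ih]
      unfold padTo
      rw [List.length_append, List.length_singleton, Nat.add_sub_add_right, Nat.add_sub_add_right,
        List.append_assoc, List.drop_append_of_le_length (Nat.sub_le _ _)]

theorem bd₀_zero : bd₀ 0 = [false] := rfl

theorem bd₀_two_mul_add (a : ℕ) (b : Bool) :
    bd₀ (2 * a + b.toNat) = if a = 0 then [b] else bd₀ a ++ [b] := by
  split_ifs with h
  · subst h; cases b <;> rfl
  · unfold bd₀
    rw [← bd_two_mul_add]
    congr 2
    rw [Nat.log_of_one_lt_of_le (by norm_num) (by omega)]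
    congr 2
    cases b <;> simp; omega

theorem bc_bd₀ (a : ℕ) : bc (bd₀ a) = a := bc_bd (Nat.lt_pow_succ_log_self (by norm_num) a)

theorem bd₀_injective : Function.Injective bd₀ := Function.LeftInverse.injective bc_bd₀

theorem bd₀_eq_false_iff (a : ℕ) : bd₀ a = [false] ↔ a = 0 :=
  ⟨fun h => bd₀_injective h, fun h => h ▸ rfl⟩

/-- Leading zeroes are removed from left to right: while the value is 0, the accumulator is
`[false]` and the next bit replaces it. -/
theorem bd₀_bc (u : List Bool) :
    bd₀ (bc u) = u.foldl (fun acc b => bif acc == [false] then [b] else acc ++ [b]) [false] := by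
  induction u using List.reverseRecOn with
  | nil => rfl
  | append_singleton u b ih =>
    rw [List.foldl_append, ← ih, bc_concat, bd₀_two_mul_add]
    by_cases h : bc u = 0
    · simp [h, bd₀_zero]
    · have : ¬ bd₀ (bc u) = [false] := mt (bd₀_eq_false_iff _).1 h
      simp only [h, if_false, List.foldl_cons, List.foldl_nil]
      rw [beq_eq_false_iff_ne.2 this]
      rfl

theorem length_bd₀ (a : ℕ) : (bd₀ a).length = Nat.log 2 a + 1 := length_bd _ _

theorem length_bd₀_mono {a b : ℕ} (h : a ≤ b) : (bd₀ a).length ≤ (bd₀ b).length := by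
  rw [length_bd₀, length_bd₀]
  exact Nat.add_le_add_right (Nat.log_mono_right h) 1

theorem bd₀_of_ne_zero {a : ℕ} (h : a ≠ 0) : ∃ u, bd₀ a = true :: u := by
  have h₁ := length_bd₀ a
  obtain ⟨b, u, hu⟩ := List.exists_cons_of_length_eq_add_one h₁
  refine ⟨u, ?_⟩
  cases b with
  | true => exact hu
  | false =>
    exfalso
    have h₂ := bc_bd₀ a
    rw [hu, bc_cons] at h₂
    have h₃ := bc_lt u
    have h₄ : u.length = Nat.log 2 a := by simpa [hu] using h₁
    rw [h₄] at h₃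
    have h₅ := Nat.pow_log_le_self 2 h
    simp at h₂
    omega

theorem bc_eq_zero_iff (u : List Bool) : bc u = 0 ↔ u.all (fun b => !b) = true := by
  induction u with
  | nil => simp [bc]
  | cons b u ih => rw [bc_cons]; cases b <;> simp [ih]

/-- The ceiling of the logarithm is the number of digits, less one exactly if all digits after the
first are 0, that is, for powers of two. The value at 0 fits the same rule. -/
theorem clog_eq (a : ℕ) : Nat.clog 2 a =
    bif (bd₀ a).tail.all (fun b => !b) then (bd₀ a).length - 1 else (bd₀ a).length := by
  by_cases h : a = 0
  · subst h; simp [bd₀_zero]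
  · obtain ⟨u, hu⟩ := bd₀_of_ne_zero h
    have h₁ := bc_bd₀ a
    rw [hu, bc_cons] at h₁
    have h₂ := bc_lt u
    rw [hu, List.tail_cons, List.length_cons]
    simp only [Bool.toNat_true, one_mul] at h₁
    by_cases h₃ : bc u = 0
    · rw [(bc_eq_zero_iff u).1 h₃, ← h₁, h₃, add_zero, Nat.clog_pow 2 _ (by norm_num)]
      simp
    · have h₄ : u.all (fun b => !b) = false := by
        rw [← Bool.not_eq_true, ← bc_eq_zero_iff]; exact h₃
      rw [h₄, cond_false]
      apply le_antisymm
      · exact Nat.clog_le_of_le_pow (by rw [pow_succ]; omega)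
      · exact (Nat.lt_clog_iff_pow_lt (by norm_num)).2 (by omega)

/-! ### Arithmetic in binary -/

/-- Comparison of binary numbers of the same length. -/
def ltBits (l : List (Bool × Bool)) : Bool × Bool :=
  l.foldl (fun r b => (r.1 || (r.2 && (!b.1 && b.2)), r.2 && (b.1 == b.2))) (false, true)

theorem ltBits_eq (l : List (Bool × Bool)) :
    ltBits l = (decide (bc (l.map Prod.fst) < bc (l.map Prod.snd)),
      decide (bc (l.map Prod.fst) = bc (l.map Prod.snd))) := by
  induction l using List.reverseRecOn with
  | nil => rfl
  | append_singleton l b ih =>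
    unfold ltBits at ih ⊢
    rw [List.foldl_append, ih]
    simp only [List.foldl_cons, List.foldl_nil, List.map_append, List.map_cons, List.map_nil,
      bc_concat]
    obtain ⟨b, b'⟩ := b
    cases b <;> cases b' <;> simp <;> (try constructor) <;>
      first | omega | (rw [Bool.eq_iff_iff]; simp; omega)

/-- Sum of three binary numbers of the same length and `1`: the carry and the sum. -/
def addBits (l : List (Bool × Bool × Bool)) : ℕ × List Bool :=
  l.foldr (fun b r => ((b.1.toNat + b.2.1.toNat + b.2.2.toNat + r.1) / 2,
    ((b.1.toNat + b.2.1.toNat + b.2.2.toNat + r.1) % 2 == 1) :: r.2)) (1, [])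

/-- Schoolbook addition with initial carry 1. With three summands the carry can be 2 but not more,
since (3 + 2) / 2 = 2. -/
theorem addBits_spec (l : List (Bool × Bool × Bool)) :
    (addBits l).1 * 2 ^ l.length + bc (addBits l).2 = bc (l.map fun b => b.1) +
      bc (l.map fun b => b.2.1) + bc (l.map fun b => b.2.2) + 1 ∧
    (addBits l).2.length = l.length ∧ (addBits l).1 ≤ 2 := by
  induction l with
  | nil => simp [addBits, bc]
  | cons b l ih =>
    obtain ⟨h₁, h₂, h₃⟩ := ih
    unfold addBits at *
    simp only [List.foldr_cons, List.map_cons, List.length_cons, bc_cons, List.length_map, h₂]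
    generalize List.foldr _ _ l = r at *
    have hb₁ := b.1.toNat_le
    have hb₂ := b.2.1.toNat_le
    have hb₃ := b.2.2.toNat_le
    generalize b.1.toNat = x at *
    generalize b.2.1.toNat = y at *
    generalize b.2.2.toNat = z at *
    refine ⟨?_, trivial, by omega⟩
    have h₄ : ((x + y + z + r.1) % 2 == 1).toNat = (x + y + z + r.1) % 2 := by
      rcases Nat.mod_two_eq_zero_or_one (x + y + z + r.1) with h | h <;> simp [h]
    have h₅ := Nat.div_add_mod (x + y + z + r.1) 2
    rw [h₄, pow_succ]
    generalize (x + y + z + r.1) % 2 = n at *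
    generalize (x + y + z + r.1) / 2 = m at *
    calc m * (2 ^ l.length * 2) + (n * 2 ^ l.length + bc r.2)
        = (2 * m + n) * 2 ^ l.length + bc r.2 := by ring
      _ = (x + y + z) * 2 ^ l.length + (r.1 * 2 ^ l.length + bc r.2) := by rw [h₅]; ring
      _ = _ := by rw [h₁]; ring

theorem bc_map_not (u : List Bool) : bc (u.map fun b => !b) + bc u + 1 = 2 ^ u.length := by
  induction u with
  | nil => simp [bc]
  | cons b u ih =>
    rw [List.map_cons, bc_cons, bc_cons, List.length_cons, List.length_map, pow_succ]
    cases b <;> simp <;> omega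

/-- `x + e - y` for binary numbers of length `k`. -/
def addSubBits (k : ℕ) (x e y : List Bool) : List Bool :=
  (addBits ((List.range k).map fun i => (x.getD i false, e.getD i false, !y.getD i false))).2

theorem map_range_getD (k : ℕ) (x : List Bool) (h : x.length = k) :
    (List.range k).map (fun i => x.getD i false) = x := by
  subst h
  refine List.ext_getElem (by simp) fun i h₁ h₂ => ?_
  simp [h₂]

/-- Two's complement: the complement of `y` plus 1 is 2^k - y, so the sum is 2^k too large. By the
two inequalities the true result lies in [0, 2^k), so the carry out is exactly this 2^k. -/
theorem bc_addSubBits {k : ℕ} {x e y : List Bool} (hx : x.length = k) (he : e.length = k)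
    (hy : y.length = k) (h₁ : bc y ≤ bc x + bc e) (h₂ : bc x + bc e < 2 ^ k + bc y) :
    bc (addSubBits k x e y) = bc x + bc e - bc y := by
  obtain ⟨h₃, h₄, h₅⟩ := addBits_spec
    ((List.range k).map fun i => (x.getD i false, e.getD i false, !y.getD i false))
  simp only [List.map_map, Function.comp_def, List.length_map, List.length_range] at h₃ h₄
  rw [map_range_getD k x hx, map_range_getD k e he] at h₃
  have h₆ := bc_map_not y
  have hn : (List.range k).map (fun i => !y.getD i false) = y.map fun b => !b := by
    conv_rhs => rw [← map_range_getD k y hy, List.map_map]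
    rfl
  rw [← hn, hy] at h₆
  unfold addSubBits
  have h₇ := bc_lt (addBits
    ((List.range k).map fun i => (x.getD i false, e.getD i false, !y.getD i false))).2
  rw [h₄] at h₇
  generalize addBits _ = r at *
  have h₈ : r.1 = 1 := by
    have h₉ : r.1 < 2 := by
      by_contra h
      have : r.1 = 2 := by omega
      rw [this] at h₃
      omega
    have h₁₀ : r.1 ≠ 0 := by
      intro h
      rw [h] at h₃
      omega
    omega
  rw [h₈] at h₃
  omega

/-! ### Polynomial-time arithmetic on numbers in binary -/

section

variable {γ : Type} [TreeEnc γ]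

@[fun_prop]
theorem PTF.padTo {k : γ → ℕ} {u : γ → List Bool} (hk : PTF k) (hu : PTF u) :
    PTF fun c => padTo (k c) (u c) := by
  unfold TotalSearch.padTo
  fun_prop

/-- `bd₀` of a number that is given in binary. -/
theorem PTF.bd₀_bc {u : γ → List Bool} (hu : PTF u) : PTF fun c => bd₀ (bc (u c)) := by
  simp only [TotalSearch.bd₀_bc]
  refine PTF.foldl_add (step := fun _ acc b => bif acc == [false] then [b] else acc ++ [b])
    (PTF.const _) hu (by fun_prop) ⟨10, fun c acc b => ?_⟩
  have h := tsize_bool b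
  have h' := tsize_append acc [b]
  simp at h'
  cases acc == [false] <;> simp <;> omega

/-- A function to numbers counts as computed in binary if its composition with `bd₀` is in `PTF`;
plain `PTF` would mean unary output. This convention is kept for all numbers of DLog. -/
theorem PTF.bd {k a : γ → ℕ} (hk : PTF k) (ha : PTF fun c => bd₀ (a c)) :
    PTF fun c => bd (k c) (a c) := by
  have h : (fun c => TotalSearch.bd (k c) (a c)) = fun c => TotalSearch.padTo (k c) (bd₀ (a c)) :=
    funext fun c => by rw [← bd_bc_eq_padTo, bc_bd₀]
  rw [h]
  exact hk.padTo ha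

theorem PTF.clog {a : γ → ℕ} (ha : PTF fun c => bd₀ (a c)) : PTF fun c => Nat.clog 2 (a c) := by
  simp only [clog_eq]
  fun_prop

theorem PTF.lt_bin {a b : γ → ℕ} (ha : PTF fun c => bd₀ (a c)) (hb : PTF fun c => bd₀ (b c)) :
    PTF fun c => decide (a c < b c) := by
  -- The sum of the two lengths is a common length that is large enough for both.
  have h₁ : ∀ {u v : γ → List Bool}, PTF u → PTF v → PTF fun c =>
      ltBits ((List.range ((u c).length + (v c).length)).map fun i =>
        ((TotalSearch.padTo ((u c).length + (v c).length) (u c)).getD i false,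
        (TotalSearch.padTo ((u c).length + (v c).length) (v c)).getD i false)) := by
    intro u v hu hv
    unfold ltBits
    refine PTF.foldl_bdd (step := fun _ (r : Bool × Bool) (b : Bool × Bool) =>
      (r.1 || (r.2 && (!b.1 && b.2)), r.2 && (b.1 == b.2)))
      (PTF.const _) ?_ (by fun_prop) ⟨7, fun c r b => ?_⟩
    · exact PTF.map (by fun_prop) (by fun_prop)
    · rw [tsize_mk]
      have := tsize_bool (r.1 || (r.2 && (!b.1 && b.2)))
      have := tsize_bool (r.2 && (b.1 == b.2))
      simp
      omega
  refine (h₁ ha hb).fst.of_enc_eq fun c => ?_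
  rw [ltBits_eq, List.map_map, List.map_map]
  have h : ∀ m n : ℕ, bc (TotalSearch.padTo ((bd₀ m).length + n) (bd₀ m)) = m := fun m n => by
    rw [← bd_bc_eq_padTo, bc_bd₀, bc_bd]
    exact lt_of_lt_of_le (Nat.lt_pow_succ_log_self (by norm_num) _)
      (Nat.pow_le_pow_right (by norm_num) (by rw [length_bd₀]; omega))
  have h' := h (b c) (bd₀ (a c)).length
  rw [Nat.add_comm] at h'
  congr 1
  rw [Bool.eq_iff_iff]
  simp only [Function.comp_def, map_range_getD _ _ (length_padTo _ _), h, h']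

/-- Halves, in unary. -/
theorem PTF.divMod_two {n : γ → ℕ} (hn : PTF n) : PTF fun c => (n c % 2 == 1, n c / 2) := by
  have h := PTF.foldl_add (init := fun _ => (false, 0)) (l := fun c => List.replicate (n c) ())
    (step := fun _ (r : Bool × ℕ) _ => (!r.1, bif r.1 then r.2 + 1 else r.2)) (PTF.const _)
    (by fun_prop) (by fun_prop) ⟨5, fun c r _ => by
      have := tsize_bool (!r.1)
      have := one_le_tsize r.1
      rw [tsize_mk, tsize_pair r]
      cases h : r.1 <;> simp [h] at * <;> omega⟩
  refine h.of_enc_eq fun c => ?_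
  congr 1
  induction n c with
  | zero => rfl
  | succ m ih =>
    rw [List.replicate_succ', List.foldl_append, ← ih]
    rcases Nat.mod_two_eq_zero_or_one m with h | h <;> simp [h] <;> omega

theorem PTF.addSubBits {k : γ → ℕ} {x e y : γ → List Bool} (hk : PTF k) (hx : PTF x) (he : PTF e)
    (hy : PTF y) : PTF fun c => addSubBits (k c) (x c) (e c) (y c) := by
  have hl : PTF fun c => (List.range (k c)).map fun i =>
      ((x c).getD i false, (e c).getD i false, !(y c).getD i false) :=
    PTF.map (by fun_prop) (by fun_prop)
  have htoNat : PTF Bool.toNat := PTF.of_finite enc_bool_injective _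
  have hsum : PTF fun x : (γ × (ℕ × List Bool)) × (Bool × Bool × Bool) =>
      x.2.1.toNat + x.2.2.1.toNat + x.2.2.2.toNat + x.1.2.1 := by fun_prop
  have h₁ := PTF.foldl_add (init := fun _ => (1, [])) (l := fun c => ((List.range (k c)).map fun i =>
      ((x c).getD i false, (e c).getD i false, !(y c).getD i false)).reverse)
    (step := fun _ (r : ℕ × List Bool) (b : Bool × Bool × Bool) =>
      ((b.1.toNat + b.2.1.toNat + b.2.2.toNat + r.1) / 2,
      ((b.1.toNat + b.2.1.toNat + b.2.2.toNat + r.1) % 2 == 1) :: r.2))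
    (PTF.const _) hl.reverse (hsum.divMod_two.snd.prodMk (hsum.divMod_two.fst.cons (by fun_prop)))
    ⟨20, fun c r b => by
      have := tsize_bool ((b.1.toNat + b.2.1.toNat + b.2.2.toNat + r.1) % 2 == 1)
      have := b.1.toNat_le
      have := b.2.1.toNat_le
      have := b.2.2.toNat_le
      rw [tsize_mk, tsize_pair r, tsize_nat, tsize_nat, tsize_cons, Polynomial.eval_ofNat]
      omega⟩
  refine h₁.snd.of_enc_eq fun c => ?_
  rw [List.foldl_reverse]
  rfl

end

open TreeEnc

/-! ### Gates and circuits -/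

/-- A gate as a triple of numbers. -/
def Gate.triple : Gate → ℕ × ℕ × ℕ
  | .input i => (0, i, 0)
  | .const b => (1, b.toNat, 0)
  | .neg i => (2, i, 0)
  | .conj i j => (3, i, j)
  | .disj i j => (4, i, j)

instance : TreeEnc Gate := ⟨fun g => enc g.triple⟩

instance : TreeEnc Circuit := ⟨fun C => enc (C.numInputs, C.gates, C.outputs)⟩

/-- Whether the gate may occur at position `k` of a circuit with `n` inputs. -/
def Gate.check (n k : ℕ) : Gate → Bool
  | .input i => decide (i < n)
  | .const _ => true
  | .neg i => decide (i < k)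
  | .conj i j => decide (i < k) && decide (j < k)
  | .disj i j => decide (i < k) && decide (j < k)

theorem Gate.check_iff (n k : ℕ) (g : Gate) : g.check n k = true ↔ g.WellFormed n k := by
  cases g <;> simp [check, WellFormed]

/-- The gate that does in a copy of a circuit what the given gate does in the circuit, if the inputs
of the copy are the gates at the positions `ws` and the positions in the copy are shifted by `k`. -/
def Gate.copy (ws : List ℕ) (k : ℕ) : Gate → Gate
  | .input i => .conj (ws.getD i 0) (ws.getD i 0)
  | .const b => .const b
  | .neg i => .neg (k + i)
  | .conj i j => .conj (k + i) (k + j)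
  | .disj i j => .disj (k + i) (k + j)

/-! ### Gates and circuits as data of polynomial-time functions -/

section

variable {α γ : Type} [TreeEnc α] [TreeEnc γ]

@[fun_prop]
theorem PTF.toNat {b : γ → Bool} (hb : PTF b) : PTF fun c => (b c).toNat :=
  (PTF.of_finite enc_bool_injective Bool.toNat).comp hb

@[fun_prop]
theorem PTF.triple {g : γ → Gate} (hg : PTF g) : PTF fun c => (g c).triple :=
  hg.of_enc_eq fun _ => rfl

@[fun_prop]
theorem PTF.input {i : γ → ℕ} (hi : PTF i) : PTF fun c => Gate.input (i c) :=
  ((PTF.const 0).prodMk (hi.prodMk (PTF.const 0))).of_enc_eq fun _ => rfl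

@[fun_prop]
theorem PTF.constGate {b : γ → Bool} (hb : PTF b) : PTF fun c => Gate.const (b c) :=
  ((PTF.const 1).prodMk (hb.toNat.prodMk (PTF.const 0))).of_enc_eq fun _ => rfl

@[fun_prop]
theorem PTF.neg {i : γ → ℕ} (hi : PTF i) : PTF fun c => Gate.neg (i c) :=
  ((PTF.const 2).prodMk (hi.prodMk (PTF.const 0))).of_enc_eq fun _ => rfl

@[fun_prop]
theorem PTF.conj {i j : γ → ℕ} (hi : PTF i) (hj : PTF j) : PTF fun c => Gate.conj (i c) (j c) :=
  ((PTF.const 3).prodMk (hi.prodMk hj)).of_enc_eq fun _ => rfl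

@[fun_prop]
theorem PTF.disj {i j : γ → ℕ} (hi : PTF i) (hj : PTF j) : PTF fun c => Gate.disj (i c) (j c) :=
  ((PTF.const 4).prodMk (hi.prodMk hj)).of_enc_eq fun _ => rfl

/-- Case distinction according to the kind of a gate. -/
theorem PTF.gate_cases {g : γ → Gate} {f₀ f₁ f₂ f₃ f₄ : γ → ℕ × ℕ → α} {f : γ → α} (hg : PTF g)
    (h₀ : PTF fun x : γ × ℕ × ℕ => f₀ x.1 x.2) (h₁ : PTF fun x : γ × ℕ × ℕ => f₁ x.1 x.2)
    (h₂ : PTF fun x : γ × ℕ × ℕ => f₂ x.1 x.2) (h₃ : PTF fun x : γ × ℕ × ℕ => f₃ x.1 x.2)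
    (h₄ : PTF fun x : γ × ℕ × ℕ => f₄ x.1 x.2)
    (hf : ∀ c, f c = match g c with
      | .input i => f₀ c (i, 0)
      | .const b => f₁ c (b.toNat, 0)
      | .neg i => f₂ c (i, 0)
      | .conj i j => f₃ c (i, j)
      | .disj i j => f₄ c (i, j)) : PTF f := by
  have hx : PTF fun c => (c, (g c).triple.2) := by fun_prop
  have ht : ∀ n : ℕ, PTF fun c => (g c).triple.1 == n := fun n => by fun_prop
  refine ((ht 0).cond (h₀.comp hx) ((ht 1).cond (h₁.comp hx) ((ht 2).cond (h₂.comp hx)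
    ((ht 3).cond (h₃.comp hx) (h₄.comp hx))))).of_enc_eq fun c => ?_
  rw [hf]
  cases g c <;> rfl

@[fun_prop]
theorem PTF.gateValue {u v : γ → List Bool} {g : γ → Gate} (hu : PTF u) (hv : PTF v) (hg : PTF g) :
    PTF fun c => (g c).value (u c) (v c) :=
  PTF.gate_cases (f₀ := fun c i => (u c).getD i.1 false) (f₁ := fun c i => i.1 == 1)
    (f₂ := fun c i => !(v c).getD i.1 false)
    (f₃ := fun c i => (v c).getD i.1 false && (v c).getD i.2 false)
    (f₄ := fun c i => (v c).getD i.1 false || (v c).getD i.2 false) hg (by fun_prop) (by fun_prop)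
    (by fun_prop) (by fun_prop) (by fun_prop) fun c => by
      cases g c with
      | const b => cases b <;> rfl
      | _ => rfl

@[fun_prop]
theorem PTF.gateCheck {n k : γ → ℕ} {g : γ → Gate} (hn : PTF n) (hk : PTF k) (hg : PTF g) :
    PTF fun c => (g c).check (n c) (k c) :=
  PTF.gate_cases (f₀ := fun c i => decide (i.1 < n c)) (f₁ := fun c i => true)
    (f₂ := fun c i => decide (i.1 < k c))
    (f₃ := fun c i => decide (i.1 < k c) && decide (i.2 < k c))
    (f₄ := fun c i => decide (i.1 < k c) && decide (i.2 < k c)) hg (by fun_prop) (by fun_prop)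
    (by fun_prop) (by fun_prop) (by fun_prop) fun c => by cases g c <;> rfl

@[fun_prop]
theorem PTF.gateCopy {k : γ → ℕ} {ws : γ → List ℕ} {g : γ → Gate} (hws : PTF ws) (hk : PTF k)
    (hg : PTF g) : PTF fun c => (g c).copy (ws c) (k c) :=
  PTF.gate_cases (f₀ := fun c i => .conj ((ws c).getD i.1 0) ((ws c).getD i.1 0))
    (f₁ := fun c i => .const (i.1 == 1)) (f₂ := fun c i => .neg (k c + i.1))
    (f₃ := fun c i => .conj (k c + i.1) (k c + i.2))
    (f₄ := fun c i => .disj (k c + i.1) (k c + i.2)) hg (by fun_prop) (by fun_prop)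
    (by fun_prop) (by fun_prop) (by fun_prop) fun c => by
      cases g c with
      | const b => cases b <;> rfl
      | _ => rfl

@[fun_prop]
theorem PTF.unary {n : γ → ℕ} (hn : PTF n) : PTF fun c => unary (n c) := by
  unfold TotalSearch.unary
  fun_prop

@[fun_prop]
theorem PTF.gateEncode {g : γ → Gate} (hg : PTF g) : PTF fun c => (g c).encode :=
  PTF.gate_cases (f₀ := fun c i => TotalSearch.unary 0 ++ TotalSearch.unary i.1)
    (f₁ := fun c i => TotalSearch.unary 1 ++ [i.1 == 1])
    (f₂ := fun c i => TotalSearch.unary 2 ++ TotalSearch.unary i.1)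
    (f₃ := fun c i => TotalSearch.unary 3 ++ TotalSearch.unary i.1 ++ TotalSearch.unary i.2)
    (f₄ := fun c i => TotalSearch.unary 4 ++ TotalSearch.unary i.1 ++ TotalSearch.unary i.2) hg
    (by fun_prop) (by fun_prop) (by fun_prop) (by fun_prop) (by fun_prop) fun c => by
      cases g c with
      | const b => cases b <;> rfl
      | _ => rfl

@[fun_prop]
theorem PTF.numInputs {C : γ → Circuit} (hC : PTF C) : PTF fun c => (C c).numInputs :=
  (hC.of_enc_eq (f' := fun c => ((C c).numInputs, (C c).gates, (C c).outputs)) fun _ => rfl).fst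

@[fun_prop]
theorem PTF.gates {C : γ → Circuit} (hC : PTF C) : PTF fun c => (C c).gates :=
  (hC.of_enc_eq (f' := fun c => ((C c).numInputs, (C c).gates, (C c).outputs)) fun _ => rfl).snd.fst

@[fun_prop]
theorem PTF.outputs {C : γ → Circuit} (hC : PTF C) : PTF fun c => (C c).outputs :=
  (hC.of_enc_eq (f' := fun c => ((C c).numInputs, (C c).gates, (C c).outputs)) fun _ => rfl).snd.snd

@[fun_prop]
theorem PTF.circuitMk {n : γ → ℕ} {gs : γ → List Gate} {os : γ → List ℕ} (hn : PTF n)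
    (hgs : PTF gs) (hos : PTF os) : PTF fun c => Circuit.mk (n c) (gs c) (os c) :=
  (hn.prodMk (hgs.prodMk hos)).of_enc_eq fun _ => rfl

@[fun_prop]
theorem PTF.values {C : γ → Circuit} {u : γ → List Bool} (hC : PTF C) (hu : PTF u) :
    PTF fun c => (C c).values (u c) := by
  unfold Circuit.values
  refine PTF.foldl_add (step := fun c vals g => vals ++ [g.value (u c) vals]) (PTF.const [])
    hC.gates (by fun_prop) ⟨10, fun c vals g => ?_⟩
  have := tsize_append vals [g.value (u c) vals]
  have := tsize_bool (g.value (u c) vals)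
  simp at *
  omega

@[fun_prop]
theorem PTF.eval {C : γ → Circuit} {u : γ → List Bool} (hC : PTF C) (hu : PTF u) :
    PTF fun c => (C c).eval (u c) := by
  unfold Circuit.eval
  fun_prop

@[fun_prop]
theorem PTF.encodeList {l : γ → List α} {f : α → List Bool} (hl : PTF l) (hf : PTF f) :
    PTF fun c => encodeList f (l c) := by
  unfold TotalSearch.encodeList
  fun_prop

@[fun_prop]
theorem PTF.block {u : γ → List Bool} (hu : PTF u) : PTF fun c => block (u c) := by
  unfold TotalSearch.block
  fun_prop

@[fun_prop]
theorem PTF.circuitEncode {C : γ → Circuit} (hC : PTF C) : PTF fun c => (C c).encode := by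
  unfold Circuit.encode
  have : PTF Gate.encode := PTF.id'.gateEncode
  have : PTF TotalSearch.unary := PTF.id'.unary
  fun_prop

end

/-- Whether the circuit is well-formed. -/
def Circuit.check (C : Circuit) : Bool :=
  ((List.range C.gates.length).all fun k =>
    (C.gates.getD k (.const false)).check C.numInputs k) &&
    C.outputs.all fun o => decide (o < C.gates.length)

theorem Circuit.check_iff (C : Circuit) : C.check = true ↔ C.WellFormed := by
  unfold check WellFormed
  simp only [Bool.and_eq_true, List.all_eq_true, List.mem_range, Gate.check_iff, decide_eq_true_eq]
  refine and_congr_left fun _ => ⟨fun h k g hg => ?_, fun h k hk => h k _ ?_⟩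
  · obtain ⟨hk, rfl⟩ := List.getElem?_eq_some_iff.1 hg
    simpa [hk] using h k hk
  · simp [hk]

@[fun_prop]
theorem PTF.circuitCheck {γ : Type} [TreeEnc γ] {C : γ → Circuit} (hC : PTF C) :
    PTF fun c => (C c).check := by
  unfold Circuit.check
  fun_prop

/-! ### Decoding -/

/-- The number of leading ones. -/
def ones (l : List Bool) : ℕ := (l.takeWhile id).length

def parseUnary (l : List Bool) : ℕ × List Bool := (ones l, l.drop (ones l + 1))

def parseBit (l : List Bool) : Bool × List Bool := (l.headD false, l.tail)

/-- One step of the decoding of a list: the flag indicates that the end has been reached. -/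
def parseStep {α : Type} (p : List Bool → α × List Bool) (x : Bool × List α × List Bool) :
    Bool × List α × List Bool :=
  bif x.1 then x else
    bif x.2.2.headD false then (false, x.2.1 ++ [(p x.2.2.tail).1], (p x.2.2.tail).2)
    else (true, x.2.1, x.2.2.tail)

/-- One iteration per bit is more than enough, because each member uses at least its marker bit. The
flag makes the surplus iterations harmless. -/
def parseList {α : Type} (p : List Bool → α × List Bool) (l : List Bool) : List α × List Bool :=
  ((parseStep p)^[l.length] (false, [], l)).2

def parseGate (l : List Bool) : Gate × List Bool :=
  let x := parseUnary l
  let y := parseUnary x.2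
  let z := parseUnary y.2
  bif x.1 == 0 then (.input y.1, y.2)
  else bif x.1 == 1 then (.const (x.2.headD false), x.2.tail)
  else bif x.1 == 2 then (.neg y.1, y.2)
  else bif x.1 == 3 then (.conj y.1 z.1, z.2)
  else (.disj y.1 z.1, z.2)

def parseCircuit (l : List Bool) : Circuit × List Bool :=
  let x := parseUnary l
  let y := parseList parseGate x.2
  let z := parseList parseUnary y.2
  (⟨x.1, y.1, z.1⟩, z.2)

theorem parseUnary_append (n : ℕ) (r : List Bool) : parseUnary (unary n ++ r) = (n, r) := by
  have h : ones (unary n ++ r) = n := by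
    induction n with
    | zero => simp [unary, ones]
    | succ n ih => simp_all [ones, unary, List.replicate_succ]
  have h' : (unary n).length = n + 1 := by simp [unary]
  rw [parseUnary, h, ← h', List.drop_left]

theorem parseList_append {α : Type} {p : List Bool → α × List Bool} {f : α → List Bool}
    (h : ∀ a r, p (f a ++ r) = (a, r)) (l : List α) (r : List Bool) :
    parseList p (encodeList f l ++ r) = (l, r) := by
  have h₁ : ∀ (l : List α) (acc : List α), (parseStep p)^[l.length + 1]
      (false, acc, encodeList f l ++ r) = (true, acc ++ l, r) := by
    intro l
    induction l with
    | nil => intro acc; simp [encodeList, parseStep]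
    | cons a l ih =>
      intro acc
      rw [List.length_cons, Function.iterate_succ_apply]
      have : parseStep p (false, acc, encodeList f (a :: l) ++ r) =
          (false, acc ++ [a], encodeList f l ++ r) := by
        simp [encodeList, parseStep, h]
      rw [this, ih]
      simp
  -- One marker bit for each member and one for the end of the list.
  have h₂ : l.length + 1 ≤ (encodeList f l ++ r).length := by
    simp only [encodeList, List.length_append, List.length_flatMap, List.length_cons]
    have : l.length ≤ (l.map fun a => (f a).length + 1).sum := by
      clear h₁
      induction l with
      | nil => simp
      | cons a l ih => simp; omega
    simp; omega
  obtain ⟨j, hj⟩ := Nat.exists_eq_add_of_le' h₂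
  rw [parseList, hj, Function.iterate_add_apply, h₁, Function.iterate_fixed (by simp [parseStep])]
  simp

theorem parseBlock_append (u r : List Bool) : parseList parseBit (block u ++ r) = (u, r) :=
  parseList_append (f := fun b => [b]) (fun _ _ => rfl) u r

theorem parseGate_append (g : Gate) (r : List Bool) : parseGate (g.encode ++ r) = (g, r) := by
  cases g <;> simp [parseGate, Gate.encode, parseUnary_append, List.append_assoc]

theorem parseCircuit_append (C : Circuit) (r : List Bool) :
    parseCircuit (C.encode ++ r) = (C, r) := by
  simp [parseCircuit, Circuit.encode, List.append_assoc, parseUnary_append,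
    parseList_append parseGate_append, parseList_append parseUnary_append]

/-! ### Decoding in polynomial time -/

section

variable {α γ : Type} [TreeEnc α] [TreeEnc γ]

@[fun_prop]
theorem PTF.ones {l : γ → List Bool} (hl : PTF l) : PTF fun c => ones (l c) := by
  have h := PTF.foldl_add (init := fun _ => (true, 0)) (step := fun _ (r : Bool × ℕ) (b : Bool) =>
    (r.1 && b, bif r.1 && b then r.2 + 1 else r.2)) (PTF.const _) hl (by fun_prop)
    ⟨5, fun c r b => by
      have := tsize_bool (r.1 && b)
      have := one_le_tsize r.1
      rw [tsize_mk, tsize_pair r]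
      cases h : r.1 && b <;> simp [h] at * <;> omega⟩
  refine h.snd.of_enc_eq fun c => ?_
  have key : ∀ (l : List Bool) (n : ℕ), (l.foldl (fun (r : Bool × ℕ) (b : Bool) =>
      (r.1 && b, bif r.1 && b then r.2 + 1 else r.2)) (false, n)).2 = n := by
    intro l n
    induction l with
    | nil => rfl
    | cons b l ih => simpa using ih
  have key' : ∀ (l : List Bool) (n : ℕ), (l.foldl (fun (r : Bool × ℕ) (b : Bool) =>
      (r.1 && b, bif r.1 && b then r.2 + 1 else r.2)) (true, n)).2 = n + TotalSearch.ones l := by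
    intro l
    induction l with
    | nil => intro n; rfl
    | cons b l ih =>
      intro n
      cases b with
      | false => simpa [TotalSearch.ones] using key l n
      | true =>
        have := ih (n + 1)
        simp only [TotalSearch.ones, List.foldl_cons, Bool.and_true, cond_true] at this ⊢
        rw [this]
        simp
        omega
  rw [key', Nat.zero_add]

@[fun_prop]
theorem PTF.parseUnary {l : γ → List Bool} (hl : PTF l) : PTF fun c => parseUnary (l c) := by
  unfold TotalSearch.parseUnary
  fun_prop

@[fun_prop]
theorem PTF.parseBit {l : γ → List Bool} (hl : PTF l) : PTF fun c => parseBit (l c) := by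
  unfold TotalSearch.parseBit
  fun_prop

@[fun_prop]
theorem PTF.parseGate {l : γ → List Bool} (hl : PTF l) : PTF fun c => parseGate (l c) := by
  unfold TotalSearch.parseGate
  fun_prop

theorem tsize_drop_le (n : ℕ) (l : List α) : tsize (l.drop n) ≤ tsize l := by
  induction n generalizing l with
  | zero => simp
  | succ n ih => rw [← List.drop_tail]; exact (ih _).trans (tsize_tail_le l)

/-- By `hle` the unread part never grows. Hence every member is parsed from a string no larger than
the input and has size at most `q` of that, and the parsed list gains at most one such member per
iteration. -/
theorem PTF.parseList {p : List Bool → α × List Bool} {l : γ → List Bool} (hp : PTF p)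
    (hle : ∀ l, tsize (p l).2 ≤ tsize l) (hl : PTF l) : PTF fun c => parseList p (l c) := by
  obtain ⟨q, hq⟩ := hp.size
  obtain ⟨r, hr⟩ := hl.size
  refine (PTF.iterate (n := fun c => (l c).length) (x := fun c => (false, [], l c))
    (f := fun _ => parseStep p) (by fun_prop) (by fun_prop) ?_
    ⟨10 + r + r * (q.comp r + 1), fun c m hm => ?_⟩).snd
  · unfold parseStep
    have h : PTF fun x : γ × Bool × List α × List Bool => p x.2.2.2.tail := hp.comp (by fun_prop)
    fun_prop
  · have key : tsize (((parseStep p)^[m] (false, [], l c)).2.2) ≤ tsize (l c) ∧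
        tsize (((parseStep p)^[m] (false, [], l c)).2.1) ≤ 1 + m * (q.eval (tsize (l c)) + 1) := by
      clear hm
      induction m with
      | zero => simp
      | succ m ih =>
        rw [Function.iterate_succ_apply']
        generalize (parseStep p)^[m] (false, [], l c) = x at ih ⊢
        obtain ⟨h₁, h₂⟩ := ih
        have h₃ := (tsize_tail_le x.2.2).trans h₁
        have h₄ : tsize (p x.2.2.tail).1 ≤ q.eval (tsize (l c)) := by
          have := (hq x.2.2.tail).trans (eval_mono_nat q h₃)
          rw [tsize_pair] at this
          omega
        have h₅ := tsize_append x.2.1 [(p x.2.2.tail).1]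
        rw [tsize_cons, tsize_nil] at h₅
        rw [Nat.succ_mul]
        unfold parseStep
        cases x.1
        · cases x.2.2.headD false
          · exact ⟨h₃, by simp only [cond_false]; omega⟩
          · exact ⟨(hle _).trans h₃, by simp only [cond_false, cond_true]; omega⟩
        · exact ⟨h₁, by simp only [cond_true]; omega⟩
    have h₁ := hr c
    have h₂ := eval_mono_nat q h₁
    have h₃ := length_lt_tsize (l c)
    have h₄ : m * (q.eval (tsize (l c)) + 1) ≤ r.eval (tsize c) * (q.eval (r.eval (tsize c)) + 1) :=
      Nat.mul_le_mul (by omega) (by omega)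
    have h₅ := tsize_bool (((parseStep p)^[m] (false, [], l c)).1)
    rw [tsize_pair, tsize_pair]
    simp only [Polynomial.eval_add, Polynomial.eval_mul, Polynomial.eval_comp,
      Polynomial.eval_one, Polynomial.eval_ofNat]
    omega

theorem tsize_parseUnary_le (l : List Bool) : tsize (parseUnary l).2 ≤ tsize l :=
  tsize_drop_le _ _

theorem tsize_parseGate_le (l : List Bool) : tsize (parseGate l).2 ≤ tsize l := by
  have h₁ := tsize_parseUnary_le l
  have h₂ := tsize_parseUnary_le (parseUnary l).2
  have h₃ := tsize_parseUnary_le (parseUnary (parseUnary l).2).2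
  have h₄ := tsize_tail_le (parseUnary l).2
  unfold parseGate
  dsimp only
  cases (parseUnary l).1 == 0
  · cases (parseUnary l).1 == 1
    · cases (parseUnary l).1 == 2
      · cases (parseUnary l).1 == 3 <;> simp <;> omega
      · simp; omega
    · simp; omega
  · simp; omega

@[fun_prop]
theorem PTF.parseBlock {l : γ → List Bool} (hl : PTF l) :
    PTF fun c => TotalSearch.parseList TotalSearch.parseBit (l c) :=
  PTF.parseList PTF.id'.parseBit tsize_tail_le hl

@[fun_prop]
theorem PTF.parseCircuit {l : γ → List Bool} (hl : PTF l) : PTF fun c => parseCircuit (l c) := by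
  have h₁ : ∀ {l : γ → List Bool}, PTF l → PTF fun c =>
      TotalSearch.parseList TotalSearch.parseGate (l c) :=
    fun hl => PTF.parseList PTF.id'.parseGate tsize_parseGate_le hl
  have h₂ : ∀ {l : γ → List Bool}, PTF l → PTF fun c =>
      TotalSearch.parseList TotalSearch.parseUnary (l c) :=
    fun hl => PTF.parseList PTF.id'.parseUnary tsize_parseUnary_le hl
  unfold TotalSearch.parseCircuit
  have h₃ := h₁ hl.parseUnary.snd
  have h₄ := h₂ h₃.snd
  exact (hl.parseUnary.fst.circuitMk h₃.fst h₄.fst).prodMk h₄.snd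

end

open TreeEnc

/-! ### Search problems with decodable instances and solutions -/

/-- The decoders are total and return something on every string; a string is a genuine code if and
only if encoding the decoded object reproduces it. -/
theorem searchProblem_iff {I A : Type} {encI : I → List Bool} {encA : A → List Bool}
    {V : I → Prop} {Sol : I → A → Prop} {dI : List Bool → I} {dA : List Bool → A}
    (hI : ∀ i, dI (encI i) = i) (hA : ∀ a, dA (encA a) = a) (x y : List Bool) :
    searchProblem encI encA V Sol x y ↔
      (V (dI x) → encI (dI x) = x → Sol (dI x) (dA y) ∧ encA (dA y) = y) := by
  constructor
  · intro h hV hx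
    obtain ⟨a, ha, rfl⟩ := h _ hV hx
    rw [hA]
    exact ⟨ha, rfl⟩
  · rintro h i hV rfl
    rw [hI] at h
    exact ⟨_, h hV rfl⟩

theorem exists_ptf_searchProblem {I A : Type} [TreeEnc I] [TreeEnc A] {encI : I → List Bool}
    {encA : A → List Bool} {V : I → Prop} {Sol : I → A → Prop} {dI : List Bool → I}
    {dA : List Bool → A} {v : I → Bool} {s : I × A → Bool}
    (hI : ∀ i, dI (encI i) = i) (hA : ∀ a, dA (encA a) = a) (hv : ∀ i, v i = true ↔ V i)
    (hs : ∀ i a, V i → (s (i, a) = true ↔ Sol i a)) (hencI : PTF encI) (hencA : PTF encA)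
    (hdI : PTF dI) (hdA : PTF dA) (hv' : PTF v) (hs' : PTF s) :
    ∃ d : List Bool × List Bool → Bool, PTF d ∧
      ∀ x y, d (x, y) = true ↔ searchProblem encI encA V Sol x y := by
  refine ⟨fun p => !(v (dI p.1) && (encI (dI p.1) == p.1)) ||
    (s (dI p.1, dA p.2) && (encA (dA p.2) == p.2)), by fun_prop, fun x y => ?_⟩
  rw [searchProblem_iff hI hA]
  by_cases h : V (dI x)
  · have h₁ := hs _ (dA y) h
    have h₂ := (hv _).2 h
    simp only [h₂, Bool.true_and, Bool.or_eq_true, Bool.not_eq_true', beq_eq_false_iff_ne,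
      Bool.and_eq_true, beq_iff_eq, h₁]
    tauto
  · have h₂ : v (dI x) = false := by rw [← Bool.not_eq_true, hv]; exact h
    simp [h₂, h]

/-! ### Collision -/

def parsePair (l : List Bool) : List Bool × List Bool :=
  ((parseList parseBit l).1, (parseList parseBit (parseList parseBit l).2).1)

theorem parsePair_append (u v : List Bool) : parsePair (block u ++ block v) = (u, v) := by
  have h := parseBlock_append v []
  rw [List.append_nil] at h
  simp [parsePair, parseBlock_append, h]

theorem parseCircuit_encode (C : Circuit) : (parseCircuit C.encode).1 = C := by
  have h := parseCircuit_append C []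
  rw [List.append_nil] at h
  rw [h]

theorem exists_ptf_collision : ∃ d : List Bool × List Bool → Bool, PTF d ∧
    ∀ x y, d (x, y) = true ↔ Collision x y := by
  refine exists_ptf_searchProblem (dI := fun l => (parseCircuit l).1) (dA := parsePair)
    (v := fun C => C.check && decide (C.outputs.length < C.numInputs))
    (s := fun p => (p.2.1.length == p.1.numInputs) && (p.2.2.length == p.1.numInputs) &&
      !(p.2.1 == p.2.2) && (p.1.eval p.2.1 == p.1.eval p.2.2))
    parseCircuit_encode (fun p => parsePair_append _ _) (fun C => ?_) (fun C p _ => ?_)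
    PTF.id'.circuitEncode (by fun_prop) (by fun_prop) ?_ (by fun_prop) (by fun_prop)
  · simp [Circuit.check_iff, Circuit.numOutputs]
  · simp [and_assoc]
  · unfold parsePair
    fun_prop

/-! ### DLog -/

theorem bc_bits_ite {p : Prop} [Decidable p] (u v : List Bool) :
    bc (if p then u else v) = if p then bc u else bc v := by split_ifs <;> rfl

namespace DLogInstance

instance : TreeEnc DLogInstance := ⟨fun G => enc (bd₀ G.s, G.f, bd₀ G.id, bd₀ G.g, bd₀ G.t)⟩

/-- The value of square-and-multiply for the exponent with bits `u`, as a string. -/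
def powBits (G : DLogInstance) (u : List Bool) : List Bool :=
  u.foldl (fun r b => if b then G.opBits (bd G.len G.g) (G.opBits r r) else G.opBits r r)
    (bd G.len G.id)

/-- The value of square-and-multiply for the exponent with bits `u`. -/
def pow (G : DLogInstance) (u : List Bool) : ℕ :=
  u.foldl (fun r b => if b then G.op G.g (G.op r r) else G.op r r) G.id

theorem lt_two_pow_len (G : DLogInstance) {x : ℕ} (h : x < G.s) : x < 2 ^ G.len :=
  h.trans_le (Nat.le_pow_clog (by norm_num) _)

theorem length_opBits (G : DLogInstance) (u v : List Bool) :
    (G.opBits u v).length = G.f.numOutputs := by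
  simp [opBits, Circuit.eval, Circuit.numOutputs]

theorem bc_opBits {G : DLogInstance} {u v : List Bool} (hu : u.length = G.len)
    (hv : v.length = G.len) : bc (G.opBits u v) = G.op (bc u) (bc v) := by
  have h₁ := bd_bc u
  have h₂ := bd_bc v
  rw [hu] at h₁
  rw [hv] at h₂
  rw [op, h₁, h₂]

theorem powBits_concat (G : DLogInstance) (u : List Bool) (b : Bool) :
    G.powBits (u ++ [b]) = if b then G.opBits (bd G.len G.g) (G.opBits (G.powBits u) (G.powBits u))
      else G.opBits (G.powBits u) (G.powBits u) := by
  simp [powBits]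

theorem pow_concat (G : DLogInstance) (u : List Bool) (b : Bool) :
    G.pow (u ++ [b]) = if b then G.op G.g (G.op (G.pow u) (G.pow u))
      else G.op (G.pow u) (G.pow u) := by
  simp [pow]

theorem Valid.length_powBits {G : DLogInstance} (hG : G.Valid) (u : List Bool) :
    (G.powBits u).length = G.len := by
  induction u using List.reverseRecOn with
  | nil => simp [powBits]
  | append_singleton u b ih =>
    rw [powBits_concat]
    split_ifs <;> rw [length_opBits, hG.2.2.2.1]

theorem Valid.bc_powBits {G : DLogInstance} (hG : G.Valid) (u : List Bool) :
    bc (G.powBits u) = G.pow u := by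
  have hG' := hG
  obtain ⟨_, _, _, h₁, h₂, h₃, _⟩ := hG'
  induction u using List.reverseRecOn with
  | nil => exact bc_bd (G.lt_two_pow_len h₂)
  | append_singleton u b ih =>
    have h := hG.length_powBits u
    rw [powBits_concat, pow_concat, bc_bits_ite, bc_opBits (length_bd _ _)
      ((length_opBits _ _ _).trans h₁), bc_opBits h h, bc_bd (G.lt_two_pow_len h₃), ih]

theorem Valid.index_eq {G : DLogInstance} (hG : G.Valid) (x : ℕ) : G.index x = G.pow (bd₀ x) :=
  hG.bc_powBits _

theorem Valid.pow_lt {G : DLogInstance} (hG : G.Valid)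
    (h : ∀ x y, x < G.s → y < G.s → G.op x y < G.s) (u : List Bool) : G.pow u < G.s := by
  obtain ⟨_, _, _, _, h₂, h₃, _⟩ := hG
  induction u using List.reverseRecOn with
  | nil => exact h₂
  | append_singleton u b ih =>
    rw [pow_concat]
    split_ifs
    · exact h _ _ h₃ (h _ _ ih ih)
    · exact h _ _ ih ih

end DLogInstance

/-- All numbers that occur in a candidate solution satisfy `p`. -/
def DLogAnswer.All (p : ℕ → Prop) : DLogAnswer → Prop
  | .single x => p x
  | .pair x y => p x ∧ p y

/-- If the operation stays in [s], the index function is a map of the finite set [s] to itself: an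
injective one is onto and reaches t, any other has two arguments of equal index. The bound on the
numbers keeps the solution short. -/
theorem DLogInstance.Valid.exists_isSolution {G : DLogInstance} (hG : G.Valid) :
    ∃ a, G.IsSolution a ∧ a.All (· < G.s) := by
  by_cases h : ∃ x y, x < G.s ∧ y < G.s ∧ G.s ≤ G.op x y
  · obtain ⟨x, y, hx, hy, h⟩ := h
    exact ⟨_, .outOfRange x y hx hy h, hx, hy⟩
  · have h' : ∀ x y, x < G.s → y < G.s → G.op x y < G.s := fun x y hx hy => by
      by_contra h₁
      exact h ⟨x, y, hx, hy, by omega⟩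
    let F : Fin G.s → Fin G.s := fun x => ⟨G.index x, by rw [hG.index_eq]; exact hG.pow_lt h' _⟩
    by_cases hF : Function.Injective F
    · obtain ⟨x, hx⟩ := (Finite.injective_iff_surjective.1 hF) ⟨G.t, hG.2.2.2.2.2.2⟩
      exact ⟨_, .log x x.2 (congrArg Fin.val hx), x.2⟩
    · simp only [Function.Injective, not_forall] at hF
      obtain ⟨x, y, hxy, hne⟩ := hF
      exact ⟨_, .indexCollision x y x.2 y.2 (fun h => hne (Fin.ext h)) (congrArg Fin.val hxy),
        x.2, y.2⟩

namespace DLogInstance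

def parse (l : List Bool) : DLogInstance :=
  let a := parseList parseBit l
  let f := parseCircuit a.2
  let b := parseList parseBit f.2
  let c := parseList parseBit b.2
  let d := parseList parseBit c.2
  ⟨bc a.1, f.1, bc b.1, bc c.1, bc d.1⟩

theorem parse_encode (G : DLogInstance) : parse G.encode = G := by
  have h := parseBlock_append (bd₀ G.t) []
  rw [List.append_nil] at h
  simp [parse, encode, parseBlock_append, parseCircuit_append, h, bc_bd₀]

end DLogInstance

namespace DLogAnswer

/-- An answer as a triple. -/
def triple : DLogAnswer → Bool × ℕ × ℕ
  | single x => (true, x, 0)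
  | pair x y => (false, x, y)

instance : TreeEnc DLogAnswer :=
  ⟨fun a => enc (a.triple.1, bd₀ a.triple.2.1, bd₀ a.triple.2.2)⟩

def parse (l : List Bool) : DLogAnswer :=
  let a := parseList parseBit l
  bif a.2.isEmpty then single (bc a.1) else pair (bc a.1) (bc (parseList parseBit a.2).1)

theorem parse_encode (a : DLogAnswer) : parse a.encode = a := by
  cases a with
  | single x =>
    have h := parseBlock_append (bd₀ x) []
    rw [List.append_nil] at h
    simp [parse, encode, h, bc_bd₀]
  | pair x y =>
    have h := parseBlock_append (bd₀ y) []
    rw [List.append_nil] at h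
    have h' : (block (bd₀ y)).isEmpty = false := by simp [block]
    simp [parse, encode, parseBlock_append, h, bc_bd₀, h']

end DLogAnswer

/-- The remainder of `x - y` modulo `s`, computed in binary. -/
def subMod (s x y : ℕ) : ℕ :=
  bc (addSubBits ((bd₀ s).length + 1) (bd ((bd₀ s).length + 1) x)
    (bif decide (x < y) then bd ((bd₀ s).length + 1) s else bd ((bd₀ s).length + 1) 0)
    (bd ((bd₀ s).length + 1) y))

/-- The result is x - y, or x + s - y if that would be negative. One bit more than s has leaves room
for x + s. -/
theorem subMod_eq {s x y : ℕ} (hx : x < s) (hy : y < s) : subMod s x y = (x + (s - y)) % s := by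
  have hs : s < 2 ^ (bd₀ s).length := by
    rw [length_bd₀]; exact Nat.lt_pow_succ_log_self (by norm_num) s
  have hs' : 2 ^ ((bd₀ s).length + 1) = 2 * 2 ^ (bd₀ s).length := by ring
  have h₁ := bc_bd (k := (bd₀ s).length + 1) (a := x) (by omega)
  have h₂ := bc_bd (k := (bd₀ s).length + 1) (a := y) (by omega)
  have h₃ := bc_bd (k := (bd₀ s).length + 1) (a := s) (by omega)
  have h₄ := bc_bd (k := (bd₀ s).length + 1) (a := 0) (by omega)
  unfold subMod
  by_cases h : x < y
  · rw [decide_eq_true h, cond_true, bc_addSubBits (length_bd _ _) (length_bd _ _) (length_bd _ _)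
      (by omega) (by omega), h₁, h₂, h₃, Nat.mod_eq_of_lt (by omega)]
    omega
  · rw [decide_eq_false h, cond_false, bc_addSubBits (length_bd _ _) (length_bd _ _)
      (length_bd _ _) (by omega) (by omega), h₁, h₂, h₄, show x + (s - y) = x + 0 - y + s by omega,
      Nat.add_mod_right, Nat.mod_eq_of_lt (by omega)]

namespace DLogInstance

def check (G : DLogInstance) : Bool :=
  !decide (G.s < 2) && G.f.check && (G.f.numInputs == 2 * G.len) &&
    (G.f.outputs.length == G.len) && decide (G.id < G.s) && decide (G.g < G.s) && decide (G.t < G.s)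

theorem check_iff (G : DLogInstance) : G.check = true ↔ G.Valid := by
  simp [check, Valid, Circuit.check_iff, Circuit.numOutputs, and_assoc, Nat.succ_le_iff]

def checkAnswer (G : DLogInstance) (b : Bool) (x y : ℕ) : Bool :=
  decide (x < G.s) &&
  bif b then bd₀ (G.index x) == bd₀ G.t
  else decide (y < G.s) &&
    (!decide (G.op x y < G.s) ||
    (!(bd₀ x == bd₀ y) && (bd₀ (G.index x) == bd₀ (G.index y))) ||
    (!(bd₀ x == bd₀ y) &&
      (bd₀ (G.op G.t (G.index x)) == bd₀ (G.op G.t (G.index y)))) ||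
    ((bd₀ (G.index x) == bd₀ (G.op G.t (G.index y))) &&
      !(bd₀ (G.index (subMod G.s x y)) == bd₀ G.t)))

theorem checkAnswer_iff (G : DLogInstance) (a : DLogAnswer) :
    G.checkAnswer a.triple.1 a.triple.2.1 a.triple.2.2 = true ↔ G.IsSolution a := by
  cases a with
  | single x =>
    change G.checkAnswer true x 0 = true ↔ _
    simp only [checkAnswer, cond_true, Bool.and_eq_true, decide_eq_true_eq,
      beq_iff_eq, bd₀_injective.eq_iff]
    exact ⟨fun h => .log x h.1 h.2, fun h => by cases h with | log _ hx h => exact ⟨hx, h⟩⟩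
  | pair x y =>
    change G.checkAnswer false x y = true ↔ _
    simp only [checkAnswer, cond_false, Bool.and_eq_true, decide_eq_true_eq,
      beq_iff_eq, bd₀_injective.eq_iff, Bool.or_eq_true, Bool.not_eq_true', decide_eq_false_iff_not,
      beq_eq_false_iff_ne, ne_eq, not_lt]
    constructor
    · rintro ⟨hx, hy, ((h | h) | h) | h⟩
      · exact .outOfRange x y hx hy h
      · exact .indexCollision x y hx hy h.1 h.2
      · exact .cosetCollision x y hx hy h.1 h.2
      · rw [subMod_eq hx hy] at h
        exact .notHomomorphic x y hx hy h.1 h.2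
    · intro h
      cases h with
      | outOfRange _ _ hx hy h => exact ⟨hx, hy, .inl (.inl (.inl h))⟩
      | indexCollision _ _ hx hy hne h => exact ⟨hx, hy, .inl (.inl (.inr ⟨hne, h⟩))⟩
      | cosetCollision _ _ hx hy hne h => exact ⟨hx, hy, .inl (.inr ⟨hne, h⟩)⟩
      | notHomomorphic _ _ hx hy h hne =>
        rw [← subMod_eq hx hy] at hne
        exact ⟨hx, hy, .inr ⟨h, hne⟩⟩

end DLogInstance

/-! ### Checking solutions of DLog in polynomial time -/

section

variable {γ : Type} [TreeEnc γ]

theorem PTF.dlogFields {G : γ → DLogInstance} (hG : PTF G) :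
    PTF fun c => (bd₀ (G c).s, (G c).f, bd₀ (G c).id, bd₀ (G c).g, bd₀ (G c).t) :=
  hG.of_enc_eq fun _ => rfl

@[fun_prop]
theorem PTF.dlogS {G : γ → DLogInstance} (hG : PTF G) : PTF fun c => bd₀ (G c).s :=
  hG.dlogFields.fst

@[fun_prop]
theorem PTF.dlogF {G : γ → DLogInstance} (hG : PTF G) : PTF fun c => (G c).f :=
  hG.dlogFields.snd.fst

@[fun_prop]
theorem PTF.dlogId {G : γ → DLogInstance} (hG : PTF G) : PTF fun c => bd₀ (G c).id :=
  hG.dlogFields.snd.snd.fst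

@[fun_prop]
theorem PTF.dlogG {G : γ → DLogInstance} (hG : PTF G) : PTF fun c => bd₀ (G c).g :=
  hG.dlogFields.snd.snd.snd.fst

@[fun_prop]
theorem PTF.dlogT {G : γ → DLogInstance} (hG : PTF G) : PTF fun c => bd₀ (G c).t :=
  hG.dlogFields.snd.snd.snd.snd

theorem PTF.dlogMk {s i g t : γ → ℕ} {f : γ → Circuit} (hs : PTF fun c => bd₀ (s c)) (hf : PTF f)
    (hi : PTF fun c => bd₀ (i c)) (hg : PTF fun c => bd₀ (g c)) (ht : PTF fun c => bd₀ (t c)) :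
    PTF fun c => DLogInstance.mk (s c) (f c) (i c) (g c) (t c) :=
  (hs.prodMk (hf.prodMk (hi.prodMk (hg.prodMk ht)))).of_enc_eq fun _ => rfl

@[fun_prop]
theorem PTF.dlogLen {G : γ → DLogInstance} (hG : PTF G) : PTF fun c => (G c).len :=
  hG.dlogS.clog

@[fun_prop]
theorem PTF.dlogEncode {G : γ → DLogInstance} (hG : PTF G) : PTF fun c => (G c).encode := by
  unfold DLogInstance.encode
  fun_prop

@[fun_prop]
theorem PTF.dlogParse {l : γ → List Bool} (hl : PTF l) : PTF fun c => DLogInstance.parse (l c) := by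
  have h := hl.parseBlock.snd.parseCircuit
  exact PTF.dlogMk hl.parseBlock.fst.bd₀_bc h.fst h.snd.parseBlock.fst.bd₀_bc
    h.snd.parseBlock.snd.parseBlock.fst.bd₀_bc h.snd.parseBlock.snd.parseBlock.snd.parseBlock.fst.bd₀_bc

@[fun_prop]
theorem PTF.dlogOpBits {G : γ → DLogInstance} {u v : γ → List Bool} (hG : PTF G) (hu : PTF u)
    (hv : PTF v) : PTF fun c => (G c).opBits (u c) (v c) := by
  unfold DLogInstance.opBits
  fun_prop

theorem PTF.dlogOp {G : γ → DLogInstance} {x y : γ → ℕ} (hG : PTF G) (hx : PTF fun c => bd₀ (x c))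
    (hy : PTF fun c => bd₀ (y c)) : PTF fun c => bd₀ ((G c).op (x c) (y c)) :=
  (hG.dlogOpBits (hG.dlogLen.bd hx) (hG.dlogLen.bd hy)).bd₀_bc

/-- The length of the output depends on the circuit only, whatever the arguments are. This keeps the
accumulator of repeated squaring bounded. -/
theorem DLogInstance.tsize_opBits_le (G : DLogInstance) (u v : List Bool) :
    tsize (G.opBits u v) ≤ 4 * tsize G.f.outputs := by
  have h := tsize_list_le (l := G.opBits u v) (m := 3) fun b _ => tsize_bool b
  have h' := length_lt_tsize G.f.outputs
  rw [DLogInstance.length_opBits, Circuit.numOutputs] at h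
  omega

@[fun_prop]
theorem PTF.dlogPowBits {G : γ → DLogInstance} {u : γ → List Bool} (hG : PTF G) (hu : PTF u) :
    PTF fun c => (G c).powBits (u c) := by
  have hgg := hG.dlogLen.bd hG.dlogG
  obtain ⟨q, hq⟩ := hG.dlogF.outputs.size
  unfold DLogInstance.powBits
  refine PTF.foldl_bdd (step := fun c r b => if b then
      (G c).opBits (TotalSearch.bd (G c).len (G c).g) ((G c).opBits r r) else (G c).opBits r r)
    (hG.dlogLen.bd hG.dlogId) hu ?_ ⟨4 * q, fun c r b => ?_⟩
  · have h : PTF fun x : (γ × List Bool) × Bool =>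
        TotalSearch.bd (G x.1.1).len (G x.1.1).g := hgg.comp (by fun_prop)
    refine PTF.of_enc_eq (f := fun x => bif x.2 then
      (G x.1.1).opBits (TotalSearch.bd (G x.1.1).len (G x.1.1).g) ((G x.1.1).opBits x.1.2 x.1.2)
      else (G x.1.1).opBits x.1.2 x.1.2) (by fun_prop) fun x => ?_
    cases x.2 <;> rfl
  · have h₁ := (hq c).trans (eval_mono_nat q (Nat.le_add_right (tsize c) (tsize b)))
    simp only [Polynomial.eval_mul, Polynomial.eval_ofNat]
    split_ifs <;> exact (DLogInstance.tsize_opBits_le _ _ _).trans (by omega)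

theorem PTF.dlogIndex {G : γ → DLogInstance} {x : γ → ℕ} (hG : PTF G)
    (hx : PTF fun c => bd₀ (x c)) : PTF fun c => bd₀ ((G c).index (x c)) :=
  (hG.dlogPowBits hx).bd₀_bc

@[fun_prop]
theorem PTF.dlogCheck {G : γ → DLogInstance} (hG : PTF G) : PTF fun c => (G c).check := by
  have h₁ := hG.dlogS.lt_bin (PTF.const (bd₀ 2))
  have h₂ := hG.dlogId.lt_bin hG.dlogS
  have h₃ := hG.dlogG.lt_bin hG.dlogS
  have h₄ := hG.dlogT.lt_bin hG.dlogS
  unfold DLogInstance.check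
  fun_prop

theorem PTF.subMod {s x y : γ → ℕ} (hs : PTF fun c => bd₀ (s c)) (hx : PTF fun c => bd₀ (x c))
    (hy : PTF fun c => bd₀ (y c)) : PTF fun c => bd₀ (subMod (s c) (x c) (y c)) := by
  have hk : PTF fun c => (bd₀ (s c)).length + 1 := by fun_prop
  exact (PTF.addSubBits hk (hk.bd hx) ((hx.lt_bin hy).cond (hk.bd hs)
    (hk.bd (PTF.const (bd₀ 0)))) (hk.bd hy)).bd₀_bc

theorem PTF.dlogCheckAnswer {G : γ → DLogInstance} {b : γ → Bool} {x y : γ → ℕ} (hG : PTF G)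
    (hb : PTF b) (hx : PTF fun c => bd₀ (x c)) (hy : PTF fun c => bd₀ (y c)) :
    PTF fun c => (G c).checkAnswer (b c) (x c) (y c) := by
  have h₁ := hG.dlogIndex hx
  have h₂ := hG.dlogIndex hy
  have h₃ := hG.dlogOp hG.dlogT h₁
  have h₄ := hG.dlogOp hG.dlogT h₂
  have h₅ := hG.dlogIndex (hG.dlogS.subMod hx hy)
  have h₆ := (hx.beqList hy).not
  exact (hx.lt_bin hG.dlogS).and (hb.cond (h₁.beqList hG.dlogT) ((hy.lt_bin hG.dlogS).and
    (((((hG.dlogOp hx hy).lt_bin hG.dlogS).not.or (h₆.and (h₁.beqList h₂))).or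
    (h₆.and (h₃.beqList h₄))).or ((h₁.beqList h₄).and (h₅.beqList hG.dlogT).not))))

theorem PTF.answerSingle {x : γ → ℕ} (hx : PTF fun c => bd₀ (x c)) :
    PTF fun c => DLogAnswer.single (x c) :=
  ((PTF.const true).prodMk (hx.prodMk (PTF.const (bd₀ 0)))).of_enc_eq fun _ => rfl

theorem PTF.answerPair {x y : γ → ℕ} (hx : PTF fun c => bd₀ (x c)) (hy : PTF fun c => bd₀ (y c)) :
    PTF fun c => DLogAnswer.pair (x c) (y c) :=
  ((PTF.const false).prodMk (hx.prodMk hy)).of_enc_eq fun _ => rfl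

theorem PTF.answerTriple {a : γ → DLogAnswer} (ha : PTF a) :
    PTF fun c => ((a c).triple.1, bd₀ (a c).triple.2.1, bd₀ (a c).triple.2.2) :=
  ha.of_enc_eq fun _ => rfl

@[fun_prop]
theorem PTF.answerEncode {a : γ → DLogAnswer} (ha : PTF a) : PTF fun c => (a c).encode := by
  have h := ha.answerTriple
  refine PTF.of_enc_eq (f := fun c => bif (a c).triple.1 then
      TotalSearch.block (bd₀ (a c).triple.2.1) else
      TotalSearch.block (bd₀ (a c).triple.2.1) ++ TotalSearch.block (bd₀ (a c).triple.2.2))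
    (h.fst.cond h.snd.fst.block (h.snd.fst.block.append h.snd.snd.block)) fun c => ?_
  cases a c <;> rfl

@[fun_prop]
theorem PTF.answerParse {l : γ → List Bool} (hl : PTF l) : PTF fun c => DLogAnswer.parse (l c) :=
  hl.parseBlock.snd.isEmpty.cond (PTF.answerSingle hl.parseBlock.fst.bd₀_bc)
    (PTF.answerPair hl.parseBlock.fst.bd₀_bc hl.parseBlock.snd.parseBlock.fst.bd₀_bc)

end

theorem exists_ptf_dlog : ∃ d : List Bool × List Bool → Bool, PTF d ∧
    ∀ x y, d (x, y) = true ↔ DLog x y :=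
  exists_ptf_searchProblem (dI := DLogInstance.parse) (dA := DLogAnswer.parse)
    (v := fun G => G.check) (s := fun p => p.1.checkAnswer p.2.triple.1 p.2.triple.2.1 p.2.triple.2.2)
    DLogInstance.parse_encode DLogAnswer.parse_encode DLogInstance.check_iff
    (fun G a _ => G.checkAnswer_iff a) PTF.id'.dlogEncode PTF.id'.answerEncode PTF.id'.dlogParse
    PTF.id'.answerParse PTF.id'.dlogCheck
    (PTF.dlogCheckAnswer PTF.id'.fst PTF.id'.snd.answerTriple.fst PTF.id'.snd.answerTriple.snd.fst
      PTF.id'.snd.answerTriple.snd.snd)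

theorem length_block (u : List Bool) : (block u).length = 2 * u.length + 1 := by
  simp [block, List.length_flatMap, Nat.mul_comm]

theorem isTFNP_dlog : IsTFNP DLog := by
  obtain ⟨d, hd, h⟩ := exists_ptf_dlog
  refine ⟨polyTimeDecidable_of_ptf hd h, 2 * Polynomial.X, fun x => ?_⟩
  by_cases hx : ∃ G : DLogInstance, G.Valid ∧ G.encode = x
  · obtain ⟨G, hG, rfl⟩ := hx
    obtain ⟨a, ha, ha'⟩ := hG.exists_isSolution
    refine ⟨a.encode, fun G' _ hG' => ⟨a, ?_, rfl⟩, ?_⟩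
    · rw [← DLogInstance.parse_encode G', hG', DLogInstance.parse_encode]
      exact ha
    -- Numbers below s have no more digits than s, whose block is part of the instance. An answer
    -- consists of at most two such blocks, whence the bound 2X.
    · have h₁ : 2 * (bd₀ G.s).length + 1 ≤ G.encode.length := by
        simp [DLogInstance.encode, length_block]
      rw [Polynomial.eval_mul, Polynomial.eval_ofNat, Polynomial.eval_X]
      cases a with
      | single x =>
        have := length_bd₀_mono (le_of_lt ha')
        rw [DLogAnswer.encode, length_block]
        omega
      | pair x y =>
        have := length_bd₀_mono (le_of_lt ha'.1)
        have := length_bd₀_mono (le_of_lt ha'.2)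
        rw [DLogAnswer.encode, List.length_append, length_block, length_block]
        omega
  · exact ⟨[], fun G hG hG' => absurd ⟨G, hG, hG'⟩ hx, by simp⟩

open TreeEnc

/-! ### Composition of circuits -/

/-- The values of all gates of a list on input `u`. -/
def gateValues (gs : List Gate) (u : List Bool) : List Bool :=
  gs.foldl (fun vals g => vals ++ [g.value u vals]) []

theorem Circuit.values_eq (C : Circuit) (u : List Bool) : C.values u = gateValues C.gates u := rfl

theorem gateValues_concat (gs : List Gate) (g : Gate) (u : List Bool) :
    gateValues (gs ++ [g]) u = gateValues gs u ++ [g.value u (gateValues gs u)] := by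
  simp [gateValues]

theorem length_gateValues (gs : List Gate) (u : List Bool) :
    (gateValues gs u).length = gs.length := by
  induction gs using List.reverseRecOn with
  | nil => rfl
  | append_singleton gs g ih => simp [gateValues_concat, ih]

theorem gateValues_append_getD (gs l : List Gate) (u : List Bool) {w : ℕ} (hw : w < gs.length) :
    (gateValues (gs ++ l) u).getD w false = (gateValues gs u).getD w false := by
  induction l using List.reverseRecOn with
  | nil => simp
  | append_singleton l g ih =>
    rw [← List.append_assoc, gateValues_concat, List.getD_append _ _ _ _ _, ih]
    rw [length_gateValues, List.length_append]
    omega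

/-- Every gate refers to the `n` input variables and to earlier gates only. -/
def GatesWellFormed (n : ℕ) (gs : List Gate) : Prop :=
  ∀ (k : ℕ) (g : Gate), gs[k]? = some g → g.WellFormed n k

theorem Gate.WellFormed.mono {n k k' : ℕ} {g : Gate} (h : g.WellFormed n k) (hk : k ≤ k') :
    g.WellFormed n k' := by
  cases g <;> simp only [WellFormed] at h ⊢ <;> omega

theorem GatesWellFormed.concat {n : ℕ} {gs : List Gate} (h : GatesWellFormed n gs) {g : Gate}
    (hg : g.WellFormed n gs.length) : GatesWellFormed n (gs ++ [g]) := by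
  intro k g' hk
  rw [List.getElem?_append] at hk
  split_ifs at hk with h'
  · exact h k g' hk
  · obtain ⟨h₁, rfl⟩ := List.getElem?_eq_some_iff.1 hk
    simp only [List.length_singleton] at h₁
    simpa using hg.mono (not_lt.1 h')

theorem gatesWellFormed_append {n : ℕ} {gs : List Gate} (h : GatesWellFormed n gs) (l : List Gate)
    (hl : ∀ (k : ℕ) (g : Gate), l[k]? = some g → g.WellFormed n (gs.length + k)) :
    GatesWellFormed n (gs ++ l) := by
  induction l using List.reverseRecOn with
  | nil => simpa using h
  | append_singleton l g ih =>
    rw [← List.append_assoc]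
    refine (ih fun k g' hk => hl k g' ?_).concat ?_
    · rw [List.getElem?_append_left (List.getElem?_eq_some_iff.1 hk).1, hk]
    · rw [List.length_append]
      exact hl _ _ (by simp)

/-- `gs'` is a well-formed list of gates that results from `gs` by adding `k` gates. -/
structure GatesExtend (n k : ℕ) (gs gs' : List Gate) : Prop where
  isPrefix : gs <+: gs'
  wellFormed : GatesWellFormed n gs'
  length : gs'.length = gs.length + k

theorem GatesExtend.refl {n : ℕ} {gs : List Gate} (h : GatesWellFormed n gs) :
    GatesExtend n 0 gs gs :=
  ⟨List.prefix_refl _, h, rfl⟩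

theorem GatesExtend.trans {n k l : ℕ} {gs gs' gs'' : List Gate} (h : GatesExtend n k gs gs')
    (h' : GatesExtend n l gs' gs'') : GatesExtend n (k + l) gs gs'' :=
  ⟨h.isPrefix.trans h'.isPrefix, h'.wellFormed, by rw [h'.length, h.length, Nat.add_assoc]⟩

/-- On input `u`, the gates at the positions `ws` have the values `r`. -/
structure WireValues (gs : List Gate) (u : List Bool) (ws : List ℕ) (r : List Bool) : Prop where
  lt : ∀ w ∈ ws, w < gs.length
  map : ws.map (fun w => (gateValues gs u).getD w false) = r

section

variable {n k : ℕ} {gs gs' : List Gate} {u : List Bool} {ws ws' : List ℕ} {r r' : List Bool}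

theorem WireValues.mono (h : WireValues gs u ws r) (hgs : gs <+: gs') :
    WireValues gs' u ws r := by
  obtain ⟨l, rfl⟩ := hgs
  refine ⟨fun w hw => ?_, ?_⟩
  · have := h.lt w hw
    rw [List.length_append]
    omega
  · rw [← h.map]
    exact List.map_congr_left fun w hw => gateValues_append_getD _ _ _ (h.lt w hw)

theorem WireValues.length (h : WireValues gs u ws r) : r.length = ws.length := by
  rw [← h.map, List.length_map]

theorem WireValues.append (h : WireValues gs u ws r) (h' : WireValues gs u ws' r') :
    WireValues gs u (ws ++ ws') (r ++ r') :=
  ⟨fun w hw => (List.mem_append.1 hw).elim (h.lt w) (h'.lt w), by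
    rw [List.map_append, h.map, h'.map]⟩

theorem WireValues.head {w : ℕ} {b : Bool} (h : WireValues gs u (w :: ws) (b :: r)) :
    WireValues gs u [w] [b] :=
  ⟨fun w' hw' => h.lt w' (by simp at hw'; simp [hw']), by simpa using (List.cons.inj h.map).1⟩

theorem WireValues.tail {w : ℕ} {b : Bool} (h : WireValues gs u (w :: ws) (b :: r)) :
    WireValues gs u ws r :=
  ⟨fun w' hw' => h.lt w' (by simp [hw']), (List.cons.inj h.map).2⟩

theorem WireValues.of_append (h : WireValues gs u (ws ++ ws') (r ++ r'))
    (hl : r.length = ws.length) : WireValues gs u ws r ∧ WireValues gs u ws' r' := by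
  have h' := h.map
  rw [List.map_append] at h'
  obtain ⟨h₁, h₂⟩ := List.append_inj h' (by rw [List.length_map, hl])
  exact ⟨⟨fun w hw => h.lt w (by simp [hw]), h₁⟩, ⟨fun w hw => h.lt w (by simp [hw]), h₂⟩⟩

theorem WireValues.value {w : ℕ} {b : Bool} (h : WireValues gs u [w] [b]) :
    (gateValues gs u).getD w false = b := by
  simpa using h.map

theorem WireValues.nil : WireValues gs u [] [] := ⟨by simp, rfl⟩

/-! A layer of gates that are evaluated in parallel -/

/-- The positions of `k` gates that are added to `m` gates. -/
def newWires (m k : ℕ) : List ℕ := (List.range k).map (m + ·)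

theorem length_newWires (m k : ℕ) : (newWires m k).length = k := by simp [newWires]

/-- The gates of a layer refer only to gates before the layer, so each of them is evaluated as if
the others were absent. -/
theorem gateValues_layer (l : List Gate) (hl : ∀ g ∈ l, g.WellFormed n gs.length) :
    gateValues (gs ++ l) u = gateValues gs u ++ l.map fun g => g.value u (gateValues gs u) := by
  induction l using List.reverseRecOn with
  | nil => simp
  | append_singleton l g ih =>
    rw [← List.append_assoc, gateValues_concat, ih fun g' hg' => hl g' (by simp [hg']),
      List.map_append, ← List.append_assoc]
    congr 1
    have h := hl g (by simp)
    have hd : ∀ i < gs.length, ∀ l' : List Bool, (gateValues gs u ++ l').getD i false =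
        (gateValues gs u).getD i false := fun i hi l' =>
      List.getD_append _ _ _ _ (by rwa [length_gateValues])
    cases g with
    | input i => rfl
    | const b => rfl
    | neg i => simp only [Gate.value, List.map_cons, List.map_nil, hd i h]
    | conj i j => simp only [Gate.value, List.map_cons, List.map_nil, hd i h.1, hd j h.2]
    | disj i j => simp only [Gate.value, List.map_cons, List.map_nil, hd i h.1, hd j h.2]

theorem wireValues_layer (l : List Gate) (hl : ∀ g ∈ l, g.WellFormed n gs.length) :
    WireValues (gs ++ l) u (newWires gs.length l.length)
      (l.map fun g => g.value u (gateValues gs u)) := by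
  refine ⟨fun w hw => ?_, ?_⟩
  · simp only [newWires, List.mem_map, List.mem_range] at hw
    obtain ⟨i, hi, rfl⟩ := hw
    rw [List.length_append]
    omega
  · rw [gateValues_layer l hl, newWires, List.map_map]
    refine Eq.trans (List.map_congr_left fun i _ => ?_)
      (map_range_getD _ (l.map fun g => g.value u (gateValues gs u)) (by simp))
    rw [Function.comp_apply, List.getD_append_right _ _ _ _ (by rw [length_gateValues]; omega),
      length_gateValues, Nat.add_sub_cancel_left]

theorem gatesExtend_layer (h : GatesWellFormed n gs) (l : List Gate)
    (hl : ∀ g ∈ l, g.WellFormed n gs.length) : GatesExtend n l.length gs (gs ++ l) :=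
  ⟨List.prefix_append _ _, gatesWellFormed_append h l fun _ g hk =>
    (hl g (List.mem_of_getElem? hk)).mono (Nat.le_add_right _ _), List.length_append⟩

/-! Copies of a circuit -/

/-- Adds a copy of the circuit whose inputs are the gates at the positions `ws`. -/
def copyGates (C : Circuit) (ws : List ℕ) (gs : List Gate) : List Gate :=
  gs ++ C.gates.map (Gate.copy ws gs.length)

/-- The positions of the output gates of the copy. -/
def copyOutputs (C : Circuit) (m : ℕ) : List ℕ := C.outputs.map (m + ·)

theorem length_copyOutputs (C : Circuit) (m : ℕ) : (copyOutputs C m).length = C.numOutputs := by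
  simp [copyOutputs, Circuit.numOutputs]

theorem Gate.WellFormed.copy {m : ℕ} {g : Gate} (h : g.WellFormed ws.length m)
    (hw : ∀ w ∈ ws, w < k) : (g.copy ws k).WellFormed n (k + m) := by
  cases g with
  | input i =>
    have h₁ : ws.getD i 0 < k := by
      rw [List.getD_eq_getElem _ _ h]
      exact hw _ (List.getElem_mem _)
    exact ⟨by omega, by omega⟩
  | const b => trivial
  | neg i => exact Nat.add_lt_add_left h k
  | conj i j => exact ⟨Nat.add_lt_add_left h.1 k, Nat.add_lt_add_left h.2 k⟩
  | disj i j => exact ⟨Nat.add_lt_add_left h.1 k, Nat.add_lt_add_left h.2 k⟩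

/-- The copy does not disturb the old values and reproduces, shifted by the number of old gates, the
values of the circuit on the string carried by `ws`. -/
theorem gateValues_copy (h : WireValues gs u ws r) (l : List Gate)
    (hl : GatesWellFormed ws.length l) :
    gateValues (gs ++ l.map (Gate.copy ws gs.length)) u = gateValues gs u ++ gateValues l r := by
  induction l using List.reverseRecOn with
  | nil => simp [gateValues]
  | append_singleton l g ih =>
    have hg : g.WellFormed ws.length l.length := hl _ _ (by simp)
    have hl' : GatesWellFormed ws.length l := fun k g' hk => hl k g' (by
      rw [List.getElem?_append_left (List.getElem?_eq_some_iff.1 hk).1, hk])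
    rw [List.map_append, ← List.append_assoc, List.map_singleton, gateValues_concat,
      gateValues_concat, ih hl', List.append_assoc]
    congr 3
    have hd : ∀ i, (gateValues gs u ++ gateValues l r).getD (gs.length + i) false =
        (gateValues l r).getD i false := fun i => by
      rw [List.getD_append_right _ _ _ _ (by rw [length_gateValues]; omega), length_gateValues,
        Nat.add_sub_cancel_left]
    cases g with
    -- There is no identity gate; the conjunction of a wire with itself replaces it.
    | input i =>
      have hi : i < ws.length := hg
      have h₁ : (gateValues gs u ++ gateValues l r).getD (ws.getD i 0) false = r.getD i false := by
        rw [List.getD_append _ _ _ _ (by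
          rw [length_gateValues, List.getD_eq_getElem _ _ hi]; exact h.lt _ (List.getElem_mem _)),
          ← h.map, List.getD_eq_getElem (l := ws.map _) _ (by simpa using hi),
          List.getElem_map, List.getD_eq_getElem _ _ hi]
      simp only [Gate.copy, Gate.value, h₁, Bool.and_self]
    | const b => rfl
    | neg i => simp only [Gate.copy, Gate.value, hd]
    | conj i j => simp only [Gate.copy, Gate.value, hd]
    | disj i j => simp only [Gate.copy, Gate.value, hd]

theorem gatesExtend_copy {C : Circuit} (hC : C.WellFormed) (hgs : GatesWellFormed n gs)
    (hw : ∀ w ∈ ws, w < gs.length) (hn : ws.length = C.numInputs) :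
    GatesExtend n C.gates.length gs (copyGates C ws gs) := by
  refine ⟨List.prefix_append _ _, gatesWellFormed_append hgs _ fun k g hk => ?_,
    by simp [copyGates]⟩
  rw [List.getElem?_map, Option.map_eq_some_iff] at hk
  obtain ⟨g, hg, rfl⟩ := hk
  have := hC.1 k g hg
  rw [← hn] at this
  exact this.copy hw

theorem wireValues_copy {C : Circuit} (hC : C.WellFormed) (h : WireValues gs u ws r)
    (hn : ws.length = C.numInputs) :
    WireValues (copyGates C ws gs) u (copyOutputs C gs.length) (C.eval r) := by
  have hl : GatesWellFormed ws.length C.gates := by rw [hn]; exact hC.1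
  refine ⟨fun w hw => ?_, ?_⟩
  · simp only [copyOutputs, List.mem_map] at hw
    obtain ⟨o, ho, rfl⟩ := hw
    have := hC.2 o ho
    simp only [copyGates, List.length_append, List.length_map]
    omega
  · rw [copyGates, gateValues_copy h _ hl, copyOutputs, List.map_map, Circuit.eval]
    refine List.map_congr_left fun o _ => ?_
    rw [Function.comp_apply, List.getD_append_right _ _ _ _ (by rw [length_gateValues]; omega),
      length_gateValues, Nat.add_sub_cancel_left, Circuit.values_eq]

/-! Selection between two strings -/

def disjGates (a b : List ℕ) : List Gate :=
  (List.range a.length).map fun i => .disj (a.getD i 0) (b.getD i 0)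

/-- Adds gates that select the gates at the positions `a` or those at the positions `b`. -/
def muxGates (c : ℕ) (a b : List ℕ) (gs : List Gate) : List Gate :=
  gs ++ [Gate.neg c] ++ a.map (Gate.conj c) ++ b.map (Gate.conj gs.length) ++
    disjGates (newWires (gs.length + 1) a.length) (newWires (gs.length + 1 + a.length) a.length)

def muxOutputs (m k : ℕ) : List ℕ := newWires (m + 1 + k + k) k

/-- Bitwise the selection is (c ∧ a) ∨ (¬c ∧ b), in four layers: the negation, the two families of
conjunctions, and the disjunctions. Hence 1 + 3k gates for strings of length k. -/
theorem mux_spec {c : ℕ} {a b : List ℕ} {p : Bool} {A B : List Bool} (hgs : GatesWellFormed n gs)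
    (hc : WireValues gs u [c] [p]) (ha : WireValues gs u a A) (hb : WireValues gs u b B)
    (hab : a.length = b.length) :
    GatesExtend n (1 + a.length + a.length + a.length) gs (muxGates c a b gs) ∧
      WireValues (muxGates c a b gs) u (muxOutputs gs.length a.length) (bif p then A else B) := by
  have hc' := hc.lt c (by simp)
  have w₁ : ∀ g ∈ [Gate.neg c], g.WellFormed n gs.length := by
    simpa [Gate.WellFormed] using hc'
  have e₁ := gatesExtend_layer hgs _ w₁
  have v₁ := wireValues_layer (u := u) _ w₁
  have l₁ : (gs ++ [Gate.neg c]).length = gs.length + 1 := by simp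
  have v₁' : WireValues (gs ++ [Gate.neg c]) u [gs.length] [!p] := by
    simpa only [newWires, List.map_cons, List.map_nil, Gate.value, hc.value, List.length_singleton,
      List.range_one, Nat.add_zero] using v₁
  have w₂ : ∀ g ∈ a.map (Gate.conj c), g.WellFormed n (gs ++ [Gate.neg c]).length := by
    intro g hg
    obtain ⟨w, hw, rfl⟩ := List.mem_map.1 hg
    have := ha.lt w hw
    exact ⟨by omega, by omega⟩
  have e₂ := gatesExtend_layer e₁.wellFormed _ w₂
  have v₂ := wireValues_layer (u := u) _ w₂
  have w₃ : ∀ g ∈ b.map (Gate.conj gs.length),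
      g.WellFormed n (gs ++ [Gate.neg c] ++ a.map (Gate.conj c)).length := by
    intro g hg
    obtain ⟨w, hw, rfl⟩ := List.mem_map.1 hg
    have := hb.lt w hw
    rw [List.length_append]
    exact ⟨by omega, by omega⟩
  have e₃ := gatesExtend_layer e₂.wellFormed _ w₃
  have v₃ := wireValues_layer (u := u) _ w₃
  have l₂ := e₂.length
  rw [l₁] at l₂
  rw [l₂] at v₃
  have v₂' := v₂.mono e₃.isPrefix
  rw [l₁] at v₂'
  simp only [List.length_map] at v₂' v₃ l₂ e₃ e₂
  rw [← hab] at v₃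
  have h₂ : (a.map (Gate.conj c)).map (fun g => g.value u (gateValues (gs ++ [Gate.neg c]) u)) =
      A.map (p && ·) := by
    have hm := (ha.mono e₁.isPrefix).map
    rw [← hm, List.map_map, List.map_map]
    exact List.map_congr_left fun w _ => by
      simp only [Function.comp_apply, Gate.value, (hc.mono e₁.isPrefix).value]
  have h₃ : (b.map (Gate.conj gs.length)).map
      (fun g => g.value u (gateValues (gs ++ [Gate.neg c] ++ a.map (Gate.conj c)) u)) =
      B.map (!p && ·) := by
    have hm := ((hb.mono e₁.isPrefix).mono e₂.isPrefix).map
    rw [← hm, List.map_map, List.map_map]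
    exact List.map_congr_left fun w _ => by
      simp only [Function.comp_apply, Gate.value, (v₁'.mono e₂.isPrefix).value]
  rw [h₂] at v₂'
  rw [h₃] at v₃
  have getD_lt : ∀ {gs : List Gate} {ws : List ℕ} {r : List Bool} {i : ℕ},
      WireValues gs u ws r → i < ws.length → ws.getD i 0 < gs.length ∧
        (gateValues gs u).getD (ws.getD i 0) false = r.getD i false := by
    intro gs ws r i h hi
    rw [List.getD_eq_getElem _ _ hi]
    refine ⟨h.lt _ (List.getElem_mem _), ?_⟩
    rw [← h.map, List.getD_eq_getElem (l := ws.map _) _ (by simpa using hi), List.getElem_map]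
  have w₄ : ∀ g ∈ disjGates (newWires (gs.length + 1) a.length)
      (newWires (gs.length + 1 + a.length) a.length),
      g.WellFormed n (gs ++ [Gate.neg c] ++ a.map (Gate.conj c) ++
        b.map (Gate.conj gs.length)).length := by
    intro g hg
    obtain ⟨i, hi, rfl⟩ := List.mem_map.1 hg
    rw [List.mem_range, length_newWires] at hi
    exact ⟨(getD_lt v₂' (by rwa [length_newWires])).1, (getD_lt v₃ (by rwa [length_newWires])).1⟩
  have e₄ := gatesExtend_layer e₃.wellFormed _ w₄
  have v₄ := wireValues_layer (u := u) _ w₄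
  have hlen : (disjGates (newWires (gs.length + 1) a.length)
      (newWires (gs.length + 1 + a.length) a.length)).length = a.length := by
    simp [disjGates, length_newWires]
  have l₃ := e₃.length
  rw [l₂, ← hab] at l₃
  rw [l₃, hlen] at v₄
  rw [hlen] at e₄
  rw [← hab] at e₃
  refine ⟨((e₁.trans e₂).trans e₃).trans e₄, ?_⟩
  have h₄ : (disjGates (newWires (gs.length + 1) a.length)
      (newWires (gs.length + 1 + a.length) a.length)).map (fun g => g.value u (gateValues
        (gs ++ [Gate.neg c] ++ a.map (Gate.conj c) ++ b.map (Gate.conj gs.length)) u)) =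
      bif p then A else B := by
    have hA := ha.length
    have hB := hb.length
    rw [disjGates, List.map_map, length_newWires]
    refine Eq.trans (List.map_congr_left fun i hi => ?_)
      (map_range_getD a.length _ (by cases p <;> simp [hA, hB, hab]))
    rw [List.mem_range] at hi
    rw [Function.comp_apply, Gate.value, (getD_lt v₂' (by rwa [length_newWires])).2,
      (getD_lt v₃ (by rwa [length_newWires])).2, List.getD_eq_getElem _ _ (by simp; omega),
      List.getD_eq_getElem _ _ (by simp; omega), List.getElem_map, List.getElem_map]
    cases p <;> simp <;> rw [List.getElem?_eq_getElem (by omega)] <;> rfl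
  rw [h₄] at v₄
  exact v₄

end

theorem tsize_gate (g : Gate) : tsize g = tsize g.triple := rfl

theorem Gate.WellFormed.tsize_le {n k : ℕ} {g : Gate} (h : g.WellFormed n k) :
    tsize g ≤ 4 * (n + k) + 20 := by
  rw [tsize_gate]
  cases g with
  | const b =>
    have := b.toNat_le
    simp only [Gate.triple, tsize_mk, tsize_nat]
    omega
  | _ =>
    simp only [Gate.WellFormed] at h
    simp only [Gate.triple, tsize_mk, tsize_nat]
    omega

/-- A well-formed gate names only inputs and earlier positions, so even in unary the code is
polynomial in the number of inputs and gates. To bound the size of a constructed circuit it is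
therefore enough to count its gates. -/
theorem GatesWellFormed.tsize_le {n : ℕ} {gs : List Gate} (h : GatesWellFormed n gs) :
    tsize gs ≤ gs.length * (4 * (n + gs.length) + 21) + 1 := by
  refine tsize_list_le fun g hg => ?_
  obtain ⟨k, hk, rfl⟩ := List.getElem_of_mem hg
  have := (h k gs[k] (by simp)).tsize_le
  omega

theorem tsize_wires_le {k : ℕ} {ws : List ℕ} (h : ∀ w ∈ ws, w < k) :
    tsize ws ≤ ws.length * (2 * k + 2) + 1 :=
  tsize_list_le (m := 2 * k + 1) fun w hw => by
    have := h w hw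
    rw [tsize_nat]
    omega

section

variable {γ : Type} [TreeEnc γ]

@[fun_prop]
theorem PTF.newWires {m k : γ → ℕ} (hm : PTF m) (hk : PTF k) :
    PTF fun c => newWires (m c) (k c) := by
  unfold TotalSearch.newWires
  exact PTF.map (by fun_prop) (by fun_prop)

@[fun_prop]
theorem PTF.copyGates {C : γ → Circuit} {ws : γ → List ℕ} {gs : γ → List Gate} (hC : PTF C)
    (hws : PTF ws) (hgs : PTF gs) : PTF fun c => copyGates (C c) (ws c) (gs c) := by
  unfold TotalSearch.copyGates
  exact hgs.append (PTF.map (by fun_prop) (by fun_prop))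

@[fun_prop]
theorem PTF.copyOutputs {C : γ → Circuit} {m : γ → ℕ} (hC : PTF C) (hm : PTF m) :
    PTF fun c => copyOutputs (C c) (m c) := by
  unfold TotalSearch.copyOutputs
  exact PTF.map (by fun_prop) (by fun_prop)

@[fun_prop]
theorem PTF.disjGates {a b : γ → List ℕ} (ha : PTF a) (hb : PTF b) :
    PTF fun c => disjGates (a c) (b c) := by
  unfold TotalSearch.disjGates
  exact PTF.map (by fun_prop) (by fun_prop)

@[fun_prop]
theorem PTF.muxGates {c : γ → ℕ} {a b : γ → List ℕ} {gs : γ → List Gate} (hc : PTF c) (ha : PTF a)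
    (hb : PTF b) (hgs : PTF gs) : PTF fun x => muxGates (c x) (a x) (b x) (gs x) := by
  have h₁ : PTF fun x => (a x).map (Gate.conj (c x)) := PTF.map (by fun_prop) (by fun_prop)
  have h₂ : PTF fun x => (b x).map (Gate.conj (gs x).length) := PTF.map (by fun_prop) (by fun_prop)
  unfold TotalSearch.muxGates
  fun_prop

@[fun_prop]
theorem PTF.muxOutputs {m k : γ → ℕ} (hm : PTF m) (hk : PTF k) :
    PTF fun c => muxOutputs (m c) (k c) := by
  unfold TotalSearch.muxOutputs
  fun_prop

end

open TreeEnc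

/-! ### A circuit for square-and-multiply -/

/-- Adds gates that apply the circuit to the concatenation of two strings. -/
def opGates (f : Circuit) (a b : List ℕ) (gs : List Gate) : List Gate × List ℕ :=
  (copyGates f (a ++ b) gs, copyOutputs f gs.length)

/-- Adds gates for a square-and-multiply step with the bit `b`. -/
def stepGates (f : Circuit) (gW : List ℕ) (x : List Gate × List ℕ) (b : ℕ) : List Gate × List ℕ :=
  let y := opGates f x.2 x.2 x.1
  let z := opGates f gW y.2 y.1
  (muxGates b z.2 y.2 z.1, muxOutputs z.1.length z.2.length)

/-- Adds gates for a square-and-multiply step with the bit `b` that is skipped if the bit is a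
leading zero. -/
def skipGates (f : Circuit) (gW : List ℕ) (x : List Gate × List ℕ × ℕ) (b : ℕ) :
    List Gate × List ℕ × ℕ :=
  let y := stepGates f gW (x.1 ++ [.disj x.2.2 b], x.2.1) b
  (muxGates x.1.length y.2 x.2.1 y.1, muxOutputs y.1.length y.2.length, x.1.length)

/-- `f` is a well-formed circuit for an operation on strings of length `k`. -/
structure Circuit.IsOp (f : Circuit) (k : ℕ) : Prop where
  wellFormed : f.WellFormed
  numInputs : f.numInputs = 2 * k
  numOutputs : f.numOutputs = k

/-- Whether `f` is an operation on strings of length `k` and `x` consists of a list of gates, which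
is long enough, and the positions of `k` of them. -/
def checkGates (f : Circuit) (k : ℕ) (x : List Gate × List ℕ) : Bool :=
  f.check && (f.numInputs == 2 * k) && (f.outputs.length == k) &&
    (Circuit.mk (k + 1) x.1 x.2).check && (x.2.length == k) && !decide (x.1.length < 4 * k + 2)

/-- Adds gates for square-and-multiply. -/
def indexGates (f : Circuit) (k : ℕ) (x : List Gate × List ℕ) : List Gate × List ℕ :=
  let y := (bif checkGates f k x then x.2.take (k - 1) else []).foldl
    (skipGates f (newWires (2 * k + 1) k)) (x.1, newWires (k + 1) k, 4 * k + 1)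
  stepGates f (newWires (2 * k + 1) k) (y.1, y.2.1) (x.2.getD (k - 1) 0)

/-- Adds gates for a step of the chain. -/
def chainStepGates (f : Circuit) (k : ℕ) (x : List Gate × List ℕ) (b : ℕ) : List Gate × List ℕ :=
  let y := indexGates f k x
  let z := opGates f (newWires (3 * k + 1) k) y.2 y.1
  (muxGates b z.2 y.2 z.1, muxOutputs z.1.length z.2.length)

/-- A square-and-multiply step on strings. -/
def sqMul (f : Circuit) (g r : List Bool) (b : Bool) : List Bool :=
  bif b then f.eval (g ++ f.eval (r ++ r)) else f.eval (r ++ r)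

/-- The Boolean records whether a digit 1 has been met. Until then steps are omitted, which amounts
to removing leading zeroes. -/
theorem foldl_skip {α : Type} (step : α → Bool → α) (a : α) (v : List Bool) :
    v.foldl (fun x b => (bif x.2 || b then step x.1 b else x.1, x.2 || b)) (a, false) =
      if bc v = 0 then (a, false) else ((bd₀ (bc v)).foldl step a, true) := by
  induction v using List.reverseRecOn with
  | nil => rfl
  | append_singleton v b ih =>
    rw [List.foldl_append, ih, bc_concat, bd₀_two_mul_add]
    by_cases h : bc v = 0
    · cases b <;> simp [h]
    · have : 2 * bc v + b.toNat ≠ 0 := by omega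
      simp [h]

/-- Only digits before the last one can be leading zeroes: 0 itself is written with the single digit
0, so the last step is never omitted. This is why `indexGates` treats the last bit separately. -/
theorem foldl_bd₀_concat {α : Type} (step : α → Bool → α) (a : α) (v : List Bool) (b : Bool) :
    (bd₀ (bc (v ++ [b]))).foldl step a = step (v.foldl (fun x b =>
      (bif x.2 || b then step x.1 b else x.1, x.2 || b)) (a, false)).1 b := by
  rw [foldl_skip, bc_concat, bd₀_two_mul_add]
  split_ifs <;> simp

section

variable {n k : ℕ} {f : Circuit} {gs : List Gate} {u : List Bool} {ws ws' gW : List ℕ}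
  {r r' Rg : List Bool}

theorem WireValues.of_lt (h : ∀ w ∈ ws, w < gs.length) :
    WireValues gs u ws (ws.map fun w => (gateValues gs u).getD w false) := ⟨h, rfl⟩

theorem op_spec (hf : f.IsOp k) (hgs : GatesWellFormed n gs) (h : WireValues gs u ws r)
    (h' : WireValues gs u ws' r') (hl : ws.length = k) (hl' : ws'.length = k) :
    GatesExtend n f.gates.length gs (opGates f ws ws' gs).1 ∧
      WireValues (opGates f ws ws' gs).1 u (opGates f ws ws' gs).2 (f.eval (r ++ r')) ∧
      (opGates f ws ws' gs).2.length = k := by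
  have hn : (ws ++ ws').length = f.numInputs := by
    rw [List.length_append, hl, hl', hf.numInputs, Nat.two_mul]
  exact ⟨gatesExtend_copy hf.wellFormed hgs (h.append h').lt hn,
    wireValues_copy hf.wellFormed (h.append h') hn, by
      rw [← hf.numOutputs]; exact length_copyOutputs _ _⟩

theorem step_spec {x : List Gate × List ℕ} {b : ℕ} {p : Bool} (hf : f.IsOp k)
    (hgs : GatesWellFormed n x.1) (h : WireValues x.1 u x.2 r) (hl : x.2.length = k)
    (hg : WireValues x.1 u gW Rg) (hgl : gW.length = k) (hb : WireValues x.1 u [b] [p]) :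
    GatesExtend n (2 * f.gates.length + 3 * k + 1) x.1 (stepGates f gW x b).1 ∧
      WireValues (stepGates f gW x b).1 u (stepGates f gW x b).2 (sqMul f Rg r p) ∧
      (stepGates f gW x b).2.length = k := by
  obtain ⟨e₁, v₁, l₁⟩ := op_spec hf hgs h h hl hl
  obtain ⟨e₂, v₂, l₂⟩ := op_spec hf e₁.wellFormed (hg.mono e₁.isPrefix) v₁ hgl l₁
  obtain ⟨e₃, v₃⟩ := mux_spec e₂.wellFormed ((hb.mono e₁.isPrefix).mono e₂.isPrefix) v₂
    (v₁.mono e₂.isPrefix) (l₂.trans l₁.symm)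
  refine ⟨?_, v₃, by simp only [stepGates, muxOutputs, length_newWires]; exact l₂⟩
  have e := (e₁.trans e₂).trans e₃
  rw [l₂] at e
  rw [show 2 * f.gates.length + 3 * k + 1 = f.gates.length + f.gates.length + (1 + k + k + k) by
    ring]
  exact e

theorem skip_spec {x : List Gate × List ℕ × ℕ} {b : ℕ} {p q : Bool} (hf : f.IsOp k)
    (hgs : GatesWellFormed n x.1) (h : WireValues x.1 u x.2.1 r) (hl : x.2.1.length = k)
    (hp : WireValues x.1 u [x.2.2] [p]) (hg : WireValues x.1 u gW Rg) (hgl : gW.length = k)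
    (hb : WireValues x.1 u [b] [q]) :
    GatesExtend n (2 * f.gates.length + 6 * k + 3) x.1 (skipGates f gW x b).1 ∧
      WireValues (skipGates f gW x b).1 u (skipGates f gW x b).2.1
        (bif p || q then sqMul f Rg r q else r) ∧
      (skipGates f gW x b).2.1.length = k ∧
      WireValues (skipGates f gW x b).1 u [(skipGates f gW x b).2.2] [p || q] := by
  have w : ∀ g ∈ [Gate.disj x.2.2 b], g.WellFormed n x.1.length := by
    intro g hg
    rw [List.mem_singleton.1 hg]
    exact ⟨hp.lt _ (by simp), hb.lt _ (by simp)⟩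
  have e₁ := gatesExtend_layer hgs _ w
  have v₁ := wireValues_layer (u := u) _ w
  have v₁' : WireValues (x.1 ++ [Gate.disj x.2.2 b]) u [x.1.length] [p || q] := by
    simpa only [newWires, List.map_cons, List.map_nil, Gate.value, hp.value, hb.value,
      List.length_singleton, List.range_one, Nat.add_zero] using v₁
  obtain ⟨e₂, v₂, l₂⟩ := step_spec (x := (x.1 ++ [Gate.disj x.2.2 b], x.2.1)) hf e₁.wellFormed
    (h.mono e₁.isPrefix) hl (hg.mono e₁.isPrefix) hgl (hb.mono e₁.isPrefix)
  obtain ⟨e₃, v₃⟩ := mux_spec e₂.wellFormed (v₁'.mono e₂.isPrefix) v₂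
    ((h.mono e₁.isPrefix).mono e₂.isPrefix) (l₂.trans hl.symm)
  refine ⟨?_, v₃, by simp only [skipGates, muxOutputs, length_newWires]; exact l₂,
    (v₁'.mono e₂.isPrefix).mono e₃.isPrefix⟩
  have e := (e₁.trans e₂).trans e₃
  rw [l₂, List.length_singleton] at e
  rw [show 2 * f.gates.length + 6 * k + 3 = 1 + (2 * f.gates.length + 3 * k + 1) +
    (1 + k + k + k) by ring]
  exact e

/-- Besides correctness it counts the added gates exactly: per bit one disjunction for the flag, a
square-and-multiply step and a selection. The size estimates rely on this count. -/
theorem foldl_skipGates {x : List Gate × List ℕ × ℕ} {p : Bool} (hf : f.IsOp k)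
    (hgs : GatesWellFormed n x.1) (h : WireValues x.1 u x.2.1 r) (hl : x.2.1.length = k)
    (hp : WireValues x.1 u [x.2.2] [p]) (hg : WireValues x.1 u gW Rg) (hgl : gW.length = k)
    {v : List Bool} (hv : WireValues x.1 u ws v) :
    GatesExtend n (ws.length * (2 * f.gates.length + 6 * k + 3)) x.1
        (ws.foldl (skipGates f gW) x).1 ∧
      WireValues (ws.foldl (skipGates f gW) x).1 u (ws.foldl (skipGates f gW) x).2.1
        (v.foldl (fun x b => (bif x.2 || b then sqMul f Rg x.1 b else x.1, x.2 || b)) (r, p)).1 ∧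
      (ws.foldl (skipGates f gW) x).2.1.length = k ∧
      (ws.foldl (skipGates f gW) x).2.2 < (ws.foldl (skipGates f gW) x).1.length := by
  induction ws generalizing x p v r with
  | nil =>
    have : v = [] := List.eq_nil_of_length_eq_zero hv.length
    subst this
    exact ⟨by simpa using GatesExtend.refl hgs, h, hl, hp.lt _ (by simp)⟩
  | cons w ws ih =>
    obtain ⟨b, v, rfl⟩ := List.exists_cons_of_length_eq_add_one hv.length
    obtain ⟨e₁, v₁, l₁, s₁⟩ := skip_spec hf hgs h hl hp hg hgl hv.head
    obtain ⟨e₂, v₂, l₂, s₂⟩ := ih e₁.wellFormed v₁ l₁ s₁ (hg.mono e₁.isPrefix)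
      (hv.tail.mono e₁.isPrefix)
    refine ⟨?_, v₂, l₂, s₂⟩
    have e := e₁.trans e₂
    rw [List.length_cons, Nat.succ_mul, Nat.add_comm]
    exact e

theorem newWires_lt {m k l : ℕ} (h : m + k ≤ l) : ∀ w ∈ newWires m k, w < l := by
  intro w hw
  simp only [newWires, List.mem_map, List.mem_range] at hw
  omega

/-- The check is a guard. A polynomial-time fold needs a size bound on all arguments, also on
malformed ones, for which copying circuits repeatedly could get out of hand; there the guarded fold
runs over the empty list. -/
theorem checkGates_iff {x : List Gate × List ℕ} : checkGates f k x = true ↔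
    f.IsOp k ∧ GatesWellFormed (k + 1) x.1 ∧ (∀ w ∈ x.2, w < x.1.length) ∧ x.2.length = k ∧
      4 * k + 2 ≤ x.1.length := by
  simp only [checkGates, Bool.and_eq_true, Circuit.check_iff, beq_iff_eq, Bool.not_eq_true',
    decide_eq_false_iff_not, not_lt]
  exact ⟨fun ⟨⟨⟨⟨⟨h₁, h₂⟩, h₃⟩, h₄⟩, h₅⟩, h₆⟩ => ⟨⟨h₁, h₂, h₃⟩, h₄.1, h₄.2, h₅, h₆⟩,
    fun ⟨⟨h₁, h₂, h₃⟩, h₄, h₅, h₆, h₇⟩ => ⟨⟨⟨⟨⟨h₁, h₂⟩, h₃⟩, h₄, h₅⟩, h₆⟩, h₇⟩⟩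

theorem index_spec {x : List Gate × List ℕ} {Ri : List Bool} (hk : 1 ≤ k) (hf : f.IsOp k)
    (hgs : GatesWellFormed (k + 1) x.1) (h : WireValues x.1 u x.2 r) (hl : x.2.length = k)
    (hi : WireValues x.1 u (newWires (k + 1) k) Ri)
    (hg : WireValues x.1 u (newWires (2 * k + 1) k) Rg)
    (hz : WireValues x.1 u [4 * k + 1] [false]) :
    GatesExtend (k + 1) ((k - 1) * (2 * f.gates.length + 6 * k + 3) +
        (2 * f.gates.length + 3 * k + 1)) x.1 (indexGates f k x).1 ∧
      WireValues (indexGates f k x).1 u (indexGates f k x).2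
        ((bd₀ (bc r)).foldl (sqMul f Rg) Ri) ∧
      (indexGates f k x).2.length = k := by
  obtain ⟨gs, ws⟩ := x
  dsimp only at *
  -- That position 4k + 1 exists gives the 4k + 2 gates demanded by the guard.
  have hc : checkGates f k (gs, ws) = true :=
    checkGates_iff.2 ⟨hf, hgs, h.lt, hl, hz.lt _ (by simp)⟩
  obtain ⟨m, rfl⟩ := Nat.exists_eq_add_of_le' hk
  have hr := h.length.trans hl
  obtain ⟨b, rv, hrv⟩ := List.exists_cons_of_length_eq_add_one
    (show r.reverse.length = m + 1 by rw [List.length_reverse, hr])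
  obtain ⟨w, wv, hwv⟩ := List.exists_cons_of_length_eq_add_one
    (show ws.reverse.length = m + 1 by rw [List.length_reverse, hl])
  obtain rfl : r = rv.reverse ++ [b] := by rw [← List.reverse_reverse r, hrv, List.reverse_cons]
  obtain rfl : ws = wv.reverse ++ [w] := by rw [← List.reverse_reverse ws, hwv, List.reverse_cons]
  generalize rv.reverse = v at *
  generalize wv.reverse = ws at *
  have hv : v.length = m := by simpa using hr
  have hw : ws.length = m := by simpa using hl
  obtain ⟨h₁, h₂⟩ := h.of_append (hv.trans hw.symm)
  obtain ⟨e₁, v₁, l₁, -⟩ := foldl_skipGates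
    (x := (gs, newWires (m + 1 + 1) (m + 1), 4 * (m + 1) + 1)) hf hgs hi (length_newWires _ _) hz hg
    (length_newWires _ _) h₁
  obtain ⟨e₂, v₂, l₂⟩ := step_spec (x := ((ws.foldl (skipGates f (newWires (2 * (m + 1) + 1) (m + 1)))
    (gs, newWires (m + 1 + 1) (m + 1), 4 * (m + 1) + 1)).1, _)) hf e₁.wellFormed v₁ l₁
    (hg.mono e₁.isPrefix) (length_newWires _ _) (h₂.mono e₁.isPrefix)
  have ht : (ws ++ [w]).take m = ws := by rw [← hw, List.take_left]
  have hd : (ws ++ [w]).getD m 0 = w := by rw [← hw]; simp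
  rw [hw] at e₁
  rw [foldl_bd₀_concat]
  simp only [indexGates, hc, cond_true, Nat.add_sub_cancel, ht, hd]
  exact ⟨e₁.trans e₂, v₂, l₂⟩

theorem chainStep_spec {x : List Gate × List ℕ} {Ri Rt : List Bool} {b : ℕ} {p : Bool} (hk : 1 ≤ k)
    (hf : f.IsOp k) (hgs : GatesWellFormed (k + 1) x.1) (h : WireValues x.1 u x.2 r)
    (hl : x.2.length = k) (hi : WireValues x.1 u (newWires (k + 1) k) Ri)
    (hg : WireValues x.1 u (newWires (2 * k + 1) k) Rg)
    (ht : WireValues x.1 u (newWires (3 * k + 1) k) Rt)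
    (hz : WireValues x.1 u [4 * k + 1] [false]) (hb : WireValues x.1 u [b] [p]) :
    GatesExtend (k + 1) ((k - 1) * (2 * f.gates.length + 6 * k + 3) +
        (2 * f.gates.length + 3 * k + 1) + f.gates.length + (1 + k + k + k)) x.1
        (chainStepGates f k x b).1 ∧
      WireValues (chainStepGates f k x b).1 u (chainStepGates f k x b).2
        (bif p then f.eval (Rt ++ (bd₀ (bc r)).foldl (sqMul f Rg) Ri)
          else (bd₀ (bc r)).foldl (sqMul f Rg) Ri) ∧
      (chainStepGates f k x b).2.length = k := by
  obtain ⟨e₁, v₁, l₁⟩ := index_spec hk hf hgs h hl hi hg hz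
  obtain ⟨e₂, v₂, l₂⟩ := op_spec hf e₁.wellFormed (ht.mono e₁.isPrefix) v₁ (length_newWires _ _) l₁
  obtain ⟨e₃, v₃⟩ := mux_spec e₂.wellFormed ((hb.mono e₁.isPrefix).mono e₂.isPrefix) v₂
    (v₁.mono e₂.isPrefix) (l₂.trans l₁.symm)
  refine ⟨?_, v₃, by simp only [chainStepGates, muxOutputs, length_newWires]; exact l₂⟩
  have e := (e₁.trans e₂).trans e₃
  rw [l₂] at e
  exact e

theorem foldl_chainStepGates {x : List Gate × List ℕ} {Ri Rt v : List Bool} (hk : 1 ≤ k)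
    (hf : f.IsOp k) (hgs : GatesWellFormed (k + 1) x.1) (h : WireValues x.1 u x.2 r)
    (hl : x.2.length = k) (hi : WireValues x.1 u (newWires (k + 1) k) Ri)
    (hg : WireValues x.1 u (newWires (2 * k + 1) k) Rg)
    (ht : WireValues x.1 u (newWires (3 * k + 1) k) Rt)
    (hz : WireValues x.1 u [4 * k + 1] [false]) (hv : WireValues x.1 u ws v) :
    GatesExtend (k + 1) (ws.length * ((k - 1) * (2 * f.gates.length + 6 * k + 3) +
        (2 * f.gates.length + 3 * k + 1) + f.gates.length + (1 + k + k + k))) x.1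
        (ws.foldl (chainStepGates f k) x).1 ∧
      WireValues (ws.foldl (chainStepGates f k) x).1 u (ws.foldl (chainStepGates f k) x).2
        (v.foldl (fun r b => bif b then f.eval (Rt ++ (bd₀ (bc r)).foldl (sqMul f Rg) Ri)
          else (bd₀ (bc r)).foldl (sqMul f Rg) Ri) r) ∧
      (ws.foldl (chainStepGates f k) x).2.length = k := by
  induction ws generalizing x v r with
  | nil =>
    have : v = [] := List.eq_nil_of_length_eq_zero hv.length
    subst this
    exact ⟨by simpa using GatesExtend.refl hgs, h, hl⟩
  | cons w ws ih =>
    obtain ⟨b, v, rfl⟩ := List.exists_cons_of_length_eq_add_one hv.length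
    obtain ⟨e₁, v₁, l₁⟩ := chainStep_spec hk hf hgs h hl hi hg ht hz hv.head
    obtain ⟨e₂, v₂, l₂⟩ := ih e₁.wellFormed v₁ l₁ (hi.mono e₁.isPrefix) (hg.mono e₁.isPrefix)
      (ht.mono e₁.isPrefix) (hz.mono e₁.isPrefix) (hv.tail.mono e₁.isPrefix)
    refine ⟨?_, v₂, l₂⟩
    have e := e₁.trans e₂
    rw [List.length_cons, Nat.succ_mul, Nat.add_comm (ws.length * _)]
    exact e

theorem newWires_add (m k l : ℕ) : newWires m (k + l) = newWires m k ++ newWires (m + k) l := by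
  simp [newWires, List.range_add, Function.comp_def, Nat.add_assoc]

end

/-! ### The circuit for the chain of an instance -/

namespace DLogInstance

/-- The input variables and the constants `id`, `g`, `t` and `0`. -/
def baseGates (G : DLogInstance) : List Gate :=
  (List.range (G.len + 1)).map Gate.input ++ (bd G.len G.id).map Gate.const ++
    (bd G.len G.g).map Gate.const ++ (bd G.len G.t).map Gate.const ++ [Gate.const false]

theorem length_baseGates (G : DLogInstance) : G.baseGates.length = 4 * G.len + 2 := by
  simp [baseGates]; omega

/-- None of these gates refers to another one, so they form one layer over no gates at all. Their
order explains the positions used throughout, with k = ℓ: inputs from 0, id from k + 1, g from 2k +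
1, t from 3k + 1, and the constant 0 at 4k + 1. -/
theorem baseGates_spec (G : DLogInstance) {u : List Bool} (hu : u.length = G.len + 1) :
    GatesWellFormed (G.len + 1) G.baseGates ∧
      WireValues G.baseGates u (newWires 0 (G.len + 1)) u ∧
      WireValues G.baseGates u (newWires (G.len + 1) G.len) (bd G.len G.id) ∧
      WireValues G.baseGates u (newWires (2 * G.len + 1) G.len) (bd G.len G.g) ∧
      WireValues G.baseGates u (newWires (3 * G.len + 1) G.len) (bd G.len G.t) ∧
      WireValues G.baseGates u [4 * G.len + 1] [false] := by
  have w : ∀ g ∈ G.baseGates, g.WellFormed (G.len + 1) ([] : List Gate).length := by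
    intro g hg
    simp only [baseGates, List.mem_append, List.mem_map, List.mem_range, List.mem_singleton] at hg
    rcases hg with (((⟨i, hi, rfl⟩ | ⟨b, _, rfl⟩) | ⟨b, _, rfl⟩) | ⟨b, _, rfl⟩) | rfl
    · exact hi
    all_goals trivial
  have e := gatesExtend_layer (gs := []) (fun k g hk => by simp at hk) _ w
  have v := wireValues_layer (u := u) _ w
  have hv : G.baseGates.map (fun g => g.value u (gateValues [] u)) =
      u ++ (bd G.len G.id ++ (bd G.len G.g ++ (bd G.len G.t ++ [false]))) := by
    simp only [baseGates, List.map_append, List.map_map, List.append_assoc]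
    refine congrArg₂ _ ?_ ?_
    · exact map_range_getD _ u hu
    · simp [Function.comp_def, Gate.value]
  rw [hv, length_baseGates, List.length_nil, List.nil_append, show 4 * G.len + 2 =
    (G.len + 1) + (G.len + (G.len + (G.len + 1))) by ring, newWires_add 0 (G.len + 1),
    newWires_add (0 + (G.len + 1)) G.len, newWires_add (0 + (G.len + 1) + G.len) G.len,
    newWires_add (0 + (G.len + 1) + G.len + G.len) G.len] at v
  obtain ⟨v₁, v⟩ := v.of_append (by rw [length_newWires, hu])
  obtain ⟨v₂, v⟩ := v.of_append (by rw [length_newWires, length_bd])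
  obtain ⟨v₃, v⟩ := v.of_append (by rw [length_newWires, length_bd])
  obtain ⟨v₄, v⟩ := v.of_append (by rw [length_newWires, length_bd])
  refine ⟨e.wellFormed, v₁, by simpa using v₂, ?_, ?_, ?_⟩
  · convert v₃ using 2; ring
  · convert v₄ using 2; ring
  · convert v using 1; simp [newWires]; ring

/-- A step of the chain: the function `x ↦ I(x)` or `x ↦ f(t, I(x))` on strings, depending on the
bit. -/
def chainStepBits (G : DLogInstance) (r : List Bool) (b : Bool) : List Bool :=
  bif b then G.opBits (bd G.len G.t) (G.powBits (bd₀ (bc r))) else G.powBits (bd₀ (bc r))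

def chainBits (G : DLogInstance) (u : List Bool) : List Bool :=
  u.foldl G.chainStepBits (bd G.len G.id)

/-- The gates and outputs of a circuit for the chain. -/
def chainGates (G : DLogInstance) : List Gate × List ℕ :=
  (bif G.check then newWires 0 (G.len + 1) else []).foldl (chainStepGates G.f G.len)
    (G.baseGates, newWires (G.len + 1) G.len)

def chainCircuit (G : DLogInstance) : Circuit :=
  ⟨G.len + 1, G.chainGates.1, G.chainGates.2⟩

theorem Valid.isOp {G : DLogInstance} (hG : G.Valid) : G.f.IsOp G.len :=
  ⟨hG.2.1, hG.2.2.1, hG.2.2.2.1⟩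

theorem Valid.one_le_len {G : DLogInstance} (hG : G.Valid) : 1 ≤ G.len :=
  Nat.clog_pos (by norm_num) hG.1

theorem powBits_eq (G : DLogInstance) (u : List Bool) :
    G.powBits u = u.foldl (sqMul G.f (bd G.len G.g)) (bd G.len G.id) := by
  unfold powBits
  congr 1
  funext r b
  cases b <;> rfl

theorem Valid.chainGates_spec {G : DLogInstance} (hG : G.Valid) {u : List Bool}
    (hu : u.length = G.len + 1) :
    GatesWellFormed (G.len + 1) G.chainGates.1 ∧
      WireValues G.chainGates.1 u G.chainGates.2 (G.chainBits u) ∧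
      G.chainGates.2.length = G.len := by
  obtain ⟨h, hv, hi, hg, ht, hz⟩ := G.baseGates_spec hu
  obtain ⟨e, v, l⟩ := foldl_chainStepGates (x := (G.baseGates, newWires (G.len + 1) G.len))
    hG.one_le_len hG.isOp h hi (length_newWires _ _) hi hg ht hz hv
  simp only [← powBits_eq] at v
  rw [chainGates, G.check_iff.2 hG, cond_true]
  exact ⟨e.wellFormed, v, l⟩

theorem Valid.chainCircuit_wellFormed {G : DLogInstance} (hG : G.Valid) :
    G.chainCircuit.WellFormed := by
  obtain ⟨h, h', -⟩ := hG.chainGates_spec (u := List.replicate (G.len + 1) false) (by simp)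
  exact ⟨h, h'.lt⟩

theorem Valid.numOutputs_chainCircuit {G : DLogInstance} (hG : G.Valid) :
    G.chainCircuit.numOutputs = G.len :=
  (hG.chainGates_spec (u := List.replicate (G.len + 1) false) (by simp)).2.2

theorem Valid.eval_chainCircuit {G : DLogInstance} (hG : G.Valid) {u : List Bool}
    (hu : u.length = G.len + 1) : G.chainCircuit.eval u = G.chainBits u :=
  (hG.chainGates_spec hu).2.1.map

end DLogInstance

/-! ### The size of the circuit -/

theorem tsize_state_le {n L : ℕ} {gs : List Gate} {ws : List ℕ} (h : GatesWellFormed n gs)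
    (hw : ∀ w ∈ ws, w < gs.length) (hn : n ≤ L) (hgs : gs.length ≤ L) (hws : ws.length ≤ L) :
    tsize (gs, ws) ≤ 10 * L ^ 2 + 30 * L + 10 := by
  rw [tsize_mk]
  have h₁ : tsize gs ≤ L * (4 * (L + L) + 21) + 1 := h.tsize_le.trans (by gcongr)
  have h₂ : tsize ws ≤ L * (2 * L + 2) + 1 := (tsize_wires_le hw).trans (by gcongr)
  nlinarith

theorem tsize_circuit (C : Circuit) : tsize C = tsize (C.numInputs, C.gates, C.outputs) := rfl

section

variable {γ : Type} [TreeEnc γ]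

@[fun_prop]
theorem PTF.opGates {f : γ → Circuit} {a b : γ → List ℕ} {gs : γ → List Gate} (hf : PTF f)
    (ha : PTF a) (hb : PTF b) (hgs : PTF gs) : PTF fun c => opGates (f c) (a c) (b c) (gs c) := by
  unfold TotalSearch.opGates
  fun_prop

@[fun_prop]
theorem PTF.stepGates {f : γ → Circuit} {gW : γ → List ℕ} {x : γ → List Gate × List ℕ} {b : γ → ℕ}
    (hf : PTF f) (hg : PTF gW) (hx : PTF x) (hb : PTF b) :
    PTF fun c => stepGates (f c) (gW c) (x c) (b c) := by
  have hy := hf.opGates hx.snd hx.snd hx.fst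
  have hz := hf.opGates hg hy.snd hy.fst
  exact (hb.muxGates hz.snd hy.snd hz.fst).prodMk (hz.fst.length.muxOutputs hz.snd.length)

@[fun_prop]
theorem PTF.skipGates {f : γ → Circuit} {gW : γ → List ℕ} {x : γ → List Gate × List ℕ × ℕ}
    {b : γ → ℕ} (hf : PTF f) (hg : PTF gW) (hx : PTF x) (hb : PTF b) :
    PTF fun c => skipGates (f c) (gW c) (x c) (b c) := by
  have hy := hf.stepGates hg (x := fun c => ((x c).1 ++ [Gate.disj (x c).2.2 (b c)], (x c).2.1))
    (by fun_prop) hb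
  exact (hx.fst.length.muxGates hy.snd hx.snd.fst hy.fst).prodMk
    ((hy.fst.length.muxOutputs hy.snd.length).prodMk hx.fst.length)

@[fun_prop]
theorem PTF.checkGates {f : γ → Circuit} {k : γ → ℕ} {x : γ → List Gate × List ℕ}
    (hf : PTF f) (hk : PTF k) (hx : PTF x) : PTF fun c => checkGates (f c) (k c) (x c) := by
  unfold TotalSearch.checkGates
  fun_prop

@[fun_prop]
theorem PTF.indexGates {f : γ → Circuit} {k : γ → ℕ} {x : γ → List Gate × List ℕ}
    (hf : PTF f) (hk : PTF k) (hx : PTF x) : PTF fun c => indexGates (f c) (k c) (x c) := by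
  obtain ⟨qf, hqf⟩ := hf.size
  obtain ⟨qx, hqx⟩ := hx.size
  obtain ⟨qk, hqk⟩ := hk.size
  -- Bounds the number of gates: those given, plus the cost per bit for at most k bits. The summands
  -- `qk + 2` ensure that L also exceeds the number k + 1 of inputs.
  let L : Polynomial ℕ := qx + qk + 2 + qk * (2 * qf + 6 * qk + 3)
  have hy : PTF fun c => (bif TotalSearch.checkGates (f c) (k c) (x c) then
      (x c).2.take (k c - 1) else []).foldl
      (TotalSearch.skipGates (f c) (TotalSearch.newWires (2 * k c + 1) (k c)))
      ((x c).1, TotalSearch.newWires (k c + 1) (k c), 4 * k c + 1) := by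
    refine PTF.foldl (by fun_prop) (by fun_prop) (by fun_prop)
      -- The terms in L come from `tsize_state_le` and the position of the flag; the bracket covers
      -- the initial state, which is all there is if the guard fails.
      ⟨10 * L ^ 2 + 34 * L + 20 + (qx + 2 * qk * (4 * qk + 10) + 10 * qk + 20),
        fun c l₁ l₂ hl => ?_⟩
    have h₁ := hqx c
    have h₂ := hqf c
    have h₃ := hqk c
    rw [tsize_pair] at h₁
    rw [tsize_circuit, tsize_mk, tsize_mk] at h₂
    rw [tsize_nat] at h₃
    have h₄ := length_lt_tsize (x c).1
    have h₅ := length_lt_tsize (f c).gates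
    cases hc : TotalSearch.checkGates (f c) (k c) (x c) with
    | false =>
      rw [hc, cond_false] at hl
      obtain ⟨rfl, -⟩ := List.append_eq_nil_iff.1 hl.symm
      have h₆ := tsize_wires_le (newWires_lt (le_refl (k c + 1 + k c)))
      rw [length_newWires] at h₆
      have h₇ : k c * (2 * (k c + 1 + k c) + 2) ≤
          2 * qk.eval (tsize c) * (4 * qk.eval (tsize c) + 10) := by
        apply Nat.mul_le_mul <;> omega
      rw [List.foldl_nil, tsize_mk, tsize_mk, tsize_nat]
      simp only [Polynomial.eval_add, Polynomial.eval_mul, Polynomial.eval_ofNat]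
      omega
    | true =>
      rw [hc, cond_true] at hl
      obtain ⟨hop, hgs, hw, hlen, hle⟩ := checkGates_iff.1 hc
      have hw₁ : ∀ w ∈ l₁, w < (x c).1.length := fun w hw' =>
        hw w (List.mem_of_mem_take (i := k c - 1) (by rw [hl]; exact List.mem_append_left _ hw'))
      -- Only the count of gates and their well-formedness matter here, so the input string is
      -- arbitrary and the wires carry whatever values they happen to have.
      obtain ⟨e, v, l, s⟩ := foldl_skipGates (u := [])
        (x := ((x c).1, TotalSearch.newWires (k c + 1) (k c), 4 * k c + 1)) hop hgs
        (WireValues.of_lt (newWires_lt (show _ ≤ (x c).1.length by omega))) (length_newWires _ _)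
        (WireValues.of_lt (by simp; omega)) (WireValues.of_lt (ws := TotalSearch.newWires
          (2 * k c + 1) (k c)) (newWires_lt (show _ ≤ (x c).1.length by omega))) (length_newWires _ _)
        (WireValues.of_lt hw₁)
      have hl₁ : l₁.length ≤ k c := by
        have := congrArg List.length hl
        rw [List.length_take, List.length_append] at this
        omega
      generalize l₁.foldl _ _ = y at *
      have hL : y.1.length ≤ L.eval (tsize c) := by
        rw [e.length]
        have : l₁.length * (2 * (f c).gates.length + 6 * k c + 3) ≤ qk.eval (tsize c) *
          (2 * qf.eval (tsize c) + 6 * qk.eval (tsize c) + 3) := by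
          apply Nat.mul_le_mul <;> omega
        simp only [L, Polynomial.eval_add, Polynomial.eval_mul, Polynomial.eval_ofNat]
        omega
      have hL' : k c + 1 ≤ L.eval (tsize c) := by
        simp only [L, Polynomial.eval_add, Polynomial.eval_mul, Polynomial.eval_ofNat]
        omega
      have h := tsize_state_le e.wellFormed v.lt hL' hL (by omega)
      rw [tsize_mk] at h
      rw [tsize_pair, tsize_pair y.2, tsize_nat]
      simp only [Polynomial.eval_add, Polynomial.eval_mul, Polynomial.eval_ofNat,
        Polynomial.eval_pow]
      omega
  exact hf.stepGates (by fun_prop) (hy.fst.prodMk hy.snd.fst) (by fun_prop)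

@[fun_prop]
theorem PTF.chainStepGates {f : γ → Circuit} {k b : γ → ℕ} {x : γ → List Gate × List ℕ}
    (hf : PTF f) (hk : PTF k) (hx : PTF x) (hb : PTF b) :
    PTF fun c => chainStepGates (f c) (k c) (x c) (b c) := by
  have hy := hf.indexGates hk hx
  have hz := hf.opGates (a := fun c => TotalSearch.newWires (3 * k c + 1) (k c)) (by fun_prop)
    hy.snd hy.fst
  exact (hb.muxGates hz.snd hy.snd hz.fst).prodMk (hz.fst.length.muxOutputs hz.snd.length)

theorem PTF.baseGates {G : γ → DLogInstance} (hG : PTF G) : PTF fun c => (G c).baseGates := by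
  have h : ∀ {u : γ → List Bool}, PTF u → PTF fun c => (u c).map Gate.const := fun hu =>
    hu.map (by fun_prop)
  have h₀ : PTF fun c => (List.range ((G c).len + 1)).map Gate.input :=
    PTF.map (by fun_prop) (by fun_prop)
  have h₁ := h (hG.dlogLen.bd hG.dlogId)
  have h₂ := h (hG.dlogLen.bd hG.dlogG)
  have h₃ := h (hG.dlogLen.bd hG.dlogT)
  exact (((h₀.append h₁).append h₂).append h₃).append (PTF.const _)

theorem PTF.chainGates {G : γ → DLogInstance} (hG : PTF G) : PTF fun c => (G c).chainGates := by
  have hb := hG.baseGates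
  obtain ⟨qf, hqf⟩ := hG.dlogF.size
  obtain ⟨qb, hqb⟩ := hb.size
  obtain ⟨qk, hqk⟩ := hG.dlogLen.size
  -- K bounds the gates added by one step of the chain; L adds up the 4ℓ + 2 base gates and at most
  -- ℓ + 1 steps.
  let K : Polynomial ℕ := qk * (2 * qf + 6 * qk + 3) + (2 * qf + 3 * qk + 1) + qf +
    (1 + qk + qk + qk)
  let L : Polynomial ℕ := 4 * qk + 2 + (qk + 1) * K
  refine PTF.foldl (by fun_prop) (by fun_prop) (by fun_prop)
    ⟨10 * L ^ 2 + 34 * L + 20 + (qb + 2 * qk * (4 * qk + 10) + 10 * qk + 20),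
      fun c l₁ l₂ hl => ?_⟩
  have h₁ := hqb c
  have h₂ := hqf c
  have h₃ := hqk c
  rw [tsize_circuit, tsize_mk, tsize_mk] at h₂
  rw [tsize_nat] at h₃
  have h₅ := length_lt_tsize (G c).f.gates
  cases hc : (G c).check with
  | false =>
    rw [hc, cond_false] at hl
    obtain ⟨rfl, -⟩ := List.append_eq_nil_iff.1 hl.symm
    have h₆ := tsize_wires_le (newWires_lt (le_refl ((G c).len + 1 + (G c).len)))
    rw [length_newWires] at h₆
    have h₇ : (G c).len * (2 * ((G c).len + 1 + (G c).len) + 2) ≤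
        2 * qk.eval (tsize c) * (4 * qk.eval (tsize c) + 10) := by
      apply Nat.mul_le_mul <;> omega
    rw [List.foldl_nil, tsize_mk]
    simp only [Polynomial.eval_add, Polynomial.eval_mul, Polynomial.eval_ofNat]
    omega
  | true =>
    rw [hc, cond_true] at hl
    have hG := (DLogInstance.check_iff _).1 hc
    obtain ⟨h, hv, hi, hg, ht, hz⟩ := (G c).baseGates_spec
      (u := List.replicate ((G c).len + 1) false) (by simp)
    have hw₁ : ∀ w ∈ l₁, w < (G c).baseGates.length := fun w hw' =>
      hv.lt w (by rw [hl]; exact List.mem_append_left _ hw')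
    obtain ⟨e, v, l⟩ := foldl_chainStepGates
      (x := ((G c).baseGates, TotalSearch.newWires ((G c).len + 1) (G c).len))
      hG.one_le_len hG.isOp h hi (length_newWires _ _) hi hg ht hz (WireValues.of_lt hw₁)
    have hl₁ : l₁.length ≤ (G c).len + 1 := by
      have := congrArg List.length hl
      rw [length_newWires, List.length_append] at this
      omega
    generalize l₁.foldl _ _ = y at *
    have hL : y.1.length ≤ L.eval (tsize c) := by
      rw [e.length, DLogInstance.length_baseGates]
      have h₆ : ((G c).len - 1) * (2 * (G c).f.gates.length + 6 * (G c).len + 3) ≤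
          qk.eval (tsize c) * (2 * qf.eval (tsize c) + 6 * qk.eval (tsize c) + 3) := by
        apply Nat.mul_le_mul <;> omega
      have h₇ : ((G c).len - 1) * (2 * (G c).f.gates.length + 6 * (G c).len + 3) +
          (2 * (G c).f.gates.length + 3 * (G c).len + 1) + (G c).f.gates.length +
          (1 + (G c).len + (G c).len + (G c).len) ≤ K.eval (tsize c) := by
        simp only [K, Polynomial.eval_add, Polynomial.eval_mul, Polynomial.eval_ofNat,
          Polynomial.eval_one]
        omega
      have h₈ := Nat.mul_le_mul (show l₁.length ≤ qk.eval (tsize c) + 1 by omega) h₇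
      simp only [L, Polynomial.eval_add, Polynomial.eval_mul, Polynomial.eval_ofNat,
        Polynomial.eval_one]
      omega
    have hL' : (G c).len + 1 ≤ L.eval (tsize c) := by
      simp only [L, Polynomial.eval_add, Polynomial.eval_mul, Polynomial.eval_ofNat]
      omega
    have h : tsize y ≤ _ := tsize_state_le e.wellFormed v.lt hL' hL (by omega)
    simp only [Polynomial.eval_add, Polynomial.eval_mul, Polynomial.eval_ofNat,
      Polynomial.eval_pow]
    omega

theorem PTF.chainCircuit {G : γ → DLogInstance} (hG : PTF G) : PTF fun c => (G c).chainCircuit := by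
  have h := hG.chainGates
  unfold DLogInstance.chainCircuit
  fun_prop

end

open TreeEnc

/-! ### The reduction of DLog to Collision -/

namespace DLogInstance

/-- The chain of the functions `x ↦ I(x)` and `x ↦ f(t, I(x))` chosen by the bits of `u`. -/
def chain (G : DLogInstance) (u : List Bool) : ℕ :=
  u.foldl (fun r b => if b then G.op G.t (G.index r) else G.index r) G.id

theorem chain_concat (G : DLogInstance) (u : List Bool) (b : Bool) : G.chain (u ++ [b]) =
    if b then G.op G.t (G.index (G.chain u)) else G.index (G.chain u) := by
  simp [chain]

theorem chainBits_concat (G : DLogInstance) (u : List Bool) (b : Bool) :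
    G.chainBits (u ++ [b]) = G.chainStepBits (G.chainBits u) b := by
  simp [chainBits]

theorem Valid.bc_chainBits {G : DLogInstance} (hG : G.Valid) (u : List Bool) :
    bc (G.chainBits u) = G.chain u := by
  induction u using List.reverseRecOn with
  | nil => exact bc_bd (G.lt_two_pow_len hG.2.2.2.2.1)
  | append_singleton u b ih =>
    have h : bc (G.powBits (bd₀ (bc (G.chainBits u)))) = G.index (G.chain u) := by rw [ih]; rfl
    rw [chainBits_concat, chain_concat, chainStepBits]
    cases b with
    | false => exact h
    | true =>
      rw [cond_true, bc_opBits (length_bd _ _) (hG.length_powBits _), h,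
        bc_bd (G.lt_two_pow_len hG.2.2.2.2.2.2)]
      rfl

/-- The values that occur in the computation of the chain. -/
def trace (G : DLogInstance) (u : List Bool) : List (List Bool) :=
  [bd G.len G.id, bd G.len G.g, bd G.len G.t] ++ (List.range (u.length + 1)).flatMap fun i =>
    G.chainBits (u.take i) ::
      (List.range ((bd₀ (bc (G.chainBits (u.take i)))).length + 1)).flatMap fun j =>
        [G.powBits ((bd₀ (bc (G.chainBits (u.take i)))).take j),
          G.opBits (G.powBits ((bd₀ (bc (G.chainBits (u.take i)))).take j))
            (G.powBits ((bd₀ (bc (G.chainBits (u.take i)))).take j))]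

section

variable {G : DLogInstance} {u w e : List Bool}

theorem Valid.chain_mem_trace (hG : G.Valid) (hw : w <+: u) : ∃ a ∈ G.trace u, bc a = G.chain w := by
  refine ⟨_, ?_, hG.bc_chainBits w⟩
  have h : w = u.take w.length := List.prefix_iff_eq_take.1 hw
  refine List.mem_append_right _ (List.mem_flatMap.2 ⟨w.length, ?_, ?_⟩)
  · rw [List.mem_range]
    exact Nat.lt_succ_of_le hw.length_le
  · rw [← h]
    exact List.mem_cons_self

/-- The squares are recorded besides the powers, because multiplication by g takes a square as its
second argument. -/
theorem Valid.pow_mem_trace (hG : G.Valid) (hw : w <+: u) (he : e <+: bd₀ (G.chain w)) :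
    (∃ a ∈ G.trace u, bc a = G.pow e) ∧ ∃ a ∈ G.trace u, bc a = G.op (G.pow e) (G.pow e) := by
  have h : w = u.take w.length := List.prefix_iff_eq_take.1 hw
  have h' : e = (bd₀ (G.chain w)).take e.length := List.prefix_iff_eq_take.1 he
  have key : ∀ a ∈ [G.powBits e, G.opBits (G.powBits e) (G.powBits e)], a ∈ G.trace u := by
    intro a ha
    refine List.mem_append_right _ (List.mem_flatMap.2 ⟨w.length, ?_, ?_⟩)
    · rw [List.mem_range]
      exact Nat.lt_succ_of_le hw.length_le
    · rw [← h, hG.bc_chainBits]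
      refine List.mem_cons_of_mem _ (List.mem_flatMap.2 ⟨e.length, ?_, ?_⟩)
      · rw [List.mem_range]
        exact Nat.lt_succ_of_le he.length_le
      · rwa [← h']
  refine ⟨⟨_, key _ List.mem_cons_self, hG.bc_powBits e⟩, _,
    key _ (List.mem_cons_of_mem _ List.mem_cons_self), ?_⟩
  rw [bc_opBits (hG.length_powBits e) (hG.length_powBits e), hG.bc_powBits]

/-- Every application of the operation in the computation has both arguments in the trace. So if the
trace shows no violation of closure, induction keeps all values in [s]: along the digits of an
exponent inside, along the bits of `w` outside. -/
theorem Valid.chain_lt (hG : G.Valid) (h : ∀ a ∈ G.trace u, ∀ b ∈ G.trace u, bc a < G.s →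
    bc b < G.s → G.op (bc a) (bc b) < G.s) (hw : w <+: u) :
    G.chain w < G.s ∧ G.index (G.chain w) < G.s := by
  have hG' := hG
  obtain ⟨_, _, _, _, hi, hg, ht⟩ := hG'
  have bg : bc (bd G.len G.g) = G.g := bc_bd (G.lt_two_pow_len hg)
  have bt : bc (bd G.len G.t) = G.t := bc_bd (G.lt_two_pow_len ht)
  have key : ∀ w, w <+: u → G.chain w < G.s → G.index (G.chain w) < G.s := by
    intro w hw hlt
    have hp : ∀ e, e <+: bd₀ (G.chain w) → G.pow e < G.s := by
      intro e
      induction e using List.reverseRecOn with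
      | nil => exact fun _ => hi
      | append_singleton e b ih =>
        intro he
        have he' : e <+: bd₀ (G.chain w) := (List.prefix_append e [b]).trans he
        obtain ⟨⟨a, ha, ha'⟩, a₂, ha₂, ha₂'⟩ := hG.pow_mem_trace hw he'
        have h₁ := h a ha a ha (by rw [ha']; exact ih he') (by rw [ha']; exact ih he')
        rw [ha'] at h₁
        rw [pow_concat]
        split_ifs
        · have h₂ := h (bd G.len G.g) (by simp [trace]) a₂ ha₂ (by rwa [bg]) (by rwa [ha₂'])
          rwa [bg, ha₂'] at h₂
        · exact h₁
    rw [hG.index_eq]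
    exact hp _ (List.prefix_refl _)
  suffices h' : G.chain w < G.s from ⟨h', key w hw h'⟩
  induction w using List.reverseRecOn with
  | nil => exact hi
  | append_singleton w b ih =>
    have hw' : w <+: u := (List.prefix_append w [b]).trans hw
    have h₁ := key w hw' (ih hw')
    rw [chain_concat]
    split_ifs
    · obtain ⟨⟨a, ha, ha'⟩, -⟩ := hG.pow_mem_trace hw' (List.prefix_refl _)
      rw [← hG.index_eq] at ha'
      have h₂ := h (bd G.len G.t) (by simp [trace]) a ha (by rwa [bt]) (by rwa [ha'])
      rwa [bt, ha'] at h₂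
    · exact h₁

end

/-- Go back from the common end. If value and bit agree at a position, the preceding values agree
and the shorter strings still differ. Because of the equal lengths both walks would reach the start
together, with nothing left to differ; so the disagreement occurs before that. -/
theorem exists_chain_collision (G : DLogInstance) {u v : List Bool} (hl : u.length = v.length)
    (hne : u ≠ v) (h : G.chain u = G.chain v) : ∃ w w' b b', w <+: u ∧ w' <+: v ∧
      (G.chain w ≠ G.chain w' ∨ b ≠ b') ∧ G.chain (w ++ [b]) = G.chain (w' ++ [b']) := by
  induction u using List.reverseRecOn generalizing v with
  | nil => exact absurd (List.eq_nil_of_length_eq_zero hl.symm).symm hne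
  | append_singleton u b ih =>
    cases v using List.reverseRecOn with
    | nil => simp at hl
    | append_singleton v b' =>
      by_cases h' : G.chain u ≠ G.chain v ∨ b ≠ b'
      · exact ⟨u, v, b, b', List.prefix_append _ _, List.prefix_append _ _, h', h⟩
      · simp only [ne_eq, not_or, not_not] at h'
        obtain ⟨h₁, rfl⟩ := h'
        obtain ⟨w, w', c, c', hw, hw', hn, hc⟩ := ih (by simpa using hl)
          (fun huv => hne (by rw [huv])) h₁
        exact ⟨w, w', c, c', hw.trans (List.prefix_append _ _), hw'.trans (List.prefix_append _ _),
          hn, hc⟩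

/-- A solution of the instance arises from a collision of the chain. -/
theorem Valid.exists_isSolution_of_chain {G : DLogInstance} (hG : G.Valid) {u v : List Bool}
    (hl : u.length = v.length) (hne : u ≠ v) (h : G.chain u = G.chain v) :
    ∃ a ∈ G.trace u ++ G.trace v, ∃ b ∈ G.trace u ++ G.trace v,
      G.IsSolution (.pair (bc a) (bc b)) ∨ G.IsSolution (.single (subMod G.s (bc a) (bc b))) := by
  by_cases H : ∀ a ∈ G.trace u ++ G.trace v, ∀ b ∈ G.trace u ++ G.trace v, bc a < G.s →
      bc b < G.s → G.op (bc a) (bc b) < G.s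
  · have key : ∀ w, w <+: u ∨ w <+: v → (∃ a ∈ G.trace u ++ G.trace v, bc a = G.chain w) ∧
        G.chain w < G.s := by
      rintro w (hw | hw)
      · obtain ⟨a, ha, ha'⟩ := hG.chain_mem_trace hw
        exact ⟨⟨a, List.mem_append_left _ ha, ha'⟩, (hG.chain_lt (fun a ha b hb =>
          H a (List.mem_append_left _ ha) b (List.mem_append_left _ hb)) hw).1⟩
      · obtain ⟨a, ha, ha'⟩ := hG.chain_mem_trace hw
        exact ⟨⟨a, List.mem_append_right _ ha, ha'⟩, (hG.chain_lt (fun a ha b hb =>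
          H a (List.mem_append_right _ ha) b (List.mem_append_right _ hb)) hw).1⟩
    -- An index equal to an element of the coset of t: either the difference of the exponents is a
    -- logarithm of t, or it witnesses that the index is not a homomorphism.
    have mixed : ∀ x y, x < G.s → y < G.s → G.index x = G.op G.t (G.index y) →
        G.IsSolution (.pair x y) ∨ G.IsSolution (.single (subMod G.s x y)) := by
      intro x y hx hy hxy
      rw [subMod_eq hx hy]
      by_cases ht : G.index ((x + (G.s - y)) % G.s) = G.t
      · exact .inr (.log _ (Nat.mod_lt _ (by omega)) ht)
      · exact .inl (.notHomomorphic x y hx hy hxy ht)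
    obtain ⟨w, w', b, b', hw, hw', hn, hc⟩ := G.exists_chain_collision hl hne h
    obtain ⟨⟨x, hx, hxw⟩, hlt⟩ := key w (.inl hw)
    obtain ⟨⟨y, hy, hyw⟩, hlt'⟩ := key w' (.inr hw')
    rw [chain_concat, chain_concat] at hc
    rw [← hxw] at hn hc hlt
    rw [← hyw] at hn hc hlt'
    cases b <;> cases b'
    · exact ⟨x, hx, y, hy, .inl (.indexCollision _ _ hlt hlt' (by simpa using hn) (by simpa using hc))⟩
    · exact ⟨x, hx, y, hy, mixed _ _ hlt hlt' (by simpa using hc)⟩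
    · exact ⟨y, hy, x, hx, mixed _ _ hlt' hlt (by simpa using hc.symm)⟩
    · exact ⟨x, hx, y, hy, .inl (.cosetCollision _ _ hlt hlt' (by simpa using hn) (by simpa using hc))⟩
  -- Closure fails for two values of the trace, and these are a solution themselves.
  · push Not at H
    obtain ⟨a, ha, b, hb, h₁, h₂, h₃⟩ := H
    exact ⟨a, ha, b, hb, .inl (.outOfRange _ _ h₁ h₂ h₃)⟩

end DLogInstance

section

variable {γ : Type} [TreeEnc γ]

@[fun_prop]
theorem PTF.chainBits {G : γ → DLogInstance} {u : γ → List Bool} (hG : PTF G) (hu : PTF u) :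
    PTF fun c => (G c).chainBits (u c) := by
  have hgg := hG.dlogLen.bd hG.dlogT
  obtain ⟨q, hq⟩ := hG.dlogF.outputs.size
  unfold DLogInstance.chainBits
  refine PTF.foldl_bdd (step := fun c r b => (G c).chainStepBits r b)
    (hG.dlogLen.bd hG.dlogId) hu ?_ ⟨4 * q, fun c r b => ?_⟩
  · have h : PTF fun x : (γ × List Bool) × Bool =>
        TotalSearch.bd (G x.1.1).len (G x.1.1).t := hgg.comp (by fun_prop)
    have h' : PTF fun x : (γ × List Bool) × Bool =>
        (G x.1.1).powBits (bd₀ (bc x.1.2)) := PTF.dlogPowBits (by fun_prop) (PTF.bd₀_bc (by fun_prop))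
    exact PTF.cond (by fun_prop) (PTF.dlogOpBits (by fun_prop) h h') h'
  · have h₁ := (hq c).trans (eval_mono_nat q (Nat.le_add_right (tsize c) (tsize b)))
    simp only [Polynomial.eval_mul, Polynomial.eval_ofNat]
    refine le_trans ?_ (Nat.mul_le_mul_left 4 h₁)
    have h₂ : tsize ((G c).powBits (bd₀ (bc r))) ≤ 4 * tsize (G c).f.outputs := by
      have h₃ := length_bd₀ (bc r)
      generalize bd₀ (bc r) = e at h₃
      -- The representation of a number has at least one digit, so the last operation applied is the
      -- circuit, whose output length is known.
      cases e using List.reverseRecOn with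
      | nil => simp at h₃
      | append_singleton e b =>
        rw [DLogInstance.powBits_concat]
        split_ifs <;> exact DLogInstance.tsize_opBits_le _ _ _
    cases b
    · exact h₂
    · exact DLogInstance.tsize_opBits_le _ _ _

@[fun_prop]
theorem PTF.trace {G : γ → DLogInstance} {u : γ → List Bool} (hG : PTF G) (hu : PTF u) :
    PTF fun c => (G c).trace (u c) := by
  have h₁ : PTF fun x : γ × ℕ => (G x.1).chainBits ((u x.1).take x.2) := by fun_prop
  have h₂ := h₁.bd₀_bc
  have h₃ : PTF fun x : (γ × ℕ) × ℕ => (G x.1.1).powBits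
      ((bd₀ (bc ((G x.1.1).chainBits ((u x.1.1).take x.1.2)))).take x.2) :=
    PTF.dlogPowBits (by fun_prop) (PTF.take (by fun_prop) (h₂.comp (by fun_prop)))
  have h₄ := PTF.dlogOpBits (G := fun x : (γ × ℕ) × ℕ => G x.1.1) (by fun_prop) h₃ h₃
  unfold DLogInstance.trace
  refine ((hG.dlogLen.bd hG.dlogId).cons ((hG.dlogLen.bd hG.dlogG).cons
    ((hG.dlogLen.bd hG.dlogT).cons (PTF.const [])))).append ?_
  refine PTF.flatMap (by fun_prop) (h₁.cons ?_)
  exact PTF.flatMap (by fun_prop) (h₃.cons (h₄.cons (PTF.const [])))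

end

/-- The candidates for a solution of an instance of DLog, given a solution of the instance of
Collision. -/
def dlogCandidates (x y : List Bool) : List (List Bool) :=
  let G := DLogInstance.parse x
  let L := G.trace (parsePair y).1 ++ G.trace (parsePair y).2
  [] :: L.flatMap fun a => L.flatMap fun b => [(DLogAnswer.pair (bc a) (bc b)).encode,
    (DLogAnswer.single (subMod G.s (bc a) (bc b))).encode]

theorem ptf_dlogCandidates :
    PTF fun p : List Bool × List Bool => dlogCandidates p.1 p.2 := by
  have hL : PTF fun p : List Bool × List Bool =>
      (DLogInstance.parse p.1).trace (parsePair p.2).1 ++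
        (DLogInstance.parse p.1).trace (parsePair p.2).2 := by
    unfold parsePair
    fun_prop
  have ha : PTF fun x : ((List Bool × List Bool) × List Bool) × List Bool => bd₀ (bc x.1.2) :=
    PTF.bd₀_bc (by fun_prop)
  have hb : PTF fun x : ((List Bool × List Bool) × List Bool) × List Bool => bd₀ (bc x.2) :=
    PTF.bd₀_bc (by fun_prop)
  have hG : PTF fun x : ((List Bool × List Bool) × List Bool) × List Bool =>
    DLogInstance.parse x.1.1.1 := by fun_prop
  refine PTF.cons (PTF.const []) (PTF.flatMap hL (PTF.flatMap (hL.comp PTF.id'.fst) ?_))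
  exact (PTF.answerPair ha hb).answerEncode.cons
    ((PTF.answerSingle (hG.dlogS.subMod ha hb)).answerEncode.cons (PTF.const []))

theorem reducible_dlog_collision : Reducible DLog Collision := by
  obtain ⟨d, hd, hd'⟩ := exists_ptf_dlog
  refine reducible_of_candidates (f := fun x => (DLogInstance.parse x).chainCircuit.encode)
    (cands := dlogCandidates) (PTF.id'.dlogParse.chainCircuit.circuitEncode)
    ptf_dlogCandidates hd (fun x y => (hd' x y).1) fun x y hy => ?_
  simp only [hd']
  by_cases hx : (DLogInstance.parse x).Valid ∧ (DLogInstance.parse x).encode = x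
  · obtain ⟨hG, hx⟩ := hx
    have key : ∀ a, (DLogInstance.parse x).IsSolution a → DLog x a.encode := by
      intro a ha G' _ hG'
      refine ⟨a, ?_, rfl⟩
      rwa [← DLogInstance.parse_encode G', hG']
    obtain ⟨⟨u, v⟩, ⟨hu, hv, hne, huv⟩, rfl⟩ := hy _ ⟨hG.chainCircuit_wellFormed, by
      rw [hG.numOutputs_chainCircuit]; exact Nat.lt_succ_self _⟩ rfl
    dsimp only at hu hv hne huv
    rw [hG.eval_chainCircuit hu, hG.eval_chainCircuit hv] at huv
    obtain ⟨a, ha, b, hb, hab⟩ := hG.exists_isSolution_of_chain (hu.trans hv.symm) hne (by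
      rw [← hG.bc_chainBits, huv, hG.bc_chainBits])
    have hmem : ∀ z ∈ [(DLogAnswer.pair (bc a) (bc b)).encode,
        (DLogAnswer.single (subMod (DLogInstance.parse x).s (bc a) (bc b))).encode],
        z ∈ dlogCandidates x (block u ++ block v) := by
      intro z hz
      rw [dlogCandidates, parsePair_append]
      exact List.mem_cons_of_mem _ (List.mem_flatMap.2 ⟨a, ha, List.mem_flatMap.2 ⟨b, hb, hz⟩⟩)
    rcases hab with h | h
    · exact ⟨_, hmem _ (by simp), key _ h⟩
    · exact ⟨_, hmem _ (by simp), key _ h⟩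
  -- Every string solves a string that is not a valid instance; the candidate `[]` is listed for
  -- this case.
  · refine ⟨[], List.mem_cons_self, fun G hG hG' => absurd ⟨?_, ?_⟩ hx⟩
    · rwa [← hG', DLogInstance.parse_encode]
    · rw [← hG', DLogInstance.parse_encode]

open TreeEnc

/-! ### The reduction of Collision to DLog -/

/-- Extends a string to length `k` by zeroes. -/
def padRight (k : ℕ) (u : List Bool) : List Bool := u ++ List.replicate (k - u.length) false

theorem length_padRight {k : ℕ} {u : List Bool} (h : u.length ≤ k) : (padRight k u).length = k := by
  simp [padRight]; omega

theorem padRight_inj {k : ℕ} {u v : List Bool} (h : u.length = v.length)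
    (h' : padRight k u = padRight k v) : u = v :=
  (List.append_inj h' h).1

/-- The circuit for the control bits of the operation. -/
def controlCircuit : Circuit :=
  ⟨4, [.input 0, .input 1, .input 2, .input 3, .conj 0 1, .neg 0, .conj 1 3, .disj 5 6, .neg 1,
    .conj 0 8, .conj 5 3, .disj 9 10], [4, 7, 11]⟩

theorem controlCircuit_wellFormed : controlCircuit.WellFormed :=
  (Circuit.check_iff _).1 rfl

/-- The outputs are the two control bits of the product and whether the second argument is to be
compressed. A left factor with pq = 10 acts as g: compress with 1 and clear the pending digit. With
11 it acts as t: set the first bit, leave the rest. With p = 0, as in a square, it compresses with 0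
if q' says that a digit 0 is pending, and announces a new one. -/
theorem eval_controlCircuit (p q p' q' : Bool) : controlCircuit.eval [p, q, p', q'] =
    [p && q, !p || (q && q'), (p && !q) || (!p && q')] := rfl

theorem DLogInstance.index_eq_bc (G : DLogInstance) (x : ℕ) :
    G.index x = bc (G.powBits (bd₀ x)) := rfl

/-! ### Hashing with a compressing circuit, and the operation that performs it -/

namespace Circuit

/-- The function `w ↦ 0 C(b C(w))` on strings whose length is the number of inputs, with outputs
padded by zeroes. -/
def compress (C : Circuit) (w : List Bool) (b : Bool) : List Bool :=
  false :: padRight (C.numInputs - 1) (C.eval (b :: padRight (C.numInputs - 1) (C.eval w)))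

/-- The starting point of chains, which is not in the image of the compressing functions. -/
def start (C : Circuit) : List Bool := true :: List.replicate (C.numInputs - 1) false

/-- The chain of the compressing functions. -/
def hash (C : Circuit) (u : List Bool) : List Bool := u.foldl C.compress C.start

theorem hash_concat (C : Circuit) (u : List Bool) (b : Bool) :
    C.hash (u ++ [b]) = C.compress (C.hash u) b := by
  simp [hash]

theorem length_eval (C : Circuit) (u : List Bool) : (C.eval u).length = C.numOutputs := by
  simp [eval, numOutputs]

/-- The circuit with at least one input computes a function to strictly shorter strings. -/
structure Compresses (C : Circuit) : Prop where
  wellFormed : C.WellFormed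
  lt : C.numOutputs < C.numInputs

section

variable {C : Circuit}

theorem Compresses.length_compress (hC : C.Compresses) (w : List Bool) (b : Bool) :
    (C.compress w b).length = C.numInputs := by
  have := hC.lt
  rw [compress, List.length_cons, length_padRight (by rw [length_eval]; omega)]
  omega

theorem Compresses.length_hash (hC : C.Compresses) (u : List Bool) :
    (C.hash u).length = C.numInputs := by
  induction u using List.reverseRecOn with
  | nil =>
    have := hC.lt
    simp [hash, start]
    omega
  | append_singleton u b _ => rw [hash_concat, hC.length_compress]

/-- The inputs of the circuit that are relevant for a value of the chain. -/
def hashInputs (C : Circuit) (u : List Bool) : List (List Bool) :=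
  (List.range (u.length + 1)).flatMap fun i =>
    [C.hash (u.take i), false :: padRight (C.numInputs - 1) (C.eval (C.hash (u.take i))),
      true :: padRight (C.numInputs - 1) (C.eval (C.hash (u.take i)))]

theorem mem_hashInputs {u w : List Bool} (hw : w <+: u) : C.hash w ∈ C.hashInputs u ∧
    ∀ b, (b :: padRight (C.numInputs - 1) (C.eval (C.hash w))) ∈ C.hashInputs u := by
  have h : w = u.take w.length := List.prefix_iff_eq_take.1 hw
  have hr : w.length ∈ List.range (u.length + 1) :=
    List.mem_range.2 (Nat.lt_succ_of_le hw.length_le)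
  refine ⟨List.mem_flatMap.2 ⟨_, hr, ?_⟩, fun b => List.mem_flatMap.2 ⟨_, hr, ?_⟩⟩
  · rw [← h]; simp
  · rw [← h]; cases b <;> simp

/-- A collision of the chain yields a collision of the circuit. -/
theorem Compresses.exists_collision (hC : C.Compresses) {u v e e' : List Bool} (he : e <+: u)
    (he' : e' <+: v) (hne : e ≠ e') (h : C.hash e = C.hash e') :
    ∃ a ∈ C.hashInputs u, ∃ b ∈ C.hashInputs v, a.length = C.numInputs ∧ b.length = C.numInputs ∧
      a ≠ b ∧ C.eval a = C.eval b := by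
  induction e using List.reverseRecOn generalizing e' with
  | nil =>
    cases e' using List.reverseRecOn with
    | nil => exact absurd rfl hne
    | append_singleton e' b' =>
      rw [hash_concat] at h
      -- The starting point begins with 1, every other value of the chain with 0. This allows
      -- strings of different lengths.
      exact absurd (List.cons.inj h).1 (by simp)
  | append_singleton e b ih =>
    cases e' using List.reverseRecOn with
    | nil =>
      rw [hash_concat] at h
      exact absurd (List.cons.inj h).1 (by simp)
    | append_singleton e' b' =>
      rw [hash_concat, hash_concat] at h
      have h₁ := padRight_inj (by rw [length_eval, length_eval]) (List.cons.inj h).2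
      have p := (List.prefix_append e [b]).trans he
      have p' := (List.prefix_append e' [b']).trans he'
      have hl : ∀ b w, (b :: padRight (C.numInputs - 1) (C.eval w)).length = C.numInputs := by
        intro b w
        have := hC.lt
        rw [List.length_cons, length_padRight (by rw [length_eval]; omega)]
        omega
      -- The outer applications of the circuit agree in value. If their inputs differ, this is a
      -- collision; otherwise the bits agree, and either the inner applications collide or the
      -- shorter strings have the same hash.
      by_cases h₂ : b :: padRight (C.numInputs - 1) (C.eval (C.hash e)) =
          b' :: padRight (C.numInputs - 1) (C.eval (C.hash e'))
      · obtain ⟨rfl, h₃⟩ := List.cons.inj h₂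
        have h₄ := padRight_inj (by rw [length_eval, length_eval]) h₃
        by_cases h₅ : C.hash e = C.hash e'
        · exact ih p p' (fun h => hne (by rw [h])) h₅
        · exact ⟨_, (mem_hashInputs p).1, _, (mem_hashInputs p').1, hC.length_hash _,
            hC.length_hash _, h₅, h₄⟩
      · exact ⟨_, (mem_hashInputs p).2 b, _, (mem_hashInputs p').2 b', hl _ _, hl _ _, h₂, h₁⟩

/-- Adds gates for the compressing function; `z` is the position of a gate with value `0`. -/
def compressGates (C : Circuit) (z b : ℕ) (ws : List ℕ) (gs : List Gate) : List Gate × List ℕ :=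
  let k := C.numInputs - 1 - C.outputs.length
  let gs' := copyGates C ws gs
  (copyGates C (b :: (copyOutputs C gs.length ++ List.replicate k z)) gs',
    z :: (copyOutputs C gs'.length ++ List.replicate k z))

theorem _root_.TotalSearch.WireValues.replicate {gs : List Gate} {u : List Bool} {w : ℕ} {b : Bool}
    (h : WireValues gs u [w] [b]) (k : ℕ) :
    WireValues gs u (List.replicate k w) (List.replicate k b) := by
  induction k with
  | zero => exact WireValues.nil
  | succ k ih => exact h.append ih

theorem Compresses.compress_spec (hC : C.Compresses) {n z b : ℕ} {ws : List ℕ} {gs : List Gate}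
    {u w : List Bool} {p : Bool} (hgs : GatesWellFormed n gs) (hz : WireValues gs u [z] [false])
    (hb : WireValues gs u [b] [p]) (hw : WireValues gs u ws w) (hl : ws.length = C.numInputs) :
    GatesExtend n (C.gates.length + C.gates.length) gs (C.compressGates z b ws gs).1 ∧
      WireValues (C.compressGates z b ws gs).1 u (C.compressGates z b ws gs).2 (C.compress w p) ∧
      (C.compressGates z b ws gs).2.length = C.numInputs := by
  have hlt := hC.lt
  have e₁ := gatesExtend_copy hC.wellFormed hgs hw.lt hl
  have v₁ := wireValues_copy hC.wellFormed hw hl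
  have r := (hz.mono e₁.isPrefix).replicate (C.numInputs - 1 - C.outputs.length)
  have hk : ∀ w, padRight (C.numInputs - 1) (C.eval w) =
      C.eval w ++ List.replicate (C.numInputs - 1 - C.outputs.length) false := fun w => by
    rw [padRight, length_eval, numOutputs]
  have v₂ := (hb.mono e₁.isPrefix).append (v₁.append r)
  rw [← hk] at v₂
  have hl' : ∀ a k, (a :: (copyOutputs C k ++ List.replicate
      (C.numInputs - 1 - C.outputs.length) z)).length = C.numInputs := by
    intro a k
    rw [List.length_cons, List.length_append, length_copyOutputs, List.length_replicate]
    unfold numOutputs at *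
    omega
  have e₂ := gatesExtend_copy hC.wellFormed e₁.wellFormed v₂.lt (hl' _ _)
  have v₃ := wireValues_copy hC.wellFormed v₂ (hl' _ _)
  have v₄ := ((hz.mono e₁.isPrefix).mono e₂.isPrefix).append (v₃.append (r.mono e₂.isPrefix))
  rw [← hk] at v₄
  exact ⟨e₁.trans e₂, v₄, hl' _ _⟩

/-- The input variables of the operation and the constant `0`. -/
def opBase (C : Circuit) : List Gate :=
  (List.range (2 * (C.numInputs + 2))).map Gate.input ++ [Gate.const false]

/-- The gates and outputs of the operation. -/
def groupOpGates (C : Circuit) : List Gate × List ℕ :=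
  let n := C.numInputs
  let w := newWires (n + 4) n
  let x := C.compressGates (2 * (n + 2)) 0 w C.opBase
  let y := copyGates controlCircuit [0, 1, n + 2, n + 3] x.1
  (muxGates (x.1.length + 11) x.2 w y,
    (x.1.length + 4) :: (x.1.length + 7) :: muxOutputs y.length x.2.length)

/-- The operation on strings of length `n + 2`. -/
def groupOp (C : Circuit) : Circuit :=
  ⟨2 * (C.numInputs + 2), C.groupOpGates.1, C.groupOpGates.2⟩

/-- With n inputs of C, the string w' starts at position n + 4 and the constant 0 is at 2(n + 2),
after all inputs. The compressed string is always computed, and a selection controlled by the third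
output of the control circuit uses or discards it. The offsets 4, 7, 11 are the output positions
inside the copy of the control circuit. -/
theorem Compresses.groupOpGates_spec (hC : C.Compresses) {p q p' q' : Bool} {w w' : List Bool}
    (hw : w.length = C.numInputs) (hw' : w'.length = C.numInputs) :
    GatesWellFormed (2 * (C.numInputs + 2)) C.groupOpGates.1 ∧
      WireValues C.groupOpGates.1 ((p :: q :: w) ++ (p' :: q' :: w')) C.groupOpGates.2
        ((p && q) :: (!p || (q && q')) ::
          bif (p && !q) || (!p && q') then C.compress w' p else w') ∧
      C.groupOpGates.2.length = C.numInputs + 2 := by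
  have wf : ∀ g ∈ C.opBase, g.WellFormed (2 * (C.numInputs + 2)) ([] : List Gate).length := by
    intro g hg
    simp only [opBase, List.mem_append, List.mem_map, List.mem_range, List.mem_singleton] at hg
    rcases hg with ⟨i, hi, rfl⟩ | rfl
    · exact hi
    · trivial
  have e := gatesExtend_layer (gs := []) (fun k g hk => by simp at hk) _ wf
  have v := wireValues_layer (u := (p :: q :: w) ++ (p' :: q' :: w')) _ wf
  have hlen : ((p :: q :: w) ++ (p' :: q' :: w')).length = 2 * (C.numInputs + 2) := by
    simp [hw, hw']; ring
  have hv : C.opBase.map (fun g => g.value ((p :: q :: w) ++ (p' :: q' :: w'))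
      (gateValues [] ((p :: q :: w) ++ (p' :: q' :: w')))) =
      [p] ++ ([q] ++ (w ++ ([p'] ++ ([q'] ++ (w' ++ [false]))))) := by
    simp only [opBase, List.map_append, List.map_map]
    have := map_range_getD _ _ hlen
    refine (congrArg (· ++ [false]) this).trans ?_
    simp
  have hbl : C.opBase.length = 1 + (1 + (C.numInputs + (1 + (1 + (C.numInputs + 1))))) := by
    simp [opBase]; ring
  generalize hu : (p :: q :: w) ++ (p' :: q' :: w') = u at *
  -- The base wires are cut into those of p, q, w, p', q', w' and 0, one block after the other.
  rw [hv, hbl, List.nil_append, List.length_nil, newWires_add 0 1, newWires_add (0 + 1) 1,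
    newWires_add (0 + 1 + 1) C.numInputs, newWires_add (0 + 1 + 1 + C.numInputs) 1,
    newWires_add (0 + 1 + 1 + C.numInputs + 1) 1,
    newWires_add (0 + 1 + 1 + C.numInputs + 1 + 1) C.numInputs] at v
  obtain ⟨vp, v⟩ := v.of_append (by simp [length_newWires])
  obtain ⟨vq, v⟩ := v.of_append (by simp [length_newWires])
  obtain ⟨-, v⟩ := v.of_append (by simp [length_newWires, hw])
  obtain ⟨vp', v⟩ := v.of_append (by simp [length_newWires])
  obtain ⟨vq', v⟩ := v.of_append (by simp [length_newWires])
  obtain ⟨vw', vz⟩ := v.of_append (by simp [length_newWires, hw'])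
  have hz : newWires (0 + 1 + 1 + C.numInputs + 1 + 1 + C.numInputs) 1 =
      [2 * (C.numInputs + 2)] := by simp [newWires]; ring
  have hw₁ : newWires (0 + 1 + 1 + C.numInputs + 1 + 1) C.numInputs =
      newWires (C.numInputs + 4) C.numInputs := by congr 1; ring
  have hq₁ : newWires (0 + 1 + 1 + C.numInputs + 1) 1 = [C.numInputs + 3] := by
    simp [newWires]; ring
  have hp₁ : newWires (0 + 1 + 1 + C.numInputs) 1 = [C.numInputs + 2] := by
    simp [newWires]; ring
  have hq₀ : newWires (0 + 1) 1 = [1] := rfl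
  have hp₀ : newWires 0 1 = [0] := rfl
  rw [hz] at vz
  rw [hw₁] at vw'
  rw [hq₁] at vq'
  rw [hp₁] at vp'
  rw [hq₀] at vq
  rw [hp₀] at vp
  rw [List.nil_append] at e
  obtain ⟨e₁, v₁, l₁⟩ := hC.compress_spec e.wellFormed vz vp vw' (length_newWires _ _)
  have v₂ := (vp.append (vq.append (vp'.append vq'))).mono e₁.isPrefix
  have e₂ := gatesExtend_copy controlCircuit_wellFormed e₁.wellFormed v₂.lt rfl
  have v₃ := wireValues_copy controlCircuit_wellFormed v₂ rfl
  simp only [List.cons_append, List.nil_append] at v₃ e₂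
  rw [eval_controlCircuit] at v₃
  obtain ⟨e₃, v₄⟩ := mux_spec e₂.wellFormed v₃.tail.tail.head (v₁.mono e₂.isPrefix)
    ((vw'.mono e₁.isPrefix).mono e₂.isPrefix) (by rw [l₁, length_newWires])
  refine ⟨e₃.wellFormed, ?_, ?_⟩
  · exact (v₃.head.mono e₃.isPrefix).append ((v₃.tail.head.mono e₃.isPrefix).append v₄)
  · simp [groupOpGates, muxOutputs, length_newWires, l₁]

theorem Compresses.groupOp_isOp (hC : C.Compresses) : C.groupOp.IsOp (C.numInputs + 2) := by
  obtain ⟨h, h', hl⟩ := hC.groupOpGates_spec (p := false) (q := false) (p' := false) (q' := false)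
    (w := List.replicate C.numInputs false) (w' := List.replicate C.numInputs false) (by simp)
    (by simp)
  exact ⟨⟨h, h'.lt⟩, rfl, hl⟩

theorem Compresses.eval_groupOp (hC : C.Compresses) {p q p' q' : Bool} {w w' : List Bool}
    (hw : w.length = C.numInputs) (hw' : w'.length = C.numInputs) :
    C.groupOp.eval ((p :: q :: w) ++ (p' :: q' :: w')) = (p && q) :: (!p || (q && q')) ::
      bif (p && !q) || (!p && q') then C.compress w' p else w' :=
  (hC.groupOpGates_spec hw hw').2.1.map

/-- The instance of DLog for a compressing circuit. -/
def toDLog (C : Circuit) : DLogInstance where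
  s := bc (true :: List.replicate (C.numInputs + 2) false)
  f := C.groupOp
  id := bc (false :: false :: C.start)
  g := bc (true :: false :: List.replicate C.numInputs false)
  t := bc (true :: true :: List.replicate C.numInputs false)

theorem toDLog_t (C : Circuit) :
    C.toDLog.t = bc (true :: true :: List.replicate C.numInputs false) := rfl

/-- A power of two, so that every string of the right length is an element and no product is out of
range. -/
theorem toDLog_s (C : Circuit) : C.toDLog.s = 2 ^ (C.numInputs + 2) := by
  rw [toDLog, bc_cons, bc_replicate_false]
  simp

theorem toDLog_len (C : Circuit) : C.toDLog.len = C.numInputs + 2 := by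
  rw [DLogInstance.len, toDLog_s, Nat.clog_pow 2 _ (by norm_num)]

theorem Compresses.length_start (hC : C.Compresses) : C.start.length = C.numInputs :=
  hC.length_hash []

theorem Compresses.bd_id (hC : C.Compresses) :
    bd C.toDLog.len C.toDLog.id = false :: false :: C.start := by
  have h := bd_bc (false :: false :: C.start)
  rw [List.length_cons, List.length_cons, hC.length_start] at h
  rw [toDLog_len]
  exact h

theorem bd_g (C : Circuit) :
    bd C.toDLog.len C.toDLog.g = true :: false :: List.replicate C.numInputs false := by
  have h := bd_bc (true :: false :: List.replicate C.numInputs false)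
  rw [List.length_cons, List.length_cons, List.length_replicate] at h
  rw [toDLog_len]
  exact h

theorem bd_t (C : Circuit) :
    bd C.toDLog.len C.toDLog.t = true :: true :: List.replicate C.numInputs false := by
  have h := bd_bc (true :: true :: List.replicate C.numInputs false)
  rw [List.length_cons, List.length_cons, List.length_replicate] at h
  rw [toDLog_len]
  exact h

theorem Compresses.valid_toDLog (hC : C.Compresses) : C.toDLog.Valid := by
  have hlt : ∀ u : List Bool, u.length = C.numInputs + 2 → bc u < C.toDLog.s := by
    intro u hu
    rw [toDLog_s, ← hu]
    exact bc_lt u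
  have hop := hC.groupOp_isOp
  refine ⟨?_, hop.wellFormed, ?_, ?_, hlt _ ?_, hlt _ (by simp), hlt _ (by simp)⟩
  · rw [toDLog_s, pow_add]
    have := Nat.one_le_two_pow (n := C.numInputs)
    omega
  · rw [toDLog_len]; rfl
  · rw [toDLog_len]; exact hop.numOutputs
  · simp [hC.length_start]

/-- Squaring carries out a pending digit 0, if there is one, and announces the next. So all of `e`
has been hashed afterwards, whichever its last digit was. -/
theorem Compresses.sq_powBits (hC : C.Compresses) (e : List Bool) :
    C.toDLog.opBits (C.toDLog.powBits e) (C.toDLog.powBits e) = false :: true :: C.hash e := by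
  induction e using List.reverseRecOn with
  | nil =>
    change C.groupOp.eval (bd C.toDLog.len C.toDLog.id ++ bd C.toDLog.len C.toDLog.id) = _
    rw [hC.bd_id, hC.eval_groupOp hC.length_start hC.length_start]
    rfl
  | append_singleton e b ih =>
    rw [DLogInstance.powBits_concat, ih, hash_concat]
    cases b with
    | false =>
      change C.groupOp.eval ((false :: true :: C.hash e) ++ (false :: true :: C.hash e)) = _
      rw [hC.eval_groupOp (hC.length_hash e) (hC.length_hash e)]
      rfl
    | true =>
      have h : C.toDLog.opBits (bd C.toDLog.len C.toDLog.g) (false :: true :: C.hash e) =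
          false :: false :: C.compress (C.hash e) true := by
        rw [bd_g]
        exact (hC.eval_groupOp (by simp) (hC.length_hash e)).trans rfl
      rw [if_pos rfl, h]
      exact (hC.eval_groupOp (hC.length_compress _ _) (hC.length_compress _ _)).trans rfl

/-- A last digit 1 has been hashed, a last digit 0 is still pending, and the second bit tells which.
The empty string is excluded, but exponents have at least one digit. -/
theorem Compresses.powBits_concat (hC : C.Compresses) (e : List Bool) (b : Bool) :
    C.toDLog.powBits (e ++ [b]) =
      bif b then false :: false :: C.hash (e ++ [true]) else false :: true :: C.hash e := by
  rw [DLogInstance.powBits_concat, hC.sq_powBits]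
  cases b with
  | false => rfl
  | true =>
    rw [if_pos rfl, bd_g, hash_concat]
    exact (hC.eval_groupOp (by simp) (hC.length_hash e)).trans rfl

theorem exists_bd₀_eq_concat (x : ℕ) : ∃ e b, bd₀ x = e ++ [b] := by
  have h := length_bd₀ x
  generalize bd₀ x = u at h
  cases u using List.reverseRecOn with
  | nil => simp at h
  | append_singleton e b => exact ⟨e, b, rfl⟩

theorem Compresses.exists_powBits_eq (hC : C.Compresses) (x : ℕ) :
    ∃ q w, C.toDLog.powBits (bd₀ x) = false :: q :: w ∧ w.length = C.numInputs := by
  obtain ⟨e, b, h⟩ := exists_bd₀_eq_concat x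
  rw [h, hC.powBits_concat]
  cases b
  · exact ⟨_, _, rfl, hC.length_hash _⟩
  · exact ⟨_, _, rfl, hC.length_hash _⟩

/-- Equal indices have equal second bits, so the exponents have the same last digit. If it is 1, the
full digit strings have the same hash; if it is 0, the strings without it do, and they differ
because the full ones do. -/
theorem Compresses.exists_hash_eq (hC : C.Compresses) {x y : ℕ} (hne : x ≠ y)
    (h : C.toDLog.index x = C.toDLog.index y) :
    ∃ e e', e <+: bd₀ x ∧ e' <+: bd₀ y ∧ e ≠ e' ∧ C.hash e = C.hash e' := by
  have hv := hC.valid_toDLog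
  have h₁ : C.toDLog.powBits (bd₀ x) = C.toDLog.powBits (bd₀ y) :=
    bc_inj (by rw [hv.length_powBits, hv.length_powBits]) h
  have h₂ : bd₀ x ≠ bd₀ y := fun h => hne (bd₀_injective h)
  obtain ⟨e, b, hx⟩ := exists_bd₀_eq_concat x
  obtain ⟨e', b', hy⟩ := exists_bd₀_eq_concat y
  rw [hx, hy] at h₁ h₂
  rw [hx, hy]
  rw [hC.powBits_concat, hC.powBits_concat] at h₁
  cases b <;> cases b'
  · exact ⟨e, e', List.prefix_append _ _, List.prefix_append _ _, fun h => h₂ (by rw [h]),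
      by simpa using h₁⟩
  · simp at h₁
  · simp at h₁
  · exact ⟨_, _, List.prefix_refl _, List.prefix_refl _, h₂, by simpa using h₁⟩

/-- On indices, whose first bit is 0, multiplication by t changes this bit and nothing else. It is
thus injective on indices and leads outside of them. -/
theorem Compresses.op_t (hC : C.Compresses) (y : ℕ) : ∃ q w, w.length = C.numInputs ∧
    C.toDLog.powBits (bd₀ y) = false :: q :: w ∧
    C.toDLog.op C.toDLog.t (C.toDLog.index y) = bc (true :: q :: w) := by
  obtain ⟨q, w, h, hw⟩ := hC.exists_powBits_eq y
  refine ⟨q, w, hw, h, ?_⟩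
  have h₁ := bd_bc (false :: q :: w)
  rw [List.length_cons, List.length_cons, hw, ← toDLog_len] at h₁
  rw [DLogInstance.op, DLogInstance.index_eq_bc, h, h₁, bd_t]
  refine congrArg bc ((hC.eval_groupOp (by simp) hw).trans ?_)
  simp

/-- A solution of the instance of DLog yields a collision of the chain. -/
theorem Compresses.exists_hash_eq_of_isSolution (hC : C.Compresses) {a : DLogAnswer}
    (ha : C.toDLog.IsSolution a) : ∃ e e', e <+: bd₀ a.triple.2.1 ∧ e' <+: bd₀ a.triple.2.2 ∧
      e ≠ e' ∧ C.hash e = C.hash e' := by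
  cases ha with
  | log x hx h =>
    obtain ⟨q, w, hq, hw⟩ := hC.exists_powBits_eq x
    rw [DLogInstance.index_eq_bc, hq, toDLog_t] at h
    -- An index begins with 0, but t begins with 1.
    exact absurd (List.cons.inj (bc_inj (by simp [hw]) h)).1 (by simp)
  | outOfRange x y hx hy h =>
    have h₁ := DLogInstance.length_opBits C.toDLog (bd C.toDLog.len x) (bd C.toDLog.len y)
    have h₂ := hC.valid_toDLog.2.2.2.1.trans C.toDLog_len
    rw [DLogInstance.op] at h
    generalize C.toDLog.opBits _ _ = r at h h₁
    have h₃ := bc_lt r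
    rw [h₁, h₂, ← toDLog_s] at h₃
    exact absurd (h.trans_lt h₃) (lt_irrefl _)
  | indexCollision x y hx hy hne h => exact hC.exists_hash_eq hne h
  | cosetCollision x y hx hy hne h =>
    refine hC.exists_hash_eq (x := x) (y := y) hne ?_
    obtain ⟨q, w, hw, hq, h₁⟩ := hC.op_t x
    obtain ⟨q', w', hw', hq', h₂⟩ := hC.op_t y
    rw [h₁, h₂] at h
    obtain ⟨-, h₃⟩ := List.cons.inj (bc_inj (by simp [hw, hw']) h)
    rw [DLogInstance.index_eq_bc, DLogInstance.index_eq_bc, hq, hq', h₃]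
  | notHomomorphic x y hx hy h _ =>
    obtain ⟨q, w, hq, hw⟩ := hC.exists_powBits_eq x
    obtain ⟨q', w', hw', -, h₂⟩ := hC.op_t y
    rw [DLogInstance.index_eq_bc, hq, h₂] at h
    -- The left side begins with 0, the product with t begins with 1.
    exact absurd (List.cons.inj (bc_inj (by simp [hw, hw']) h)).1 (by simp)

end

end Circuit

/-! ### Computing the instance of DLog and the candidates for a collision -/

section

variable {γ : Type} [TreeEnc γ]

@[fun_prop]
theorem PTF.padRight {k : γ → ℕ} {u : γ → List Bool} (hk : PTF k) (hu : PTF u) :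
    PTF fun c => padRight (k c) (u c) := by
  unfold TotalSearch.padRight
  fun_prop

@[fun_prop]
theorem PTF.compressStart {C : γ → Circuit} (hC : PTF C) : PTF fun c => (C c).start := by
  unfold Circuit.start
  fun_prop

@[fun_prop]
theorem PTF.compress {C : γ → Circuit} {w : γ → List Bool} {b : γ → Bool} (hC : PTF C) (hw : PTF w)
    (hb : PTF b) : PTF fun c => (C c).compress (w c) (b c) := by
  unfold Circuit.compress
  fun_prop

@[fun_prop]
theorem PTF.hash {C : γ → Circuit} {u : γ → List Bool} (hC : PTF C) (hu : PTF u) :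
    PTF fun c => (C c).hash (u c) := by
  obtain ⟨q, hq⟩ := hC.size
  unfold Circuit.hash
  refine PTF.foldl_bdd (step := fun c w b => (C c).compress w b) (by fun_prop) hu (by fun_prop)
    ⟨8 * q + 10, fun c w b => ?_⟩
  have h₁ := (hq c).trans (eval_mono_nat q (Nat.le_add_right (tsize c) (tsize b)))
  rw [tsize_circuit, tsize_mk, tsize_mk, tsize_nat] at h₁
  have h₂ := length_lt_tsize (C c).outputs
  have h₃ := tsize_list_le (l := (C c).compress w b) (m := 3) fun b _ => tsize_bool b
  have h₄ : ((C c).compress w b).length ≤ (C c).outputs.length + (C c).numInputs + 1 := by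
    simp [Circuit.compress, TotalSearch.padRight, Circuit.length_eval, Circuit.numOutputs]
    omega
  simp only [Polynomial.eval_add, Polynomial.eval_mul, Polynomial.eval_ofNat]
  omega

@[fun_prop]
theorem PTF.hashInputs {C : γ → Circuit} {u : γ → List Bool} (hC : PTF C) (hu : PTF u) :
    PTF fun c => (C c).hashInputs (u c) := by
  unfold Circuit.hashInputs
  exact PTF.flatMap (by fun_prop) (by fun_prop)

@[fun_prop]
theorem PTF.compressGates {C : γ → Circuit} {z b : γ → ℕ} {ws : γ → List ℕ} {gs : γ → List Gate}
    (hC : PTF C) (hz : PTF z) (hb : PTF b) (hws : PTF ws) (hgs : PTF gs) :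
    PTF fun c => (C c).compressGates (z c) (b c) (ws c) (gs c) := by
  have h := hC.copyGates hws hgs
  unfold Circuit.compressGates
  fun_prop

@[fun_prop]
theorem PTF.groupOp {C : γ → Circuit} (hC : PTF C) : PTF fun c => (C c).groupOp := by
  have h₀ : PTF fun c => (C c).opBase :=
    (PTF.map (by fun_prop) (by fun_prop)).append (PTF.const [Gate.const false])
  have hw : PTF fun c => TotalSearch.newWires ((C c).numInputs + 4) (C c).numInputs := by fun_prop
  have hx := hC.compressGates (z := fun c => 2 * ((C c).numInputs + 2)) (b := fun _ => 0)
    (by fun_prop) (by fun_prop) hw h₀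
  have hy := (PTF.const controlCircuit).copyGates
    (ws := fun c => [0, 1, (C c).numInputs + 2, (C c).numInputs + 3]) (by fun_prop) hx.fst
  have hg : PTF fun c => (C c).groupOpGates :=
    ((hx.fst.length.add (PTF.const 11)).muxGates hx.snd hw hy).prodMk
      ((hx.fst.length.add (PTF.const 4)).cons ((hx.fst.length.add (PTF.const 7)).cons
        (hy.length.muxOutputs hx.snd.length)))
  unfold Circuit.groupOp
  fun_prop

@[fun_prop]
theorem PTF.toDLog {C : γ → Circuit} (hC : PTF C) : PTF fun c => (C c).toDLog :=
  PTF.dlogMk (PTF.bd₀_bc (by fun_prop)) hC.groupOp (PTF.bd₀_bc (by fun_prop))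
    (PTF.bd₀_bc (by fun_prop)) (PTF.bd₀_bc (by fun_prop))

end

/-- The candidates for a solution of an instance of Collision, given a solution of the instance of
DLog. -/
def collisionCandidates (x y : List Bool) : List (List Bool) :=
  let C := (parseCircuit x).1
  let a := (DLogAnswer.parse y).triple
  [] :: (C.hashInputs (bd₀ a.2.1)).flatMap fun u => (C.hashInputs (bd₀ a.2.2)).map fun v =>
    block u ++ block v

theorem ptf_collisionCandidates :
    PTF fun p : List Bool × List Bool => collisionCandidates p.1 p.2 := by
  have ha : PTF fun p : List Bool × List Bool => DLogAnswer.parse p.2 := by fun_prop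
  have h₁ := ha.answerTriple.snd.fst
  have h₂ := ha.answerTriple.snd.snd
  have h₃ := PTF.hashInputs (C := fun p : List Bool × List Bool => (parseCircuit p.1).1)
    (by fun_prop) h₁
  have h₄ := PTF.hashInputs (C := fun p : List Bool × List Bool => (parseCircuit p.1).1)
    (by fun_prop) h₂
  exact PTF.cons (PTF.const []) (PTF.flatMap h₃ (PTF.map (h₄.comp PTF.id'.fst) (by fun_prop)))

theorem reducible_collision_dlog : Reducible Collision DLog := by
  obtain ⟨d, hd, hd'⟩ := exists_ptf_collision
  refine reducible_of_candidates (f := fun x => (parseCircuit x).1.toDLog.encode)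
    (cands := collisionCandidates) PTF.id'.parseCircuit.fst.toDLog.dlogEncode
    ptf_collisionCandidates hd (fun x y => (hd' x y).1) fun x y hy => ?_
  simp only [hd']
  by_cases hx : (parseCircuit x).1.Compresses ∧ (parseCircuit x).1.encode = x
  · obtain ⟨hC, hx⟩ := hx
    obtain ⟨a, ha, rfl⟩ := hy _ hC.valid_toDLog rfl
    obtain ⟨e, e', he, he', hne, h⟩ := hC.exists_hash_eq_of_isSolution ha
    -- The colliding inputs occur in the hash computations for the two numbers of the answer, so
    -- they are among the candidates.
    obtain ⟨u, hu, v, hv, hul, hvl, huv, h'⟩ := hC.exists_collision he he' hne h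
    refine ⟨block u ++ block v, ?_, fun C _ hC' => ⟨(u, v), ?_, rfl⟩⟩
    · rw [collisionCandidates, DLogAnswer.parse_encode]
      exact List.mem_cons_of_mem _ (List.mem_flatMap.2 ⟨u, hu, List.mem_map.2 ⟨v, hv, rfl⟩⟩)
    · rw [← parseCircuit_encode C, hC']
      exact ⟨hul, hvl, huv, h'⟩
  · refine ⟨[], List.mem_cons_self, fun C hC hC' => absurd ⟨?_, ?_⟩ hx⟩
    · rw [← hC', parseCircuit_encode]
      exact ⟨hC.1, hC.2⟩
    · rw [← hC', parseCircuit_encode]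

end TotalSearch

/-- The search problem DLog is PWPP-complete. -/
theorem mainTheorem1 : TotalSearch.IsPWPPComplete TotalSearch.DLog :=
  ⟨⟨TotalSearch.isTFNP_dlog, TotalSearch.reducible_dlog_collision⟩,
    fun _ hS => hS.2.trans TotalSearch.reducible_collision_dlog⟩
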